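/- Let $\Omega\subseteq\mathbb{C}$ be a domain (a non-empty connected open set) of infinite connectivity, that is, the complement of $\Omega$ in the Riemann sphere $\hat{\mathbb{C}}=\mathbb{C}\cup\{\infty\}$ has infinitely many connected components. Let $\mathcal{H}_{l.u.}(\Omega)$ denote the set of all locally univalent holomorphic functions on $\Omega$, i.e. of all holomorphic $f:\Omega\to\mathbb{C}$ with $f'(z)\neq 0$ for all $z\in\Omega$, equipped with the topology of locally uniform convergence. A compact set $K\subseteq\Omega$ is called $\mathcal{O}$-convex if no connected component of $\Omega\setminus K$ is relatively compact in $\Omega$. Let $\Phi$ be a family of locally univalent self-maps of $\Omega$ (holomorphic maps $\phi:\Omega\to\Omega$ with nowhere vanishing derivative). A function $G\in\mathcal{H}_{l.u.}(\Omega)$ is called $\Phi$-universal in $\mathcal{H}_{l.u.}(\Omega)$ if $\{G\circ\phi : \phi\in\Phi\}$ is a dense subset of $\mathcal{H}_{l.u.}(\Omega)$. Suppose that there exists a sequence $(\phi_n)$ in $\Phi$ such that (i) $(\phi_n)$ is eventually injective: for every compact set $K\subseteq\Omega$ there exists $N\in\mathbb{N}$ such that $\phi_n|_K$ is injective for all $n\ge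 N$; and (ii) for every $\mathcal{O}$-convex compact set $K\subseteq\Omega$ and every $N\in\mathbb{N}$ there exists $n\ge N$ such that $\phi_n(K)\cap K=\emptyset$ and $\phi_n(K)\cup K$ is $\mathcal{O}$-convex. Then there is a $\Phi$-universal function in $\mathcal{H}_{l.u.}(\Omega)$, and the set of all such functions is a dense $G_\delta$-subset of $\mathcal{H}_{l.u.}(\Omega)$. -/

import Mathlib

/-- A domain in the complex plane: a non-empty connected open set. -/
def IsPlaneDomain (Ω : Set ℂ) : Prop := IsOpen Ω ∧ IsConnected Ω

/-- `Ω` has infinite connectivity: its complement in the Riemann sphere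
`ℂ ∪ {∞}` has infinitely many connected components. -/
def HasInfiniteConnectivity (Ω : Set ℂ) : Prop :=
  Infinite (ConnectedComponents
    ↥(((fun z : ℂ => (z : OnePoint ℂ)) '' Ω)ᶜ : Set (OnePoint ℂ)))

/-- A function `f : Ω → ℂ` on an open set `Ω` is holomorphic and locally univalent:
it is holomorphic with nowhere vanishing derivative. The function `F` extends `f` to all
of `ℂ` by arbitrary values; only its restriction to the open set `Ω` matters. -/
def IsLocallyUnivalent (Ω : Set ℂ) (f : Ω → ℂ) : Prop :=
  ∃ F : ℂ → ℂ, DifferentiableOn ℂ F Ω ∧ (∀ z ∈ Ω, deriv F z ≠ 0) ∧ ∀ z : Ω, F z = f z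

/-- The set of all locally univalent holomorphic functions on `Ω`, as a subset of the
space `C(Ω, ℂ)`, whose compact-open topology is that of locally uniform convergence. -/
def locallyUnivalentFunctions (Ω : Set ℂ) : Set C(Ω, ℂ) :=
  {f | IsLocallyUnivalent Ω f}

/-- The set of all locally univalent (holomorphic) self-maps of `Ω`. -/
def locallyUnivalentSelfMaps (Ω : Set ℂ) : Set C(Ω, Ω) :=
  {φ | IsLocallyUnivalent Ω (fun z => (φ z : ℂ))}

/-- `G` is `Φ`-universal in `𝒢`: it belongs to `𝒢`, and `{G ∘ φ | φ ∈ Φ}` is a dense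
subset of `𝒢` (for the topology of locally uniform convergence). -/
def IsUniversalIn {Ω : Set ℂ} (Φ : Set C(Ω, Ω)) (𝒢 : Set C(Ω, ℂ)) (G : C(Ω, ℂ)) : Prop :=
  G ∈ 𝒢 ∧ {f | ∃ φ ∈ Φ, G.comp φ = f} ⊆ 𝒢 ∧ 𝒢 ⊆ closure {f | ∃ φ ∈ Φ, G.comp φ = f}

/-- For every compact `K ⊆ Ω`, all but finitely many `φ n` are injective on `K`. -/
def EventuallyInjective {Ω : Set ℂ} (φ : ℕ → C(Ω, Ω)) : Prop :=
  ∀ K : Set Ω, IsCompact K → ∃ N : ℕ, ∀ n ≥ N, Set.InjOn (φ n) K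

/-- `K ⊆ Ω` is an `𝒪`-convex compact set: it is compact and no connected component of
`Ω \ K` is relatively compact in `Ω`. Here the space `Ω` carries its subspace topology, so
complement and closure are taken in `Ω`. -/
def IsOConvexCompact {Ω : Set ℂ} (K : Set Ω) : Prop :=
  IsCompact K ∧ ∀ z ∈ Kᶜ, ¬ IsCompact (closure (connectedComponentIn Kᶜ z))

open MeasureTheory Complex Set Topology Filter Metric
open scoped ContDiff

/-! The argument is a Baire category argument resting on a Runge theorem for locally univalent
functions.

Category. `C(Ω, ℂ)` has a countable basis, and `G` is universal exactly when, for every basic open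
`b` meeting the locally univalent functions, some `G ∘ φ` lies in `b`. Each such condition is open.
By Hurwitz's theorem applied to derivatives, a limit of locally univalent functions is locally
univalent or constant, so these functions form an open subset of their complete closure and hence a
Baire space. It remains to prove each condition dense: given `f`, `g` and a compact `K`, find a
locally univalent `h` with `h ≈ f` and `h ∘ φ n ≈ g` on `K` (`exists_universal_approx`). Enlarge `K`
to a connected 𝒪-convex `C` and choose `n` with `φ n` injective near `C`, `φ n '' C` disjoint from
`C`, and the union 𝒪-convex. The function equal to `f` near `C` and to `g ∘ (φ n)⁻¹` near `φ n '' C`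
is locally univalent, and `h` approximates it.

Runge for locally univalent functions (`exists_locally_univalent_approx`). Take a finite set `P` off
`Ω`, with at most one point in each bounded component of the complement of the two continua. (1) The
derivative `f'` is approximated by functions holomorphic and zero-free off `P`: zeros and poles of a
rational approximant are pushed into `P` or to `∞`, because elements near `1` of a Banach algebra
are exponentials. (2) To be a derivative off `P`, the approximant must have zero periods. A factor
`exp (∑ τ p * W p)` with `W p ≈ 1 / (f' (z - p))` removes the periods by the implicit function
theorem and creates no zeros. (3) The primitive is then close to `f` up to one constant on each
continuum, and the two constants may differ. Choose `φ` close to `0` near one continuum and to `1`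
near the other, so that `φ'` is tiny there. Multiplying the derivative by `exp (s φ' / q₀)`, with
the periods corrected again, changes it little even for `s` in a huge disc. The increment of the
primitive between the continua is holomorphic in `s` with derivative of modulus at least `1/2` at
`0`, so by a Liouville argument it comes close to any prescribed value. -/

/-! ### Wirtinger derivative and Cauchy's formula with smooth cut-offs -/

/-- The Wirtinger derivative `∂χ/∂z̄`. -/
noncomputable def dbar (χ : ℂ → ℂ) (z : ℂ) : ℂ := (fderiv ℝ χ z 1 + I * fderiv ℝ χ z I) / 2

theorem ContDiff.continuous_dbar {χ : ℂ → ℂ} (hχ : ContDiff ℝ ∞ χ) : Continuous (dbar χ) := by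
  have h := hχ.continuous_fderiv (by simp)
  unfold dbar
  fun_prop

theorem tsupport_dbar_subset (χ : ℂ → ℂ) : tsupport (dbar χ) ⊆ tsupport (fderiv ℝ χ) := by
  refine closure_mono fun z hz => ?_
  contrapose! hz
  simp only [Function.mem_support, not_not] at hz ⊢
  simp [dbar, hz]

theorem tsupport_fderiv_apply (χ : ℂ → ℂ) (v : ℂ) :
    tsupport (fun z => fderiv ℝ χ z v) ⊆ tsupport (fderiv ℝ χ) := by
  refine closure_mono fun z hz => ?_
  contrapose! hz
  simp only [Function.mem_support, not_not] at hz ⊢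
  simp [hz]

theorem continuous_mul_of_tsupport_subset {a b : ℂ → ℂ} {U : Set ℂ} (hU : IsOpen U)
    (ha : ContinuousOn a U) (hb : Continuous b) (hs : tsupport b ⊆ U) :
    Continuous (fun z => a z * b z) := by
  rw [continuous_iff_continuousAt]
  intro z
  by_cases hz : z ∈ tsupport b
  · exact (ha.continuousAt (hU.mem_nhds (hs hz))).mul hb.continuousAt
  · have h0 : (fun z => a z * b z) =ᶠ[𝓝 z] fun _ => 0 := by
      filter_upwards [(isClosed_tsupport b).isOpen_compl.mem_nhds hz] with w hw
      simp [image_eq_zero_of_notMem_tsupport hw]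
    exact continuousAt_const.congr h0.symm

theorem integrable_mul_of_tsupport_subset {a b : ℂ → ℂ} {U : Set ℂ} (hU : IsOpen U)
    (ha : ContinuousOn a U) (hb : Continuous b) (hs : tsupport b ⊆ U) (hc : HasCompactSupport b) :
    Integrable (fun z => a z * b z) :=
  (continuous_mul_of_tsupport_subset hU ha hb hs).integrable_of_hasCompactSupport hc.mul_left

theorem fderiv_real_apply {h : ℂ → ℂ} {z : ℂ} (hh : DifferentiableAt ℂ h z) (v : ℂ) :
    fderiv ℝ h z v = deriv h z * v := by
  rw [hh.fderiv_restrictScalars ℝ]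
  simp [mul_comm]

theorem integral_mul_fderiv_eq {h χ : ℂ → ℂ} {U : Set ℂ} (hU : IsOpen U)
    (hh : DifferentiableOn ℂ h U) (hχ : ContDiff ℝ ∞ χ) (hc : HasCompactSupport χ)
    (hs : tsupport χ ⊆ U) (v : ℂ) :
    ∫ z, h z * fderiv ℝ χ z v = - (v * ∫ z, deriv h z * χ z) := by
  have hd : ∀ z ∈ U, DifferentiableAt ℂ h z := fun z hz => hh.differentiableAt (hU.mem_nhds hz)
  have e : ∀ z, fderiv ℝ h z v * χ z = v * (deriv h z * χ z) := by
    intro z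
    by_cases hz : z ∈ tsupport χ
    · rw [fderiv_real_apply (hd z (hs hz))]; ring
    · simp [image_eq_zero_of_notMem_tsupport hz]
  have hcd := hχ.continuous_fderiv (by simp)
  have i1 : Integrable (fun z => deriv h z * χ z) :=
    integrable_mul_of_tsupport_subset hU (hh.deriv hU).continuousOn hχ.continuous hs hc
  rw [integral_mul_fderiv_eq_neg_fderiv_mul_of_integrable]
  · simp_rw [e]
    rw [integral_const_mul]
  · simp_rw [e]
    exact i1.const_mul v
  · refine integrable_mul_of_tsupport_subset hU hh.continuousOn (by fun_prop) ?_ ?_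
    · exact ((tsupport_fderiv_apply χ v).trans (tsupport_fderiv_subset ℝ)).trans hs
    · exact hc.fderiv_apply ℝ v
  · exact integrable_mul_of_tsupport_subset hU hh.continuousOn hχ.continuous hs hc
  · exact fun z hz => (hd z (hs hz)).restrictScalars ℝ
  · exact fun z _ => (hχ.differentiable (by simp)) z

/-- Integration by parts moves the operator `∂/∂z̄` onto `h`, which it annihilates. -/
theorem integral_mul_dbar_eq_zero {h χ : ℂ → ℂ} {U : Set ℂ} (hU : IsOpen U)
    (hh : DifferentiableOn ℂ h U) (hχ : ContDiff ℝ ∞ χ) (hc : HasCompactSupport χ)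
    (hs : tsupport χ ⊆ U) : ∫ z, h z * dbar χ z = 0 := by
  have hcd := hχ.continuous_fderiv (by simp)
  have hi : ∀ v, Integrable (fun z => h z * fderiv ℝ χ z v) := fun v => by
    refine integrable_mul_of_tsupport_subset hU hh.continuousOn (by fun_prop) ?_ ?_
    · exact ((tsupport_fderiv_apply χ v).trans (tsupport_fderiv_subset ℝ)).trans hs
    · exact hc.fderiv_apply ℝ v
  have e : ∀ z, h z * dbar χ z =
      (1 / 2) * (h z * fderiv ℝ χ z 1) + (I / 2) * (h z * fderiv ℝ χ z I) := by
    intro z; unfold dbar; ring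
  simp_rw [e]
  rw [integral_add ((hi 1).const_mul _) ((hi I).const_mul _), integral_const_mul,
    integral_const_mul, integral_mul_fderiv_eq hU hh hχ hc hs,
    integral_mul_fderiv_eq hU hh hχ hc hs]
  ring_nf
  simp

/-- Exact differentials have no periods. Since `r` need not be holomorphic where `χ` is locally
constant, one cannot integrate by parts against `χ` itself. The first partial derivatives of `χ` are
supported in `U`, and the symmetry of the second derivative makes the two resulting terms cancel. -/
theorem integral_deriv_mul_dbar_eq_zero {r χ : ℂ → ℂ} {U : Set ℂ} (hU : IsOpen U)
    (hr : DifferentiableOn ℂ r U) (hχ : ContDiff ℝ ∞ χ) (hc : HasCompactSupport χ)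
    (hs : tsupport (fderiv ℝ χ) ⊆ U) : ∫ z, deriv r z * dbar χ z = 0 := by
  have hcd : ContDiff ℝ ∞ (fderiv ℝ χ) := hχ.fderiv_right (by simp)
  have hv : ∀ v, ContDiff ℝ ∞ (fun z => fderiv ℝ χ z v) := fun v => hcd.clm_apply contDiff_const
  have hcv : ∀ v, HasCompactSupport (fun z => fderiv ℝ χ z v) := fun v => hc.fderiv_apply ℝ v
  have hsv : ∀ v, tsupport (fun z => fderiv ℝ χ z v) ⊆ U := fun v =>
    (tsupport_fderiv_apply χ v).trans hs
  have h1 := integral_mul_fderiv_eq hU hr (hv 1) (hcv 1) (hsv 1) I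
  have h2 := integral_mul_fderiv_eq hU hr (hv I) (hcv I) (hsv I) 1
  have hsymm : ∀ z, fderiv ℝ (fun z => fderiv ℝ χ z 1) z I = fderiv ℝ (fun z => fderiv ℝ χ z I) z 1 := by
    intro z
    have hd : DifferentiableAt ℝ (fderiv ℝ χ) z := (hcd.differentiable (by simp)) z
    rw [fderiv_clm_apply hd (by fun_prop), fderiv_clm_apply hd (by fun_prop)]
    have := (hχ.contDiffAt (x := z)).isSymmSndFDerivAt (by simp only [minSmoothness_of_isRCLikeNormedField]; exact WithTop.coe_le_coe.2 (le_top : (2 : ℕ∞) ≤ ⊤))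
    simpa using this I 1
  simp_rw [hsymm] at h1
  rw [h2] at h1
  have hi : ∀ v, Integrable (fun z => deriv r z * fderiv ℝ χ z v) := fun v =>
    integrable_mul_of_tsupport_subset hU (hr.deriv hU).continuousOn (hv v).continuous (hsv v) (hcv v)
  have e : ∀ z, deriv r z * dbar χ z =
      (1 / 2) * (deriv r z * fderiv ℝ χ z 1) + (I / 2) * (deriv r z * fderiv ℝ χ z I) := by
    intro z; unfold dbar; ring
  simp_rw [e]
  rw [integral_add ((hi 1).const_mul _) ((hi I).const_mul _), integral_const_mul,
    integral_const_mul]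
  linear_combination (-I / 2) * h1 + (∫ z, deriv r z * fderiv ℝ χ z 1) / 2 * I_sq

/-- In polar coordinates the Jacobian cancels the modulus of `1 / z`. What remains is half the
radial derivative, which integrates to `-χ 0` on each ray, plus an angular derivative, which
integrates to zero on each circle. -/
theorem integral_dbar_div {χ : ℂ → ℂ} (hχ : ContDiff ℝ ∞ χ) (hc : HasCompactSupport χ) :
    ∫ z, dbar χ z / z = - (Real.pi * χ 0) := by
  have hcd := hχ.continuous_fderiv (by simp)
  obtain ⟨R, hR0, hR⟩ : ∃ R > 0, ∀ z, R < ‖z‖ → χ z = 0 := by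
    obtain ⟨R, hR⟩ := hc.isCompact.isBounded.subset_closedBall 0
    refine ⟨max R 1, by positivity, fun z hz => ?_⟩
    refine image_eq_zero_of_notMem_tsupport fun h => ?_
    have := hR h
    simp only [mem_closedBall, dist_zero_right] at this
    exact absurd hz (not_lt.2 (this.trans (le_max_left _ _)))
  have hR' : ∀ z, R < ‖z‖ → fderiv ℝ χ z = 0 := fun z hz => by
    have : χ =ᶠ[𝓝 z] fun _ => 0 := by
      filter_upwards [(isOpen_lt continuous_const continuous_norm).mem_nhds hz] with w hw
      exact hR w hw
    rw [this.fderiv_eq]; simp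
  set A : ℝ × ℝ → ℂ := fun p => fderiv ℝ χ (p.1 * exp (p.2 * I)) (exp (p.2 * I)) with hA
  set B : ℝ × ℝ → ℂ := fun p => fderiv ℝ χ (p.1 * exp (p.2 * I)) (I * exp (p.2 * I)) with hB
  have cA : Continuous A := by
    simp only [hA]
    exact (hcd.comp (by fun_prop)).clm_apply (by fun_prop)
  have cB : Continuous B := by
    simp only [hB]
    exact (hcd.comp (by fun_prop)).clm_apply (by fun_prop)
  have nrm : ∀ p : ℝ × ℝ, 0 < p.1 → ‖(p.1 : ℂ) * exp (p.2 * I)‖ = p.1 := by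
    intro p hp
    rw [norm_mul, norm_exp_ofReal_mul_I, mul_one, norm_real, Real.norm_of_nonneg hp.le]
  have key : ∀ F : ℝ × ℝ → ℂ, Continuous F → (∀ p : ℝ × ℝ, R < p.1 → F p = 0) →
      IntegrableOn F (Ioi (0:ℝ) ×ˢ Ioo (-Real.pi) Real.pi) := by
    intro F hF h0
    have : IntegrableOn F (Icc (0:ℝ) R ×ˢ Icc (-Real.pi) Real.pi) :=
      hF.continuousOn.integrableOn_compact (isCompact_Icc.prod isCompact_Icc)
    refine this.of_forall_sdiff_eq_zero (measurableSet_Ioi.prod measurableSet_Ioo) ?_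
    rintro ⟨r, t⟩ ⟨⟨h1, h2⟩, h3⟩
    refine h0 _ ?_
    simp only [mem_prod, mem_Icc, mem_Ioi, mem_Ioo] at *
    by_contra h
    exact h3 ⟨⟨h1.le, not_lt.1 h⟩, h2.1.le, h2.2.le⟩
  have nrm' : ∀ p : ℝ × ℝ, R < p.1 → R < ‖(p.1 : ℂ) * exp (p.2 * I)‖ := fun p hp => by
    rwa [nrm p (hR0.trans hp)]
  have iA := key A cA fun p hp => by simp [hA, hR' _ (nrm' p hp)]
  have iB := key B cB fun p hp => by simp [hB, hR' _ (nrm' p hp)]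
  have step : ∀ p ∈ Ioi (0:ℝ) ×ˢ Ioo (-Real.pi) Real.pi,
      p.1 • (dbar χ (Complex.polarCoord.symm p) / Complex.polarCoord.symm p)
        = (1/2) * A p + (I/2) * B p := by
    rintro ⟨r, t⟩ ⟨hr, -⟩
    have hr' : (r:ℂ) ≠ 0 := by
      have : (0:ℝ) < r := hr
      exact_mod_cast this.ne'
    have e1 : Complex.polarCoord.symm (r, t) = r * exp (t * I) := by
      rw [Complex.polarCoord_symm_apply, exp_mul_I]; simp
    have e2 : ∀ (T : ℂ →L[ℝ] ℂ) (w : ℂ), T w = w.re * T 1 + w.im * T I := by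
      intro T w
      conv_lhs => rw [← re_add_im w]
      rw [map_add, show (w.re : ℂ) = w.re • (1:ℂ) by simp, show (w.im : ℂ) * I = w.im • I by simp,
        map_smul, map_smul]
      simp
    rw [e1]
    simp only [hA, hB, dbar]
    rw [e2 _ (exp (t * I)), e2 _ (I * exp (t * I))]
    set T1 := fderiv ℝ χ (r * exp (t * I)) 1
    set T2 := fderiv ℝ χ (r * exp (t * I)) I
    have c1 : (exp (t * I)).re = Real.cos t := exp_ofReal_mul_I_re t
    have c2 : (exp (t * I)).im = Real.sin t := exp_ofReal_mul_I_im t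
    have c3 : exp (t * I) = (Real.cos t : ℂ) + Real.sin t * I := by
      rw [exp_mul_I, ofReal_cos, ofReal_sin]
    have c4 : (Real.cos t : ℂ)^2 + (Real.sin t : ℂ)^2 = 1 := by
      exact_mod_cast Real.cos_sq_add_sin_sq t
    simp only [mul_re, mul_im, I_re, I_im, c1, c2, real_smul]
    have hne := exp_ne_zero (t * I)
    have c5 : T1 + I * T2 = exp (t * I) * ((Real.cos t * T1 + Real.sin t * T2) +
        I * (-Real.sin t * T1 + Real.cos t * T2)) := by
      rw [c3]
      linear_combination (-(T1 + I * T2)) * c4 + (Real.sin t ^ 2 * T1 -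
        Real.cos t * Real.sin t * T2) * I_sq
    rw [c5]
    push_cast
    field_simp
    ring
  rw [← Complex.integral_comp_polarCoord_symm, polarCoord_target,
    setIntegral_congr_fun (measurableSet_Ioi.prod measurableSet_Ioo) step,
    integral_add (iA.const_mul _) (iB.const_mul _), integral_const_mul, integral_const_mul]
  have hder : ∀ z : ℂ, HasFDerivAt χ (fderiv ℝ χ z) z := fun z =>
    (hχ.differentiable (by simp) z).hasFDerivAt
  have hBz : ∫ p in Ioi (0:ℝ) ×ˢ Ioo (-Real.pi) Real.pi, B p = 0 := by
    rw [Measure.volume_eq_prod] at iB ⊢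
    rw [setIntegral_prod _ iB]
    refine setIntegral_eq_zero_of_forall_eq_zero fun r hr => ?_
    have hr' : (r:ℂ) ≠ 0 := by exact_mod_cast (ne_of_gt hr)
    rw [← integral_Ioc_eq_integral_Ioo, ← intervalIntegral.integral_of_le (by linarith [Real.pi_pos])]
    have hd : ∀ t : ℝ, HasDerivAt (fun t : ℝ => χ (r * exp (t * I)) / r) (B (r, t)) t := by
      intro t
      have h1 : HasDerivAt (fun t : ℝ => (r:ℂ) * exp (t * I)) (r * (I * exp (t * I))) t := by
        have := ((hasDerivAt_id t).ofReal_comp.mul_const I).cexp.const_mul (r:ℂ)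
        simpa [mul_comm] using this
      have h2 := (hder (r * exp (t * I))).comp_hasDerivAt t h1
      have h3 : B (r, t) = fderiv ℝ χ (r * exp (t * I)) (r * (I * exp (t * I))) / r := by
        rw [show (r:ℂ) * (I * exp (t * I)) = r • (I * exp (t * I)) from real_smul.symm,
          map_smul, real_smul]
        field_simp
        rfl
      rw [h3]
      exact h2.div_const (r:ℂ)
    rw [intervalIntegral.integral_eq_sub_of_hasDerivAt (fun t _ => hd t)
      (Continuous.intervalIntegrable (by fun_prop) _ _)]
    have e : exp ((-Real.pi : ℝ) * I) = exp ((Real.pi : ℝ) * I) := by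
      push_cast
      rw [neg_mul, exp_neg, exp_pi_mul_I]
      norm_num
    rw [e, sub_self]
  have hAz : ∫ p in Ioi (0:ℝ) ×ˢ Ioo (-Real.pi) Real.pi, A p = -(2 * Real.pi * χ 0) := by
    rw [Measure.volume_eq_prod] at iA ⊢
    rw [← setIntegral_prod_swap, setIntegral_prod (fun z : ℝ × ℝ => A z.swap) iA.swap]
    have : ∀ t : ℝ, ∫ r in Ioi (0:ℝ), A (r, t) = - χ 0 := by
      intro t
      have hd : ∀ r : ℝ, HasDerivAt (fun r : ℝ => χ (r * exp (t * I))) (A (r, t)) r := by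
        intro r
        have h1 : HasDerivAt (fun r : ℝ => (r:ℂ) * exp (t * I)) (exp (t * I)) r := by
          simpa using (hasDerivAt_id r).ofReal_comp.mul_const (exp (t * I))
        exact (hder (r * exp (t * I))).comp_hasDerivAt r h1
      have hi : IntegrableOn (fun r : ℝ => A (r, t)) (Ioi 0) := by
        have : IntegrableOn (fun r : ℝ => A (r, t)) (Icc 0 R) :=
          (by fun_prop : Continuous fun r : ℝ => A (r, t)).continuousOn.integrableOn_compact isCompact_Icc
        refine this.of_forall_sdiff_eq_zero measurableSet_Ioi ?_
        rintro r ⟨h1, h3⟩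
        have : R < r := by
          by_contra h
          exact h3 ⟨le_of_lt h1, not_lt.1 h⟩
        simp [hA, hR' _ (nrm' (r, t) this)]
      rw [integral_Ioi_of_hasDerivAt_of_tendsto' (fun r _ => hd r) hi (m := 0)]
      · simp
      · refine tendsto_const_nhds.congr' ?_
        filter_upwards [eventually_gt_atTop R] with r hr
        exact (hR _ (nrm' (r, t) hr)).symm
    simp only [Prod.swap_prod_mk, this]
    rw [setIntegral_const]
    simp only [measureReal_def, Real.volume_Ioo, real_smul]
    rw [ENNReal.toReal_ofReal (by linarith [Real.pi_pos])]
    push_cast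
    ring
  rw [hAz, hBz]
  ring

theorem integral_dbar_div_sub {χ : ℂ → ℂ} (hχ : ContDiff ℝ ∞ χ) (hc : HasCompactSupport χ) (w : ℂ) :
    ∫ z, dbar χ z / (z - w) = - (Real.pi * χ w) := by
  have h := integral_dbar_div (χ := fun z => χ (z + w)) (by fun_prop)
    (hc.comp_homeomorph (Homeomorph.addRight w))
  rw [← integral_add_right_eq_self _ w]
  simp only [add_sub_cancel_right]
  rw [zero_add] at h
  rw [← h]
  congr 1
  ext z
  simp [dbar, fderiv_comp_add_right]

theorem exists_smooth_one_nhds_zero_nhds {s t : Set ℂ} (hs : IsClosed s) (ht : IsClosed t)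
    (hd : Disjoint s t) : ∃ χ : ℂ → ℂ, ContDiff ℝ ∞ χ ∧ (∀ᶠ z in 𝓝ˢ s, χ z = 1) ∧
      (∀ᶠ z in 𝓝ˢ t, χ z = 0) := by
  obtain ⟨f, h0, h1, -⟩ := exists_contMDiffMap_zero_one_nhds_of_isClosed (n := ⊤)
    (modelWithCornersSelf ℝ ℂ) ht hs hd.symm
  refine ⟨fun z => f z, ?_, ?_, ?_⟩
  · exact ofRealCLM.contDiff.comp f.contMDiff.contDiff
  · filter_upwards [h1] with z hz
    simp [hz]
  · filter_upwards [h0] with z hz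
    simp [hz]

theorem exists_smooth_cutoff {K U : Set ℂ} (hK : IsCompact K) (hU : IsOpen U) (hKU : K ⊆ U) :
    ∃ χ : ℂ → ℂ, ContDiff ℝ ∞ χ ∧ HasCompactSupport χ ∧ tsupport χ ⊆ U ∧
      ∀ᶠ z in 𝓝ˢ K, χ z = 1 := by
  obtain ⟨W, hWo, hKW, hWU, hWc⟩ := exists_open_between_and_isCompact_closure hK hU hKU
  obtain ⟨χ, h1, h2, h3⟩ := exists_smooth_one_nhds_zero_nhds hK.isClosed hWo.isClosed_compl
    (disjoint_compl_right_iff_subset.2 hKW)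
  have hs : tsupport χ ⊆ closure W := by
    refine closure_mono fun z hz => ?_
    by_contra h
    exact hz (h3.self_of_nhdsSet z h)
  exact ⟨χ, h1, hWc.of_isClosed_subset (isClosed_tsupport _) hs, hs.trans hWU, h2⟩

theorem notMem_tsupport_fderiv_of_eventually_const {χ : ℂ → ℂ} {z c : ℂ}
    (h : ∀ᶠ w in 𝓝 z, χ w = c) : z ∉ tsupport (fderiv ℝ χ) := by
  rw [notMem_tsupport_iff_eventuallyEq]
  filter_upwards [h.eventually_nhds] with w hw
  have : χ =ᶠ[𝓝 w] fun _ => c := hw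
  rw [this.fderiv_eq]
  simp

/-- The average lies in the closed convex set `S`, and the integral is a real multiple of it. -/
theorem Submodule.integral_mem_of_isClosed {Y X : Type*} [MeasurableSpace Y] {μ : Measure Y}
    [IsFiniteMeasure μ] [NormedAddCommGroup X] [NormedSpace ℂ X] [CompleteSpace X]
    (S : Submodule ℂ X) (hS : IsClosed (S : Set X)) {F : Y → X} (hF : Integrable F μ)
    (h : ∀ y, F y ∈ S) : ∫ y, F y ∂μ ∈ S := by
  rcases eq_or_ne μ 0 with rfl | hμ
  · simp
  · have : NeZero μ := ⟨hμ⟩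
    rw [← measure_smul_average]
    have hc : Convex ℝ (S : Set X) := (S.restrictScalars ℝ).convex
    exact (S.restrictScalars ℝ).smul_mem _
      (hc.average_mem hS (Eventually.of_forall h) hF)

/-- Cauchy's integral formula with a smooth cut-off function in place of a contour. -/
theorem integral_mul_dbar_div_sub {U : Set ℂ} (hU : IsOpen U) {g χ : ℂ → ℂ}
    (hg : DifferentiableOn ℂ g U) (hχ : ContDiff ℝ ∞ χ) (hc : HasCompactSupport χ)
    (hs : tsupport χ ⊆ U) {z : ℂ} (hz : z ∈ U) (h1 : ∀ᶠ w in 𝓝 z, χ w = 1) :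
    ∫ w, g w * (w - z)⁻¹ * dbar χ w = - (Real.pi * g z) := by
  have hzt : z ∉ tsupport (dbar χ) := fun h =>
    notMem_tsupport_fderiv_of_eventually_const h1 (tsupport_dbar_subset _ h)
  have hst : tsupport (dbar χ) ⊆ U \ {z} := fun w hw =>
    ⟨hs (tsupport_fderiv_subset ℝ (tsupport_dbar_subset _ hw)), fun h => hzt (h ▸ hw)⟩
  have hcd : HasCompactSupport (dbar χ) := hc.of_isClosed_subset (isClosed_tsupport _)
    ((tsupport_dbar_subset _).trans (tsupport_fderiv_subset ℝ))
  have hUo : IsOpen (U \ {z}) := hU.sdiff isClosed_singleton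
  have c1 : ContinuousOn (fun w : ℂ => (w - z)⁻¹) (U \ {z}) := by
    refine ContinuousOn.inv₀ (by fun_prop) fun w hw => sub_ne_zero.2 hw.2
  have c2 : ContinuousOn (fun w : ℂ => g w * (w - z)⁻¹) (U \ {z}) :=
    (hg.continuousOn.mono sdiff_subset).mul c1
  have i1 := integrable_mul_of_tsupport_subset hUo c1 hχ.continuous_dbar hst hcd
  have i2 := integrable_mul_of_tsupport_subset hUo c2 hχ.continuous_dbar hst hcd
  -- The difference quotient of `g` at `z` is holomorphic across `z`. Splitting its vanishing
  -- integral leaves `g z` times the case `g = 1`.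
  have h0 := integral_mul_dbar_eq_zero hU
    ((differentiableOn_dslope (hU.mem_nhds hz)).2 hg) hχ hc hs
  have e : ∀ w, dslope g z w * dbar χ w =
      g w * (w - z)⁻¹ * dbar χ w - g z * ((w - z)⁻¹ * dbar χ w) := by
    intro w
    by_cases hw : w = z
    · simp [hw, image_eq_zero_of_notMem_tsupport hzt]
    · rw [dslope_of_ne _ hw, slope_def_field]
      ring
  simp_rw [e] at h0
  rw [integral_sub i2 (i1.const_mul _), integral_const_mul] at h0
  have h2 := integral_dbar_div_sub hχ hc z
  simp_rw [div_eq_mul_inv, mul_comm (dbar χ _)] at h2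
  rw [h2, h1.self_of_nhds] at h0
  linear_combination h0

/-! ### Runge's theorem for rational functions -/

/-- Runge's theorem, with poles anywhere off the compact set. -/
theorem exists_rational_approx {K U : Set ℂ} (hK : IsCompact K) (hU : IsOpen U) (hKU : K ⊆ U)
    {g : ℂ → ℂ} (hg : DifferentiableOn ℂ g U) {ε : ℝ} (hε : 0 < ε) :
    ∃ p q : Polynomial ℂ, ∀ z ∈ K, q.eval z ≠ 0 ∧ ‖g z - p.eval z / q.eval z‖ < ε := by
  obtain ⟨χ, hχ, hc, hs, h1⟩ := exists_smooth_cutoff hK hU hKU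
  have : CompactSpace K := isCompact_iff_compactSpace.mp hK
  set T := tsupport (dbar χ) with hT
  have hTU : T ⊆ U := (tsupport_dbar_subset _).trans ((tsupport_fderiv_subset ℝ).trans hs)
  have hTc : IsCompact T := hc.of_isClosed_subset (isClosed_tsupport _)
    ((tsupport_dbar_subset _).trans (tsupport_fderiv_subset ℝ))
  have : CompactSpace T := isCompact_iff_compactSpace.mp hTc
  have hTK : ∀ w ∈ T, ∀ z ∈ K, w - z ≠ 0 := by
    intro w hw z hz h
    rw [sub_eq_zero] at h
    subst h
    exact notMem_tsupport_fderiv_of_eventually_const (h1.filter_mono (nhds_le_nhdsSet hz))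
      (tsupport_dbar_subset _ hw)
  have hcont : Continuous fun p : T × K => ((p.1 : ℂ) - p.2)⁻¹ :=
    Continuous.inv₀ (by fun_prop) fun p => hTK _ p.1.2 _ p.2.2
  -- Cauchy's formula presents `-π g` as a `C(K, ℂ)`-valued integral of multiples of the kernels `z
  -- ↦ (w - z)⁻¹`. It therefore lies in their closed span, and finite combinations of the kernels
  -- are rational.
  set k : C(T, C(K, ℂ)) := ContinuousMap.curry ⟨_, hcont⟩ with hk
  set S : Submodule ℂ C(K, ℂ) := (Submodule.span ℂ (range k)).topologicalClosure with hS
  set F : T → C(K, ℂ) := fun w => (g w * dbar χ w) • k w with hF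
  have hFc : Continuous F := by
    have h2 : Continuous fun w : T => g w := (hg.continuousOn.mono hTU).domRestrict
    have h3 : Continuous fun w : T => dbar χ w := hχ.continuous_dbar.comp continuous_subtype_val
    exact (h2.mul h3).smul k.continuous
  have hmT : MeasurableSet T := hTc.isClosed.measurableSet
  have : IsFiniteMeasure (Measure.comap ((↑) : T → ℂ) volume) := ⟨by
    rw [Measure.comap_apply _ Subtype.val_injective
      (fun s hs => hmT.subtype_image hs) _ MeasurableSet.univ]
    simpa using hTc.measure_lt_top⟩
  have hFi : Integrable F (Measure.comap ((↑) : T → ℂ) volume) :=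
    hFc.integrable_of_hasCompactSupport (HasCompactSupport.of_compactSpace F)
  have hmem : ∫ w, F w ∂(Measure.comap ((↑) : T → ℂ) volume) ∈ S := by
    refine S.integral_mem_of_isClosed (Submodule.isClosed_topologicalClosure _) hFi fun w => ?_
    exact S.smul_mem _ (Submodule.le_topologicalClosure _ (Submodule.subset_span ⟨w, rfl⟩))
  have hval : ∀ z : K, (∫ w, F w ∂(Measure.comap ((↑) : T → ℂ) volume)) z = - (Real.pi * g z) := by
    intro z
    have := (ContinuousMap.evalCLM ℂ z).integral_comp_comm hFi
    simp only [ContinuousMap.evalCLM_apply] at this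
    rw [← this, ← integral_mul_dbar_div_sub hU hg hχ hc hs (hKU z.2)
      (h1.filter_mono (nhds_le_nhdsSet z.2))]
    rw [← setIntegral_eq_integral_of_forall_compl_eq_zero (s := T)
      (fun w hw => by simp [image_eq_zero_of_notMem_tsupport hw]), ← integral_subtype_comap hmT]
    refine integral_congr_ae (Eventually.of_forall fun w => ?_)
    simp only [hF, hk, ContinuousMap.smul_apply,
      ContinuousMap.curry_apply, ContinuousMap.coe_mk, smul_eq_mul]
    ring
  obtain ⟨r, hrS, hr⟩ := Metric.mem_closure_iff.1 hmem (Real.pi * ε) (by positivity)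
  have hrat : ∃ p q : Polynomial ℂ, ∀ z : K, q.eval (z : ℂ) ≠ 0 ∧ r z = p.eval (z : ℂ) / q.eval (z : ℂ) := by
    clear hr
    induction hrS using Submodule.span_induction with
    | mem x hx =>
      obtain ⟨w, rfl⟩ := hx
      refine ⟨1, Polynomial.C (w : ℂ) - Polynomial.X, fun z => ?_⟩
      simpa [hk] using hTK w w.2 z z.2
    | zero => exact ⟨0, 1, by simp⟩
    | add x y _ _ hx hy =>
      obtain ⟨p, q, h⟩ := hx
      obtain ⟨p', q', h'⟩ := hy
      refine ⟨p * q' + p' * q, q * q', fun z => ?_⟩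
      have a := (h z).1
      have b := (h' z).1
      simp only [Polynomial.eval_mul, Polynomial.eval_add, ContinuousMap.add_apply, (h z).2, (h' z).2]
      exact ⟨mul_ne_zero a b, by field_simp⟩
    | smul c x _ hx =>
      obtain ⟨p, q, h⟩ := hx
      refine ⟨Polynomial.C c * p, q, fun z => ⟨(h z).1, ?_⟩⟩
      simp [(h z).2, mul_div_assoc]
  obtain ⟨p, q, hpq⟩ := hrat
  refine ⟨Polynomial.C (-(Real.pi : ℂ)⁻¹) * p, q, fun z hz => ⟨(hpq ⟨z, hz⟩).1, ?_⟩⟩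
  have h2 := (ContinuousMap.dist_apply_le_dist (⟨z, hz⟩ : K)).trans_lt hr
  rw [hval ⟨z, hz⟩, (hpq ⟨z, hz⟩).2, dist_eq_norm] at h2
  have hpi : (Real.pi : ℂ) ≠ 0 := by exact_mod_cast Real.pi_ne_zero
  have e : g z - (Polynomial.C (-(Real.pi : ℂ)⁻¹) * p).eval z / q.eval z =
      -(Real.pi : ℂ)⁻¹ * (-(Real.pi * g z) - p.eval z / q.eval z) := by
    simp only [Polynomial.eval_mul, Polynomial.eval_C]
    field_simp
    ring
  rw [e, norm_mul, norm_neg, norm_inv, norm_real, Real.norm_of_nonneg Real.pi_pos.le,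
    inv_mul_lt_iff₀ Real.pi_pos]
  exact h2

/-! ### Pushing zeros and poles by means of exponentials -/

/-- Restrictions to `L` of holomorphic functions on the complement of `P`. -/
def holSubalgebra (P L : Set ℂ) : Subalgebra ℂ C(L, ℂ) where
  carrier := {g | ∃ G : ℂ → ℂ, DifferentiableOn ℂ G Pᶜ ∧ ∀ z : L, G z = g z}
  mul_mem' := by
    rintro a b ⟨A, hA, ha⟩ ⟨B, hB, hb⟩
    exact ⟨A * B, hA.mul hB, fun z => by simp [ha, hb]⟩
  add_mem' := by
    rintro a b ⟨A, hA, ha⟩ ⟨B, hB, hb⟩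
    exact ⟨A + B, hA.add hB, fun z => by simp [ha, hb]⟩
  algebraMap_mem' c := ⟨fun _ => c, differentiableOn_const _, fun z => by simp⟩

/-- Restrictions to `L` of nowhere vanishing holomorphic functions on the complement of `P`. -/
def holUnits (P L : Set ℂ) : Subgroup C(L, ℂ)ˣ where
  carrier := {g | ∃ G : ℂ → ℂ, DifferentiableOn ℂ G Pᶜ ∧ (∀ z ∈ Pᶜ, G z ≠ 0) ∧
    ∀ z : L, G z = (g : C(L, ℂ)) z}
  mul_mem' := by
    rintro a b ⟨A, hA, hA0, ha⟩ ⟨B, hB, hB0, hb⟩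
    exact ⟨A * B, hA.mul hB, fun z hz => mul_ne_zero (hA0 z hz) (hB0 z hz),
      fun z => by simp [ha, hb]⟩
  one_mem' := ⟨fun _ => 1, differentiableOn_const _, fun _ _ => one_ne_zero, fun z => by simp⟩
  inv_mem' := by
    rintro a ⟨A, hA, hA0, ha⟩
    refine ⟨fun z => (A z)⁻¹, hA.inv hA0, fun z hz => inv_ne_zero (hA0 z hz), fun z => ?_⟩
    have h : (a : C(L, ℂ)) z * ((a⁻¹ : C(L, ℂ)ˣ) : C(L, ℂ)) z = 1 := by
      rw [← ContinuousMap.mul_apply, Units.mul_inv]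
      rfl
    simp only [ha]
    exact (eq_inv_of_mul_eq_one_right h).symm

/-- The derivative of `exp` at `0` is the identity, so `exp` maps neighbourhoods of `0` onto
neighbourhoods of `1`. -/
theorem exists_ball_subset_range_exp (X : Type*) [NormedRing X] [NormedAlgebra ℂ X]
    [CompleteSpace X] : ∃ r > 0, ∀ a : X, ‖a - 1‖ < r → ∃ v : X, NormedSpace.exp v = a := by
  have h := (hasStrictFDerivAt_exp_zero (𝕂 := ℂ) (𝔸 := X)).map_nhds_eq_of_surj
    (LinearMap.range_eq_top.2 fun x => ⟨x, rfl⟩)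
  rw [NormedSpace.exp_zero] at h
  have h2 : range (NormedSpace.exp : X → X) ∈ 𝓝 (1 : X) := by
    rw [← h]
    simp
  obtain ⟨r, hr, hr2⟩ := Metric.mem_nhds_iff.1 h2
  exact ⟨r, hr, fun a ha => hr2 (mem_ball_iff_norm.2 ha)⟩

/-- A closed subalgebra is itself a Banach algebra, so the logarithm can be found inside it. -/
theorem exists_exp_eq_of_mem_closed_subalgebra {X : Type*} [NormedRing X] [NormedAlgebra ℂ X]
    [CompleteSpace X] (A : Subalgebra ℂ X) (hA : IsClosed (A : Set X)) :
    ∃ r > 0, ∀ a ∈ A, ‖a - 1‖ < r → ∃ v ∈ A, NormedSpace.exp v = a := by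
  have : CompleteSpace A := hA.completeSpace_coe
  obtain ⟨r, hr, h⟩ := exists_ball_subset_range_exp A
  refine ⟨r, hr, fun a ha hn => ?_⟩
  obtain ⟨v, hv⟩ := h ⟨a, ha⟩ hn
  refine ⟨v, v.2, ?_⟩
  let : NormedAlgebra ℚ A := NormedAlgebra.restrictScalars ℚ ℂ A
  let : Algebra ℚ X := Algebra.compHom X (algebraMap ℚ ℂ)
  have := NormedSpace.map_exp A.val continuous_subtype_val v
  rw [hv] at this
  exact this.symm

theorem isUnit_of_forall_ne_zero {L : Set ℂ} {g : C(L, ℂ)} (h : ∀ z, g z ≠ 0) : ∃ u : C(L, ℂ)ˣ, (u : C(L, ℂ)) = g :=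
  (ContinuousMap.isUnit_iff_forall_ne_zero g).2 h

theorem units_inv_apply {L : Set ℂ} (u : C(L, ℂ)ˣ) (z : L) :
    ((u⁻¹ : C(L, ℂ)ˣ) : C(L, ℂ)) z = ((u : C(L, ℂ)) z)⁻¹ := by
  refine eq_inv_of_mul_eq_one_left ?_
  rw [← ContinuousMap.mul_apply, Units.inv_mul]
  rfl

section
variable {P L : Set ℂ} [CompactSpace L]

theorem coe_mem_topologicalClosure_of_mem {u : C(L, ℂ)ˣ}
    (hu : u ∈ (holUnits P L).topologicalClosure) :
    (u : C(L, ℂ)) ∈ (holSubalgebra P L).topologicalClosure := by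
  refine map_mem_closure Units.continuous_val hu ?_
  rintro v ⟨G, hG, -, hv⟩
  exact ⟨G, hG, hv⟩

theorem exp_mem_holUnits_closure {u : C(L, ℂ)ˣ} {v : C(L, ℂ)}
    (hv : v ∈ (holSubalgebra P L).topologicalClosure) (huv : (u : C(L, ℂ)) = NormedSpace.exp v) :
    u ∈ (holUnits P L).topologicalClosure := by
  have key : ∀ w : C(L, ℂ), IsUnit (NormedSpace.exp w) := fun w => NormedSpace.isUnit_exp w
  have hc : Continuous fun w : C(L, ℂ) => (key w).unit := by
    rw [Units.isOpenEmbedding_val.isEmbedding.continuous_iff]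
    exact NormedSpace.exp_continuous
  have : u = (key v).unit := Units.ext (by simp [huv])
  rw [this]
  refine map_mem_closure hc hv ?_
  rintro w ⟨G, hG, hw⟩
  refine ⟨fun z => exp (G z), hG.cexp, fun z _ => exp_ne_zero _, fun z => ?_⟩
  have h := NormedSpace.map_exp (ContinuousMap.evalAlgHom ℂ ℂ z) (continuous_eval_const z) w
  simp only [ContinuousMap.evalAlgHom_apply] at h
  rw [IsUnit.unit_spec, h, ← hw, exp_eq_exp_ℂ]

/-- Approximating a logarithm and then exponentiating gives approximants without zeros on all of
`Pᶜ`, whereas approximating `u` directly would control them only on `L`. -/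
theorem exists_ball_subset_holUnits_closure (P L : Set ℂ) [CompactSpace L] :
    ∃ r > 0, ∀ u : C(L, ℂ)ˣ,
      (u : C(L, ℂ)) ∈ (holSubalgebra P L).topologicalClosure → ‖(u : C(L, ℂ)) - 1‖ < r →
        u ∈ (holUnits P L).topologicalClosure := by
  obtain ⟨r, hr, h⟩ := exists_exp_eq_of_mem_closed_subalgebra
    (holSubalgebra P L).topologicalClosure (Subalgebra.isClosed_topologicalClosure _)
  refine ⟨r, hr, fun u hu hn => ?_⟩
  obtain ⟨v, hv, hvu⟩ := h u hu hn
  exact exp_mem_holUnits_closure hv hvu.symm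

/-- The function `z ↦ z - a` on `L`. -/
def subConst (L : Set ℂ) (a : ℂ) : C(L, ℂ) := ⟨fun z => z - a, by fun_prop⟩

/-- `z ↦ z - a` is a uniform limit on `L` of nowhere vanishing holomorphic functions off `P`. -/
def IsMovable (P L : Set ℂ) [CompactSpace L] (a : ℂ) : Prop :=
  ∃ u ∈ (holUnits P L).topologicalClosure, (u : C(L, ℂ)) = subConst L a

theorem isMovable_of_mem (hP : P ⊆ Lᶜ) {p : ℂ} (hp : p ∈ P) : IsMovable P L p := by
  obtain ⟨u, hu⟩ := isUnit_of_forall_ne_zero (g := subConst L p) fun z h =>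
    hP hp (by rw [subConst, ContinuousMap.coe_mk, sub_eq_zero] at h; exact h ▸ z.2)
  refine ⟨u, Subgroup.le_topologicalClosure _ ⟨fun z => z - p, by fun_prop, ?_, ?_⟩, hu⟩
  · exact fun z hz => sub_ne_zero.2 fun h => hz (h ▸ hp)
  · exact fun z => by rw [hu]; rfl

/-- Both claims follow from quotients close to `1`: `(z - b) / (z - a) = 1 + (a - b) / (z - a)` when
`b` is near `a`, and `(z - a) / (-a) = 1 - z / a` when `a` is far from `L`. -/
theorem exists_isMovable_step (P L : Set ℂ) [CompactSpace L] : ∃ r > 0,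
    (∀ a b : ℂ, IsMovable P L a → b ∉ L → (∀ z ∈ L, ‖b - a‖ ≤ r * ‖z - a‖) → IsMovable P L b) ∧
    ∀ a : ℂ, a ∉ L → a ≠ 0 → (∀ z ∈ L, ‖z‖ ≤ r * ‖a‖) → IsMovable P L a := by
  obtain ⟨r, hr, H⟩ := exists_ball_subset_holUnits_closure P L
  have hne : ∀ b : ℂ, b ∉ L → ∀ z : L, subConst L b z ≠ 0 := fun b hb z h => by
    rw [subConst, ContinuousMap.coe_mk, sub_eq_zero] at h
    exact hb (h ▸ z.2)
  refine ⟨r / 2, by positivity, ?_, ?_⟩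
  · rintro a b ⟨u, hu, hua⟩ hb hab
    obtain ⟨v, hv⟩ := isUnit_of_forall_ne_zero (hne b hb)
    have e : ((u⁻¹ * v : C(L, ℂ)ˣ) : C(L, ℂ)) - 1 = (a - b) • ((u⁻¹ : C(L, ℂ)ˣ) : C(L, ℂ)) := by
      ext z
      have h0 : (u : C(L, ℂ)) z ≠ 0 := (ContinuousMap.isUnit_iff_forall_ne_zero _).1 u.isUnit z
      simp only [Units.val_mul, ContinuousMap.sub_apply, ContinuousMap.mul_apply,
        units_inv_apply, ContinuousMap.one_apply, ContinuousMap.smul_apply, smul_eq_mul]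
      rw [hua] at h0 ⊢
      rw [hv]
      field_simp
      simp only [subConst, ContinuousMap.coe_mk]
      ring
    have hm : u⁻¹ * v ∈ (holUnits P L).topologicalClosure := by
      refine H _ ?_ ?_
      · rw [← sub_add_cancel ((u⁻¹ * v : C(L, ℂ)ˣ) : C(L, ℂ)) 1, e]
        exact add_mem (Subalgebra.smul_mem _ (coe_mem_topologicalClosure_of_mem (inv_mem hu)) _)
          (one_mem _)
      · rw [e]
        refine lt_of_le_of_lt ((ContinuousMap.norm_le _ (by positivity)).2 fun z => ?_) (half_lt_self hr)
        rw [ContinuousMap.smul_apply, units_inv_apply, hua, smul_eq_mul, norm_mul, norm_inv]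
        have h0 : (u : C(L, ℂ)) z ≠ 0 := (ContinuousMap.isUnit_iff_forall_ne_zero _).1 u.isUnit z
        rw [hua] at h0
        rw [← div_eq_mul_inv, div_le_iff₀ (norm_pos_iff.2 h0), norm_sub_rev]
        exact hab z z.2
    exact ⟨v, by simpa using mul_mem hu hm, hv⟩
  · intro a ha ha0 h
    obtain ⟨v, hv⟩ := isUnit_of_forall_ne_zero (hne a ha)
    obtain ⟨c, hc⟩ := isUnit_of_forall_ne_zero (g := ContinuousMap.const L (-a))
      fun z => neg_ne_zero.2 ha0
    have hcm : c ∈ holUnits P L := ⟨fun _ => -a, differentiableOn_const _,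
      fun _ _ => neg_ne_zero.2 ha0, fun z => by rw [hc]; rfl⟩
    have e : ((c⁻¹ * v : C(L, ℂ)ˣ) : C(L, ℂ)) = 1 - a⁻¹ • (⟨fun z => z, by fun_prop⟩ : C(L, ℂ)) := by
      ext z
      simp only [Units.val_mul, ContinuousMap.sub_apply, ContinuousMap.mul_apply,
        units_inv_apply, ContinuousMap.one_apply, ContinuousMap.smul_apply, smul_eq_mul, hc, hv,
        subConst, ContinuousMap.coe_mk, ContinuousMap.const_apply]
      field_simp
      ring
    have hm : c⁻¹ * v ∈ (holUnits P L).topologicalClosure := by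
      refine H _ ?_ ?_
      · rw [e]
        refine sub_mem (one_mem _) (Subalgebra.smul_mem _ (Subalgebra.le_topologicalClosure _ ?_) _)
        exact ⟨fun z => z, differentiableOn_id, fun z => rfl⟩
      · rw [e, sub_sub_cancel_left, norm_neg]
        refine lt_of_le_of_lt ((ContinuousMap.norm_le _ (by positivity)).2 fun z => ?_) (half_lt_self hr)
        rw [ContinuousMap.smul_apply, smul_eq_mul, norm_mul, norm_inv,
          inv_mul_le_iff₀ (norm_pos_iff.2 ha0), mul_comm]
        exact h z z.2
    exact ⟨v, by simpa using mul_mem (Subgroup.le_topologicalClosure _ hcm) hm, hv⟩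

/-- Points in a connected subset of the complement of `L` containing a point of `P`, or
unbounded, are movable. -/
theorem isMovable_of_isPreconnected (hL : IsCompact L) (hP : P ⊆ Lᶜ) {C : Set ℂ}
    (hC : IsPreconnected C) (hCL : C ⊆ Lᶜ)
    (h : (∃ p ∈ P, p ∈ C) ∨ ¬ Bornology.IsBounded C) {a : ℂ} (ha : a ∈ C) : IsMovable P L a := by
  obtain ⟨r, hr, H1, H2⟩ := exists_isMovable_step P L
  have hball : ∀ b ∉ L, ∃ δ > 0, ∀ z ∈ L, δ ≤ ‖z - b‖ := by
    intro b hb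
    obtain ⟨δ, hδ, h⟩ := Metric.isOpen_iff.1 hL.isClosed.isOpen_compl b hb
    refine ⟨δ, hδ, fun z hz => ?_⟩
    by_contra hlt
    exact h (mem_ball_iff_norm.2 (not_le.1 hlt)) hz
  have hstart : ∃ b ∈ C, IsMovable P L b := by
    rcases h with ⟨p, hp, hpC⟩ | h
    · exact ⟨p, hpC, isMovable_of_mem hP hp⟩
    · obtain ⟨R, hR⟩ := hL.isBounded.exists_norm_le
      have : ∃ b ∈ C, (max R 1) / r < ‖b‖ := by
        by_contra! hcon
        exact h (isBounded_iff_forall_norm_le.2 ⟨_, hcon⟩)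
      obtain ⟨b, hbC, hb⟩ := this
      have hb' : max R 1 < r * ‖b‖ := by rwa [div_lt_iff₀' hr] at hb
      refine ⟨b, hbC, H2 b (hCL hbC) ?_ fun z hz => ?_⟩
      · rintro rfl
        simp at hb'
        linarith [hb'.2]
      · exact (hR z hz).trans ((le_max_left _ _).trans hb'.le)
  -- If `c` is within `r' * δ` of `b`, the bound `1 / 2` keeps `c` at distance at least `δ / 2` from
  -- `L`, and the bound `r / 2` then permits a step from `c` back to `b`. Hence the non-movable
  -- points are open as well, and a connected set cannot contain both kinds.
  set r' := min (r / 2) (1 / 2) with hr'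
  have hr'0 : 0 < r' := by positivity
  have hopen : ∀ b ∉ L, IsMovable P L b → ∀ᶠ c in 𝓝 b, IsMovable P L c := by
    intro b hb hbm
    obtain ⟨δ, hδ, h⟩ := hball b hb
    filter_upwards [Metric.ball_mem_nhds b (show 0 < r * δ by positivity),
      hL.isClosed.isOpen_compl.mem_nhds hb] with c hc hcL
    refine H1 b c hbm hcL fun z hz => (mem_ball_iff_norm.1 hc).le.trans ?_
    exact mul_le_mul_of_nonneg_left (h z hz) hr.le
  have hclosed : ∀ b ∉ L, ¬ IsMovable P L b → ∀ᶠ c in 𝓝 b, ¬ IsMovable P L c := by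
    intro b hb hbm
    obtain ⟨δ, hδ, h⟩ := hball b hb
    filter_upwards [Metric.ball_mem_nhds b (show 0 < r' * δ by positivity)] with c hc hcm
    refine hbm (H1 c b hcm hb fun z hz => ?_)
    rw [mem_ball_iff_norm, norm_sub_rev] at hc
    have h1 := h z hz
    have h2 : ‖z - b‖ ≤ ‖z - c‖ + ‖b - c‖ := by
      have := norm_sub_le (z - c) (b - c)
      simpa using this
    have h3 : r' ≤ 1 / 2 := min_le_right _ _
    have h4 : r' ≤ r / 2 := min_le_left _ _
    have h5 : δ / 2 ≤ ‖z - c‖ := by nlinarith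
    nlinarith
  by_contra hna
  obtain ⟨b, hbC, hb⟩ := hstart
  have := hC {c | c ∉ L ∧ ∀ᶠ d in 𝓝 c, IsMovable P L d} {c | c ∉ L ∧ ∀ᶠ d in 𝓝 c, ¬ IsMovable P L d}
    (hL.isClosed.isOpen_compl.inter isOpen_setOfPred_eventually_nhds)
    (hL.isClosed.isOpen_compl.inter isOpen_setOfPred_eventually_nhds) (fun c hc => by
      by_cases h : IsMovable P L c
      · exact Or.inl ⟨hCL hc, hopen c (hCL hc) h⟩
      · exact Or.inr ⟨hCL hc, hclosed c (hCL hc) h⟩)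
    ⟨b, hbC, hCL hbC, hopen b (hCL hbC) hb⟩ ⟨a, ha, hCL ha, hclosed a (hCL ha) hna⟩
  obtain ⟨c, -, ⟨-, h1⟩, -, h2⟩ := this
  exact h2.self_of_nhds h1.self_of_nhds

end

/-! ### Runge's theorem with prescribed poles, also without zeros -/

/-- Every point off `M` can be connected in the complement of `L` to a point of `P` or to `∞`. -/
def Separates (P L M : Set ℂ) : Prop :=
  ∀ ζ ∉ M, ∃ C : Set ℂ, IsPreconnected C ∧ C ⊆ Lᶜ ∧ ζ ∈ C ∧
    ((∃ p ∈ P, p ∈ C) ∨ ¬ Bornology.IsBounded C)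

section
variable {P L M : Set ℂ} [CompactSpace L]

theorem Separates.isMovable (h : Separates P L M) (hL : IsCompact L) (hP : P ⊆ Lᶜ) {a : ℂ}
    (ha : a ∉ M) : IsMovable P L a := by
  obtain ⟨C, h1, h2, h3, h4⟩ := h a ha
  exact isMovable_of_isPreconnected hL hP h1 h2 h4 h3

/-- The restriction of a polynomial. -/
noncomputable def polyMap (L : Set ℂ) (p : Polynomial ℂ) : C(L, ℂ) :=
  ⟨fun z => p.eval (z : ℂ), by fun_prop⟩

/-- The polynomial splits into linear factors with movable roots, and the closure of `holUnits` is a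
group. -/
theorem exists_unit_eq_polyMap (h : ∀ a ∉ M, IsMovable P L a) (p : Polynomial ℂ) (hp0 : p ≠ 0)
    (hp : ∀ z ∈ M, p.eval z ≠ 0) :
    ∃ u ∈ (holUnits P L).topologicalClosure, (u : C(L, ℂ)) = polyMap L p := by
  have hs := IsAlgClosed.splits p
  rw [hs.eq_prod_roots]
  have hroots : ∀ a ∈ p.roots, a ∉ M := fun a ha haM =>
    hp a haM (Polynomial.isRoot_of_mem_roots ha)
  have hprod : ∀ s : Multiset ℂ, (∀ a ∈ s, a ∉ M) →
      ∃ u ∈ (holUnits P L).topologicalClosure,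
        (u : C(L, ℂ)) = polyMap L (s.map fun a => Polynomial.X - Polynomial.C a).prod := by
    intro s
    induction s using Multiset.induction_on with
    | empty => exact fun _ => ⟨1, one_mem _, by ext z; simp [polyMap]⟩
    | cons a s ih =>
      intro hs
      obtain ⟨u, hu, hu'⟩ := ih fun b hb => hs b (Multiset.mem_cons_of_mem hb)
      obtain ⟨v, hv, hv'⟩ := h a (hs a (Multiset.mem_cons_self a s))
      refine ⟨v * u, mul_mem hv hu, ?_⟩
      ext z
      simp [hu', hv', polyMap, subConst]
  obtain ⟨u, hu, hu'⟩ := hprod p.roots hroots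
  have hl : p.leadingCoeff ≠ 0 := Polynomial.leadingCoeff_ne_zero.2 hp0
  obtain ⟨c, hc⟩ := isUnit_of_forall_ne_zero (g := ContinuousMap.const L p.leadingCoeff)
    fun z => hl
  have hcm : c ∈ holUnits P L := ⟨fun _ => p.leadingCoeff, differentiableOn_const _,
    fun _ _ => hl, fun z => by rw [hc]; rfl⟩
  refine ⟨c * u, mul_mem (Subgroup.le_topologicalClosure _ hcm) hu, ?_⟩
  ext z
  simp [hu', hc, polyMap]

end

/-- Runge's theorem with poles in `P`. -/
theorem Separates.exists_holomorphic_approx {P L M U : Set ℂ} (h : Separates P L M)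
    (hL : IsCompact L) (hP : P ⊆ Lᶜ) (hM : IsCompact M) (hLM : L ⊆ M) (hU : IsOpen U) (hMU : M ⊆ U)
    {g : ℂ → ℂ} (hg : DifferentiableOn ℂ g U) {ε : ℝ} (hε : 0 < ε) :
    ∃ G : ℂ → ℂ, DifferentiableOn ℂ G Pᶜ ∧ ∀ z ∈ L, ‖G z - g z‖ < ε := by
  have : CompactSpace L := isCompact_iff_compactSpace.mp hL
  obtain ⟨p, q, hpq⟩ := exists_rational_approx hM hU hMU hg (half_pos hε)
  rcases eq_or_ne q 0 with rfl | hq0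
  · exact ⟨0, differentiableOn_const _, fun z hz => absurd (by simp) (hpq z (hLM hz)).1⟩
  obtain ⟨u, hu, hu'⟩ := exists_unit_eq_polyMap (P := P) (L := L) (fun a ha => h.isMovable hL hP ha)
    q hq0 fun z hz => (hpq z hz).1
  have hmem : polyMap L p * ((u⁻¹ : C(L, ℂ)ˣ) : C(L, ℂ)) ∈ (holSubalgebra P L).topologicalClosure := by
    refine mul_mem (Subalgebra.le_topologicalClosure _ ?_)
      (coe_mem_topologicalClosure_of_mem (inv_mem hu))
    exact ⟨fun z => p.eval z, p.differentiable.differentiableOn, fun z => rfl⟩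
  obtain ⟨b, ⟨G, hG, hGb⟩, hb⟩ := Metric.mem_closure_iff.1 hmem _ (half_pos hε)
  refine ⟨G, hG, fun z hz => ?_⟩
  have h1 := (ContinuousMap.dist_apply_le_dist (⟨z, hz⟩ : L)).trans_lt hb
  have h2 := (hpq z (hLM hz)).2
  rw [← hGb, ContinuousMap.mul_apply, units_inv_apply, hu', dist_eq_norm, ← div_eq_mul_inv] at h1
  simp only [polyMap, ContinuousMap.coe_mk] at h1
  rw [norm_sub_rev]
  calc _ = ‖(g z - p.eval z / q.eval z) + (p.eval z / q.eval z - G z)‖ := by congr 1; ring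
    _ ≤ _ := norm_add_le _ _
    _ < ε := by linarith

/-- Runge's theorem for nowhere vanishing functions. -/
theorem Separates.exists_nonvanishing_approx {P L M U : Set ℂ} (h : Separates P L M)
    (hL : IsCompact L) (hP : P ⊆ Lᶜ) (hM : IsCompact M) (hLM : L ⊆ M) (hU : IsOpen U) (hMU : M ⊆ U)
    {g : ℂ → ℂ} (hg : DifferentiableOn ℂ g U) (hg0 : ∀ z ∈ M, g z ≠ 0) {ε : ℝ} (hε : 0 < ε) :
    ∃ G : ℂ → ℂ, DifferentiableOn ℂ G Pᶜ ∧ (∀ z ∈ Pᶜ, G z ≠ 0) ∧ ∀ z ∈ L, ‖G z - g z‖ < ε := by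
  have : CompactSpace L := isCompact_iff_compactSpace.mp hL
  rcases M.eq_empty_or_nonempty with rfl | hMne
  · exact ⟨fun _ => 1, differentiableOn_const _, fun _ _ => one_ne_zero,
      fun z hz => absurd (hLM hz) (by simp)⟩
  obtain ⟨z0, hz0, hmin⟩ := hM.exists_isMinOn hMne (hg.continuousOn.mono hMU).norm
  have hm : 0 < ‖g z0‖ := norm_pos_iff.2 (hg0 z0 hz0)
  -- An error below the minimum of `‖g‖` on `M` keeps the zeros of `p` off `M`, so that zeros and
  -- poles are both movable.
  obtain ⟨p, q, hpq⟩ := exists_rational_approx hM hU hMU hg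
    (show 0 < min ‖g z0‖ (ε / 2) by positivity)
  have hp : ∀ z ∈ M, p.eval z ≠ 0 := by
    intro z hz h0
    have h1 := (hpq z hz).2
    rw [h0, zero_div, sub_zero] at h1
    exact absurd (h1.trans_le (min_le_left _ _)) (not_lt.2 (hmin hz))
  have hq0 : q ≠ 0 := by rintro rfl; exact (hpq z0 hz0).1 (by simp)
  have hp0 : p ≠ 0 := by rintro rfl; exact hp z0 hz0 (by simp)
  obtain ⟨u, hu, hu'⟩ := exists_unit_eq_polyMap (P := P) (L := L) (fun a ha => h.isMovable hL hP ha)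
    q hq0 fun z hz => (hpq z hz).1
  obtain ⟨v, hv, hv'⟩ := exists_unit_eq_polyMap (P := P) (L := L) (fun a ha => h.isMovable hL hP ha)
    p hp0 hp
  have hmem : v * u⁻¹ ∈ closure (holUnits P L : Set C(L, ℂ)ˣ) := mul_mem hv (inv_mem hu)
  have hnh : ∀ᶠ w : C(L, ℂ)ˣ in 𝓝 (v * u⁻¹),
      dist (((v * u⁻¹ : C(L, ℂ)ˣ)) : C(L, ℂ)) (w : C(L, ℂ)) < ε / 2 := by
    have hc : Continuous fun w : C(L, ℂ)ˣ => dist (((v * u⁻¹ : C(L, ℂ)ˣ)) : C(L, ℂ)) (w : C(L, ℂ)) :=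
      continuous_const.dist Units.continuous_val
    refine hc.continuousAt.eventually_lt continuousAt_const ?_
    simpa using half_pos hε
  obtain ⟨b, hb, ⟨G, hG, hG0, hGb⟩⟩ := mem_closure_iff_nhds.1 hmem _ hnh
  refine ⟨G, hG, hG0, fun z hz => ?_⟩
  have h1 := (ContinuousMap.dist_apply_le_dist (⟨z, hz⟩ : L)).trans_lt hb
  have h2 := (hpq z (hLM hz)).2.trans_le (min_le_right _ _)
  rw [← hGb, Units.val_mul, ContinuousMap.mul_apply, units_inv_apply, hu', hv', dist_eq_norm,
    ← div_eq_mul_inv] at h1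
  simp only [polyMap, ContinuousMap.coe_mk] at h1
  rw [norm_sub_rev]
  calc _ = ‖(g z - p.eval z / q.eval z) + (p.eval z / q.eval z - G z)‖ := by congr 1; ring
    _ ≤ _ := norm_add_le _ _
    _ < ε := by linarith

/-! ### Principal parts at isolated singularities -/

section laurent
variable {f : ℂ → ℂ} {ρ' : ℝ}

/-- The circle may be shrunk to radius `r` without changing the integral. As `r` is arbitrarily
small, the coefficients of the principal part decay faster than any geometric sequence. -/
theorem circleIntegral_pow_bound (hf : DifferentiableOn ℂ f (ball 0 ρ' \ {0})) {ρ : ℝ}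
    (hρ : ρ < ρ') {r : ℝ} (hr : 0 < r) (hrρ : r ≤ ρ) : ∃ C, 0 ≤ C ∧ ∀ n : ℕ,
      ‖∮ ζ in C(0, ρ), f ζ * ζ ^ n‖ ≤ C * r ^ n := by
  have hsub : closedBall (0 : ℂ) ρ \ ball 0 r ⊆ ball 0 ρ' \ {0} := by
    rintro z ⟨h1, h2⟩
    refine ⟨closedBall_subset_ball hρ h1, ?_⟩
    rintro rfl
    exact h2 (mem_ball_self hr)
  have hsub' : ball (0 : ℂ) ρ \ closedBall 0 r ⊆ ball 0 ρ' \ {0} := fun z hz =>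
    hsub ⟨ball_subset_closedBall hz.1, fun h => hz.2 (ball_subset_closedBall h)⟩
  have hU : IsOpen (ball (0 : ℂ) ρ' \ {0}) := isOpen_ball.sdiff isClosed_singleton
  have hsph : sphere (0 : ℂ) r ⊆ ball 0 ρ' \ {0} := fun z hz => hsub
    ⟨closedBall_subset_closedBall hrρ (sphere_subset_closedBall hz), by
      simp only [mem_sphere, mem_ball, dist_zero_right] at *; linarith⟩
  obtain ⟨C, hC⟩ := (isCompact_sphere (0 : ℂ) r).exists_bound_of_continuousOn
    (hf.continuousOn.mono hsph)
  have hC0 : 0 ≤ C := by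
    have := hC (r : ℂ) (by simp [abs_of_pos hr])
    exact (norm_nonneg _).trans this
  refine ⟨2 * Real.pi * r * C, by positivity, fun n => ?_⟩
  rw [circleIntegral_eq_of_differentiable_on_annulus_off_countable hr hrρ countable_empty]
  · refine (circleIntegral.norm_integral_le_of_norm_le_const hr.le (C := C * r ^ n) ?_).trans_eq
      (by ring)
    intro z hz
    rw [norm_mul, norm_pow, mem_sphere_zero_iff_norm.1 hz]
    gcongr
    exact hC z hz
  · exact (hf.continuousOn.mono hsub).mul (by fun_prop)
  · rintro z ⟨hz, -⟩
    exact (hf.differentiableAt (hU.mem_nhds (hsub' hz))).mul (by fun_prop)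

/-- The expansion of a Cauchy integral outside the circle. -/
theorem hasSum_circleIntegral_outside {r : ℝ} (hr : 0 < r) (hf : ContinuousOn f (sphere 0 r)) {z : ℂ}
    (hz : r < ‖z‖) (hs : Summable fun n : ℕ => (∮ ζ in C(0, r), f ζ * ζ ^ n) * (z⁻¹) ^ (n + 1)) :
    HasSum (fun n : ℕ => (∮ ζ in C(0, r), f ζ * ζ ^ n) * (z⁻¹) ^ (n + 1))
      (∮ ζ in C(0, r), f ζ * (z - ζ)⁻¹) := by
  have hz0 : z ≠ 0 := norm_pos_iff.1 (hr.trans hz)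
  have hne : ∀ ζ ∈ sphere (0 : ℂ) r, z - ζ ≠ 0 := by
    intro ζ hζ h
    rw [sub_eq_zero] at h
    rw [h, mem_sphere_zero_iff_norm.1 hζ] at hz
    exact lt_irrefl _ hz
  have hci : ∀ n : ℕ, CircleIntegrable (fun ζ => f ζ * ζ ^ n) 0 r := fun n =>
    (hf.mul (by fun_prop)).circleIntegrable hr.le
  have hci' : ∀ n : ℕ, ContinuousOn (fun ζ => f ζ * ζ ^ n * (z - ζ)⁻¹) (sphere 0 r) := fun n =>
    (hf.mul (by fun_prop)).mul (ContinuousOn.inv₀ (by fun_prop) hne)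
  have hpart : ∀ N : ℕ, ∑ n ∈ Finset.range N, (∮ ζ in C(0, r), f ζ * ζ ^ n) * (z⁻¹) ^ (n + 1) =
      (∮ ζ in C(0, r), f ζ * (z - ζ)⁻¹) - (z⁻¹) ^ N * ∮ ζ in C(0, r), f ζ * ζ ^ N * (z - ζ)⁻¹ := by
    intro N
    induction N with
    | zero => simp
    | succ N ih =>
      rw [Finset.sum_range_succ, ih]
      have : ∮ ζ in C(0, r), f ζ * ζ ^ N * (z - ζ)⁻¹ = ∮ ζ in C(0, r),
          (z⁻¹ * (f ζ * ζ ^ N) + z⁻¹ * (f ζ * ζ ^ (N + 1) * (z - ζ)⁻¹)) := by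
        refine circleIntegral.integral_congr hr.le fun ζ hζ => ?_
        have := hne ζ hζ
        field_simp
        ring
      rw [this, circleIntegral.integral_add, circleIntegral.integral_const_mul,
        circleIntegral.integral_const_mul]
      · ring
      · exact (ContinuousOn.mul continuousOn_const (hf.mul (by fun_prop))).circleIntegrable hr.le
      · exact (ContinuousOn.mul continuousOn_const (hci' _)).circleIntegrable hr.le
  obtain ⟨C, hC⟩ := (isCompact_sphere (0 : ℂ) r).exists_bound_of_continuousOn (hci' 0)
  have hlim : Tendsto (fun N : ℕ => (z⁻¹) ^ N * ∮ ζ in C(0, r), f ζ * ζ ^ N * (z - ζ)⁻¹) atTop (𝓝 0) := by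
    have hq : Tendsto (fun N : ℕ => 2 * Real.pi * r * C * (r / ‖z‖) ^ N) atTop (𝓝 0) := by
      have := (tendsto_pow_atTop_nhds_zero_of_lt_one (by positivity)
        ((div_lt_one (hr.trans hz)).2 hz)).const_mul (2 * Real.pi * r * C)
      simpa using this
    refine squeeze_zero_norm (fun N => ?_) hq
    rw [norm_mul, norm_pow, norm_inv]
    have : ‖∮ ζ in C(0, r), f ζ * ζ ^ N * (z - ζ)⁻¹‖ ≤ 2 * Real.pi * r * (C * r ^ N) := by
      refine circleIntegral.norm_integral_le_of_norm_le_const hr.le fun ζ hζ => ?_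
      have h1 := hC ζ hζ
      rw [pow_zero, mul_one] at h1
      rw [mul_right_comm, norm_mul, norm_pow, mem_sphere_zero_iff_norm.1 hζ]
      gcongr
    calc _ ≤ ‖z‖⁻¹ ^ N * (2 * Real.pi * r * (C * r ^ N)) := by gcongr
      _ = _ := by rw [div_pow, inv_pow]; ring
  have h1 := hs.hasSum.tendsto_sum_nat
  simp_rw [hpart] at h1
  have h2 := tendsto_nhds_unique h1 (tendsto_const_nhds.sub hlim)
  rw [sub_zero] at h2
  rw [← h2]
  exact hs.hasSum

/-- The principal part of the Laurent expansion at an isolated singularity. -/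
theorem exists_principal_part_zero (hρ' : 0 < ρ') (hf : DifferentiableOn ℂ f (ball 0 ρ' \ {0})) :
    ∃ g : ℂ → ℂ, Differentiable ℂ g ∧ g 0 = 0 ∧ ∃ ρ > 0, ∃ h : ℂ → ℂ, DifferentiableOn ℂ h (ball 0 ρ) ∧
      ∀ z ∈ ball 0 ρ, z ≠ 0 → f z = g z⁻¹ + h z := by
  set ρ := ρ' / 2 with hρdef
  have hρ : 0 < ρ := by positivity
  have hρρ : ρ < ρ' := half_lt_self hρ'
  have hU : IsOpen (ball (0 : ℂ) ρ' \ {0}) := isOpen_ball.sdiff isClosed_singleton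
  set a : ℕ → ℂ := fun n => ∮ ζ in C(0, ρ), f ζ * ζ ^ n with ha
  have hbound : ∀ B : ℝ, 0 < B → ∃ u : ℕ → ℝ, Summable u ∧ ∀ n, ∀ w ∈ ball (0 : ℂ) B,
      ‖a n * w ^ (n + 1)‖ ≤ u n := by
    intro B hB
    -- A radius of at most `1 / (2 * B)` makes the series on the disc of radius `B` geometric with
    -- ratio `1 / 2`.
    obtain ⟨C, hC0, hC⟩ := circleIntegral_pow_bound hf hρρ
      (show 0 < min ρ (1 / (2 * B)) by positivity) (min_le_left _ _)
    refine ⟨fun n => C * B * (1 / 2) ^ n, ?_, fun n w hw => ?_⟩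
    · exact (summable_geometric_of_lt_one (by norm_num) (by norm_num)).mul_left _
    · have h1 : min ρ (1 / (2 * B)) * B ≤ 1 / 2 := by
        calc _ ≤ 1 / (2 * B) * B := by gcongr; exact min_le_right _ _
          _ = 1 / 2 := by field_simp
      have hw' : ‖w‖ ≤ B := (mem_ball_zero_iff.1 hw).le
      rw [norm_mul, norm_pow]
      calc _ ≤ (C * (min ρ (1 / (2 * B))) ^ n) * B ^ (n + 1) := by
            gcongr
            exact hC n
        _ = C * B * (min ρ (1 / (2 * B)) * B) ^ n := by rw [mul_pow]; ring
        _ ≤ C * B * (1 / 2) ^ n := by gcongr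
  set κ : ℂ := (2 * Real.pi * I)⁻¹ with hκ
  set g : ℂ → ℂ := fun w => κ * ∑' n, a n * w ^ (n + 1) with hg
  set h : ℂ → ℂ := fun w => κ • ∮ ζ in C(0, ρ), (ζ - w)⁻¹ • f ζ with hh
  refine ⟨g, ?_, by simp [hg], ρ, hρ, h, ?_, ?_⟩
  · intro w
    obtain ⟨u, hu, hub⟩ := hbound (‖w‖ + 1) (by positivity)
    have := differentiableOn_tsum_of_summable_norm hu (F := fun n w => a n * w ^ (n + 1))
      (fun n => by fun_prop) isOpen_ball hub
    exact (this.differentiableAt (isOpen_ball.mem_nhds (by simp))).const_mul κ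
  · have hci : CircleIntegrable f 0 ρ := (hf.continuousOn.mono fun z hz =>
      ⟨closedBall_subset_ball hρρ (sphere_subset_closedBall hz), by
        rintro rfl; simp [hρ.ne] at hz⟩).circleIntegrable hρ.le
    obtain ⟨R, hR⟩ : ∃ R : NNReal, (R : ℝ) = ρ := ⟨⟨ρ, hρ.le⟩, rfl⟩
    rw [← hR] at hci
    have h2 := (hasFPowerSeriesOn_cauchy_integral hci (by rw [← NNReal.coe_pos, hR]; exact hρ)).differentiableOn
    rwa [Metric.eball_coe, hR] at h2
  · intro z hz hz0
    have hzρ : ‖z‖ < ρ := mem_ball_zero_iff.1 hz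
    set r := ‖z‖ / 2 with hr
    have hr0 : 0 < r := by positivity
    have hrz : r < ‖z‖ := half_lt_self (norm_pos_iff.2 hz0)
    have hzU : z ∈ ball (0 : ℂ) ρ' \ {0} := ⟨ball_subset_ball hρρ.le hz, hz0⟩
    have hsub : closedBall (0 : ℂ) ρ \ ball 0 r ⊆ ball 0 ρ' \ {0} := by
      rintro z ⟨h1, h2⟩
      refine ⟨closedBall_subset_ball hρρ h1, ?_⟩
      rintro rfl
      exact h2 (mem_ball_self hr0)
    have hsub' : ball (0 : ℂ) ρ \ closedBall 0 r ⊆ ball 0 ρ' \ {0} := fun z hz =>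
      hsub ⟨ball_subset_closedBall hz.1, fun h => hz.2 (ball_subset_closedBall h)⟩
    have hsphr : sphere (0 : ℂ) r ⊆ ball 0 ρ' \ {0} := fun w hw => hsub
      ⟨by simp only [mem_sphere, mem_closedBall, dist_zero_right] at *; linarith, by
        simp only [mem_sphere, mem_ball, dist_zero_right] at *; linarith⟩
    have hsphρ : sphere (0 : ℂ) ρ ⊆ ball 0 ρ' \ {0} := fun w hw => hsub
      ⟨sphere_subset_closedBall hw, by
        simp only [mem_sphere, mem_ball, dist_zero_right] at *; linarith⟩
    have han : ∀ n, a n = ∮ ζ in C(0, r), f ζ * ζ ^ n := fun n => by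
      refine circleIntegral_eq_of_differentiable_on_annulus_off_countable hr0 (by linarith)
        countable_empty ((hf.continuousOn.mono hsub).mul (by fun_prop)) ?_
      rintro z ⟨hz, -⟩
      exact (hf.differentiableAt (hU.mem_nhds (hsub' hz))).mul (by fun_prop)
    obtain ⟨u, hu, hub⟩ := hbound (‖z⁻¹‖ + 1) (by positivity)
    have hsum : Summable fun n : ℕ => a n * (z⁻¹) ^ (n + 1) :=
      Summable.of_norm_bounded hu fun n => hub n _ (by simp)
    have hgz : g z⁻¹ = κ * ∮ ζ in C(0, r), f ζ * (z - ζ)⁻¹ := by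
      simp only [hg]
      congr 1
      simp_rw [han] at hsum ⊢
      exact (hasSum_circleIntegral_outside hr0 (hf.continuousOn.mono hsphr) hrz hsum).tsum_eq
    -- Cauchy's formula for the annulus: the difference quotient at `z` has equal integrals over
    -- both circles, while the integral of `(ζ - z)⁻¹` is `2πi` over the outer circle and `0` over
    -- the inner one.
    have hds := (differentiableOn_dslope (hU.mem_nhds hzU)).2 hf
    have heq : (∮ ζ in C(0, ρ), dslope f z ζ) = ∮ ζ in C(0, r), dslope f z ζ := by
      refine circleIntegral_eq_of_differentiable_on_annulus_off_countable hr0 (by linarith)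
        countable_empty (hds.continuousOn.mono hsub) ?_
      rintro z ⟨hz, -⟩
      exact hds.differentiableAt (hU.mem_nhds (hsub' hz))
    have hexp : ∀ s : ℝ, 0 < s → sphere (0 : ℂ) s ⊆ ball 0 ρ' \ {0} → s ≠ ‖z‖ →
        (∮ ζ in C(0, s), dslope f z ζ) =
          (∮ ζ in C(0, s), f ζ * (ζ - z)⁻¹) - f z * ∮ ζ in C(0, s), (ζ - z)⁻¹ := by
      intro s hs hsU hsz
      have hne : ∀ ζ ∈ sphere (0 : ℂ) s, ζ ≠ z := by
        rintro ζ hζ rfl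
        exact hsz (mem_sphere_zero_iff_norm.1 hζ).symm
      have hic : ContinuousOn (fun ζ : ℂ => (ζ - z)⁻¹) (sphere 0 s) :=
        ContinuousOn.inv₀ (by fun_prop) fun ζ hζ => sub_ne_zero.2 (hne ζ hζ)
      have i1 : CircleIntegrable (fun ζ => f ζ * (ζ - z)⁻¹) 0 s :=
        ((hf.continuousOn.mono hsU).mul hic).circleIntegrable hs.le
      have i2 : CircleIntegrable (fun ζ => f z * (ζ - z)⁻¹) 0 s :=
        (continuousOn_const.mul hic).circleIntegrable hs.le
      rw [← circleIntegral.integral_const_mul, ← circleIntegral.integral_sub i1 i2]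
      refine circleIntegral.integral_congr hs.le fun ζ hζ => ?_
      rw [dslope_of_ne _ (hne ζ hζ), slope_def_field]
      ring
    rw [hexp ρ hρ hsphρ hzρ.ne', hexp r hr0 hsphr hrz.ne,
      circleIntegral.integral_sub_inv_of_mem_ball hz] at heq
    have hzero : ∮ ζ in C(0, r), (ζ - z)⁻¹ = 0 := by
      have hne : ∀ ζ ∈ closedBall (0 : ℂ) r, ζ - z ≠ 0 := by
        intro ζ hζ h0
        rw [sub_eq_zero] at h0
        rw [h0, mem_closedBall_zero_iff] at hζ
        linarith
      refine circleIntegral_eq_zero_of_differentiable_on_off_countable hr0.le countable_empty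
        (ContinuousOn.inv₀ (by fun_prop) hne) fun ζ hζ => ?_
      exact DifferentiableAt.inv (by fun_prop) (hne ζ (ball_subset_closedBall hζ.1))
    rw [hzero] at heq
    have hneg : ∮ ζ in C(0, r), f ζ * (z - ζ)⁻¹ = - ∮ ζ in C(0, r), f ζ * (ζ - z)⁻¹ := by
      rw [← neg_one_mul, ← circleIntegral.integral_const_mul]
      congr 1
      ext ζ
      rw [← neg_sub z ζ, inv_neg]
      ring
    have h2π : (2 * Real.pi * I : ℂ) ≠ 0 := by simp [Real.pi_ne_zero]
    rw [hgz, hneg]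
    simp only [hh, smul_eq_mul]
    simp_rw [mul_comm _ (f _)]
    have hκ' : κ * (2 * Real.pi * I) = 1 := inv_mul_cancel₀ h2π
    linear_combination (-f z) * hκ' - κ * heq

end laurent

theorem exists_principal_part {U : Set ℂ} {p : ℂ} (hU : U ∈ 𝓝 p) {f : ℂ → ℂ}
    (hf : DifferentiableOn ℂ f (U \ {p})) :
    ∃ g : ℂ → ℂ, Differentiable ℂ g ∧ g 0 = 0 ∧ ∃ h : ℂ → ℂ, DifferentiableAt ℂ h p ∧
      ∀ᶠ z in 𝓝 p, z ≠ p → f z = g (z - p)⁻¹ + h z := by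
  obtain ⟨ρ', hρ', hsub⟩ := Metric.mem_nhds_iff.1 hU
  have hf' : DifferentiableOn ℂ (fun z => f (z + p)) (ball 0 ρ' \ {0}) := by
    refine hf.comp (by fun_prop) fun z hz => ⟨hsub ?_, ?_⟩
    · simpa using hz.1
    · simpa using hz.2
  obtain ⟨g, hg, hg0, ρ, hρ, h, hh, heq⟩ := exists_principal_part_zero hρ' hf'
  refine ⟨g, hg, hg0, fun z => h (z - p), ?_, ?_⟩
  · have : DifferentiableAt ℂ h (p - p) := by
      rw [sub_self]
      exact hh.differentiableAt (ball_mem_nhds 0 hρ)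
    exact this.comp (f := fun z => z - p) p (by fun_prop)
  · filter_upwards [ball_mem_nhds p hρ] with z hz hzp
    have := heq (z - p) (by simpa [dist_eq_norm] using hz) (sub_ne_zero.2 hzp)
    simpa using this

/-! ### Primitives off a finite set -/

/-- A holomorphic function off a finite set has a primitive up to simple fractions. -/
theorem exists_primitive_add_simple_fractions (P : Finset ℂ) : ∀ f : ℂ → ℂ,
    DifferentiableOn ℂ f (P : Set ℂ)ᶜ → ∃ (G : ℂ → ℂ) (c : ℂ → ℂ),
      ∀ z ∉ P, HasDerivAt G (f z - ∑ p ∈ P, c p * (z - p)⁻¹) z := by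
  classical
  induction P using Finset.induction_on with
  | empty =>
    intro f hf
    have hf' : Differentiable ℂ f := by simpa [differentiableOn_univ] using hf
    obtain ⟨G, hG⟩ := hf'.isExactOn_univ
    exact ⟨G, 0, fun z _ => by simpa using hG z (mem_univ z)⟩
  | insert p P hp ih =>
    intro f hf
    have hPo : IsOpen ((P : Set ℂ)ᶜ) := P.finite_toSet.isClosed.isOpen_compl
    have hfp : DifferentiableOn ℂ f ((P : Set ℂ)ᶜ \ {p}) := by
      convert hf using 1
      ext z; simp [not_or, and_comm]
    obtain ⟨g, hg, hg0, h, hh, heq⟩ := exists_principal_part (hPo.mem_nhds hp) hfp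
    set F : ℂ → ℂ := Function.update (fun z => f z - g (z - p)⁻¹) p (h p) with hF
    have hFd : DifferentiableOn ℂ F (P : Set ℂ)ᶜ := by
      intro z hz
      refine DifferentiableAt.differentiableWithinAt ?_
      by_cases hzp : z = p
      · subst hzp
        refine hh.congr_of_eventuallyEq ?_
        filter_upwards [heq] with w hw
        by_cases hwz : w = z
        · simp [hF, hwz]
        · simp [hF, hwz, hw hwz]
      · have h1 : DifferentiableAt ℂ f z := hfp.differentiableAt
          ((hPo.sdiff isClosed_singleton).mem_nhds ⟨hz, hzp⟩)
        have h2 : DifferentiableAt ℂ (fun z => g (z - p)⁻¹) z :=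
          (hg _).comp z (DifferentiableAt.inv (by fun_prop) (sub_ne_zero.2 hzp))
        refine (h1.sub h2).congr_of_eventuallyEq ?_
        filter_upwards [isOpen_ne.mem_nhds hzp] with w hw
        simp [hF, Function.update_of_ne hw]
    obtain ⟨G, c, hGc⟩ := ih F hFd
    have hds : ∀ φ : ℂ → ℂ, Differentiable ℂ φ → Differentiable ℂ (dslope φ 0) := fun φ hφ => by
      rw [← differentiableOn_univ] at hφ ⊢
      exact (differentiableOn_dslope univ_mem).2 hφ
    -- Write `g w = c0 * w + w ^ 2 * g₂ w`. With `w = (z - p)⁻¹` one has `dw/dz = -w ^ 2`, so the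
    -- second term has primitive `-K w`, where `K' = g₂`. Only `c0 / (z - p)` is left over.
    obtain ⟨K, hK⟩ := (hds _ (hds g hg)).isExactOn_univ
    set c0 := dslope g 0 0
    have hgw : ∀ w, w ≠ 0 → g w = c0 * w + w ^ 2 * dslope (dslope g 0) 0 w := by
      intro w hw
      rw [dslope_of_ne _ hw, slope_def_field, dslope_of_ne _ hw, slope_def_field, hg0]
      field_simp
      ring
    refine ⟨fun z => G z - K (z - p)⁻¹, Function.update c p c0, fun z hz => ?_⟩
    rw [Finset.mem_insert, not_or] at hz
    have hz' : z - p ≠ 0 := sub_ne_zero.2 hz.1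
    have h1 := hGc z hz.2
    have h2 : HasDerivAt (fun z => K (z - p)⁻¹)
        (dslope (dslope g 0) 0 (z - p)⁻¹ * (-1 / (z - p) ^ 2)) z :=
      (hK (z - p)⁻¹ (mem_univ _)).comp z (((hasDerivAt_id z).sub_const p).inv hz')
    have e : f z - ∑ q ∈ insert p P, Function.update c p c0 q * (z - q)⁻¹ =
        F z - ∑ q ∈ P, c q * (z - q)⁻¹ - dslope (dslope g 0) 0 (z - p)⁻¹ * (-1 / (z - p) ^ 2) := by
      rw [Finset.sum_insert hp, Function.update_self, Finset.sum_congr rfl fun q hq => by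
        rw [Function.update_of_ne (fun h : q = p => hp (h ▸ hq))]]
      simp only [hF, Function.update_of_ne hz.1]
      rw [hgw _ (inv_ne_zero hz')]
      field_simp
      ring
    rw [e]
    exact h1.sub h2

/-! ### Correcting periods by the implicit function theorem -/

/-- The implicit function theorem for `(u, t) ↦ Λ (b * exp (u + w t))` at the origin, where the
partial derivative in `t` is the map assumed invertible. The derivative of `τ` along `v` is minus
the inverse of that map applied to `Λ (b * v)`, so perturbations that are exact to first order need
no first-order correction. -/
theorem exists_implicit_exp {X T : Type*} [NormedCommRing X] [NormedAlgebra ℂ X] [CompleteSpace X]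
    [NormedAddCommGroup T] [NormedSpace ℂ T] [CompleteSpace T] (b : X) (Λ : X →L[ℂ] T)
    (w : T →L[ℂ] X) (hb : Λ b = 0)
    (hM : (Λ ∘L (ContinuousLinearMap.mul ℂ X b) ∘L w).IsInvertible) :
    ∃ τ : X → T, τ 0 = 0 ∧ ContDiffAt ℂ 1 τ 0 ∧
      (∀ᶠ u in 𝓝 0, Λ (b * NormedSpace.exp (u + w (τ u))) = 0) ∧
      ∀ v, Λ (b * v) = 0 → fderiv ℂ τ 0 v = 0 := by
  set f : X × T → T := fun p => Λ (b * NormedSpace.exp (p.1 + w p.2)) with hf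
  have hexp : ContDiff ℂ 1 (NormedSpace.exp : X → X) :=
    contDiff_iff_contDiffAt.2 fun x => (NormedSpace.exp_analytic (𝕂 := ℂ) x).contDiffAt
  have hfc : ContDiff ℂ 1 f := by
    have h1 : ContDiff ℂ 1 fun p : X × T => NormedSpace.exp (p.1 + w p.2) :=
      hexp.comp (by fun_prop)
    exact Λ.contDiff.comp (contDiff_const.mul h1)
  set f' : X × T →L[ℂ] T := Λ ∘L (ContinuousLinearMap.mul ℂ X b) ∘L
    (ContinuousLinearMap.fst ℂ X T + w ∘L ContinuousLinearMap.snd ℂ X T) with hf'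
  have hder : fderiv ℂ f (0, 0) = f' := by
    have h0 : HasFDerivAt (fun p : X × T => p.1 + w p.2)
        (ContinuousLinearMap.fst ℂ X T + w ∘L ContinuousLinearMap.snd ℂ X T) (0, 0) :=
      (ContinuousLinearMap.fst ℂ X T + w ∘L ContinuousLinearMap.snd ℂ X T).hasFDerivAt
    have h1 : HasFDerivAt (NormedSpace.exp : X → X) (1 : X →L[ℂ] X)
        ((fun p : X × T => p.1 + w p.2) (0, 0)) := by
      simpa using hasFDerivAt_exp_zero (𝕂 := ℂ) (𝔸 := X)
    have h2 := h1.comp (0, 0) h0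
    have h3 := (Λ ∘L ContinuousLinearMap.mul ℂ X b).hasFDerivAt.comp (0, 0) h2
    exact h3.fderiv
  have hfat : ContDiffAt ℂ 1 f (0, 0) := hfc.contDiffAt
  have hinr : fderiv ℂ f (0, 0) ∘L .inr ℂ X T = Λ ∘L (ContinuousLinearMap.mul ℂ X b) ∘L w := by
    rw [hder]; ext t; simp [hf']
  have if₂ : (fderiv ℂ f (0, 0) ∘L .inr ℂ X T).IsInvertible := by rwa [hinr]
  refine ⟨hfat.implicitFunction one_ne_zero if₂, hfat.implicitFunction_apply_self one_ne_zero if₂,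
    hfat.contDiffAt_implicitFunction one_ne_zero if₂, ?_, fun v hv => ?_⟩
  · filter_upwards [hfat.eventually_apply_implicitFunction one_ne_zero if₂] with u hu
    have h0 : f (0, 0) = 0 := by simp [hf, hb]
    rw [h0] at hu
    exact hu
  · have h1 := (hfat.hasStrictFDerivAt_implicitFunction one_ne_zero if₂).hasFDerivAt.fderiv
    rw [h1, hder]
    simp [hf', hv]

/-! ### Period functionals -/

/-- Integration against a continuous density as a functional on `C(Y, ℂ)`. -/
noncomputable def integralCLM {Y : Type*} [TopologicalSpace Y] [CompactSpace Y] [MeasurableSpace Y]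
    [OpensMeasurableSpace Y] (μ : Measure Y) [IsFiniteMeasure μ] (ψ : C(Y, ℂ)) : C(Y, ℂ) →L[ℂ] ℂ :=
  LinearMap.mkContinuous
    { toFun := fun g => ∫ y, g y * ψ y ∂μ
      map_add' := fun g h => by
        have hi : ∀ g : C(Y, ℂ), Integrable (fun y => g y * ψ y) μ := fun g =>
          (g * ψ).continuous.integrable_of_hasCompactSupport (HasCompactSupport.of_compactSpace _)
        simp only [ContinuousMap.add_apply, add_mul]
        exact integral_add (hi g) (hi h)
      map_smul' := fun c g => by
        simp only [ContinuousMap.smul_apply, smul_eq_mul, mul_assoc, RingHom.id_apply]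
        exact integral_const_mul _ _ }
    (‖ψ‖ * μ.real univ) (fun g => by
      refine (norm_integral_le_of_norm_le_const (C := ‖g‖ * ‖ψ‖) (Eventually.of_forall fun y => ?_)).trans_eq
        (by ring)
      rw [norm_mul]
      exact mul_le_mul (g.norm_coe_le_norm y) (ψ.norm_coe_le_norm y) (norm_nonneg _) (norm_nonneg _))

theorem integralCLM_apply {Y : Type*} [TopologicalSpace Y] [CompactSpace Y] [MeasurableSpace Y]
    [OpensMeasurableSpace Y] (μ : Measure Y) [IsFiniteMeasure μ] (ψ g : C(Y, ℂ)) :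
    integralCLM μ ψ g = ∫ y, g y * ψ y ∂μ := rfl

theorem isFiniteMeasure_comap_coe {L : Set ℂ} (hL : IsCompact L) :
    IsFiniteMeasure (Measure.comap ((↑) : L → ℂ) volume) := ⟨by
  have hm : MeasurableSet L := hL.isClosed.measurableSet
  rw [Measure.comap_apply _ Subtype.val_injective
    (fun s hs => hm.subtype_image hs) _ MeasurableSet.univ]
  simpa using hL.measure_lt_top⟩

/-- The functional `g ↦ ∫ g ∂̄χ` on `C(L, ℂ)`. -/
theorem exists_dbar_functional {L : Set ℂ} (hL : IsCompact L) [CompactSpace L] {χ : ℂ → ℂ}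
    (hχ : ContDiff ℝ ∞ χ) (hs : tsupport (fderiv ℝ χ) ⊆ L) :
    ∃ lam : C(L, ℂ) →L[ℂ] ℂ, ∀ (g : C(L, ℂ)) (G : ℂ → ℂ), (∀ z : L, g z = G z) →
      lam g = ∫ z, G z * dbar χ z := by
  have := isFiniteMeasure_comap_coe hL
  refine ⟨integralCLM (Measure.comap ((↑) : L → ℂ) volume)
    ⟨fun z => dbar χ z, hχ.continuous_dbar.comp continuous_subtype_val⟩, fun g G h => ?_⟩
  rw [integralCLM_apply, ← setIntegral_eq_integral_of_forall_compl_eq_zero (s := L)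
    (fun w hw => ?_), ← integral_subtype_comap hL.isClosed.measurableSet]
  · simp [h]
  · rw [image_eq_zero_of_notMem_tsupport fun hh => hw (hs (tsupport_dbar_subset _ hh)), mul_zero]

/-- `Λ` computes (up to a constant) the residues at the points of `P`. -/
structure IsPeriodFunctional (P : Finset ℂ) (L : Set ℂ) [CompactSpace L]
    (Λ : C(L, ℂ) →L[ℂ] (P → ℂ)) : Prop where
  eq_zero_of_deriv : ∀ (r : ℂ → ℂ) (V : Set ℂ), IsOpen V → L ⊆ V → DifferentiableOn ℂ r V →
    ∀ g : C(L, ℂ), (∀ z : L, g z = deriv r z) → Λ g = 0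
  apply_inv : ∀ (p : P) (g : C(L, ℂ)), (∀ z : L, g z = ((z : ℂ) - p)⁻¹) →
    Λ g = Pi.single p (-(Real.pi : ℂ))
  exists_primitive : ∀ q : ℂ → ℂ, DifferentiableOn ℂ q (P : Set ℂ)ᶜ → ∀ g : C(L, ℂ),
    (∀ z : L, g z = q z) → Λ g = 0 → ∃ H : ℂ → ℂ, ∀ z ∉ P, HasDerivAt H (q z) z

/-- The component at `p` is `g ↦ ∫ g ∂̄χ_p`: the cut-off `χ p` replaces a contour around `p`. It
kills derivatives and is dual to the simple fractions. Hence if all periods of `q` vanish, so do the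
coefficients of the simple fractions obstructing a primitive. -/
theorem exists_isPeriodFunctional {P : Finset ℂ} {L : Set ℂ} (hL : IsCompact L) [CompactSpace L]
    (hPL : ∀ p ∈ P, p ∉ L) {χ : ℂ → ℂ → ℂ} (hχ : ∀ p ∈ P, ContDiff ℝ ∞ (χ p))
    (hc : ∀ p ∈ P, HasCompactSupport (χ p)) (hs : ∀ p ∈ P, tsupport (fderiv ℝ (χ p)) ⊆ L)
    (h1 : ∀ p ∈ P, χ p p = 1) (h0 : ∀ p ∈ P, ∀ q ∈ P, p ≠ q → χ p q = 0) :
    ∃ Λ : C(L, ℂ) →L[ℂ] (P → ℂ), IsPeriodFunctional P L Λ := by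
  classical
  choose lam hlam using fun p : P => exists_dbar_functional hL (hχ p p.2) (hs p p.2)
  set Λ : C(L, ℂ) →L[ℂ] (P → ℂ) := ContinuousLinearMap.pi lam with hΛ
  have hPc : L ⊆ (P : Set ℂ)ᶜ := fun z hz hzP => hPL z hzP hz
  have A : ∀ (r : ℂ → ℂ) (V : Set ℂ), IsOpen V → L ⊆ V → DifferentiableOn ℂ r V →
      ∀ g : C(L, ℂ), (∀ z : L, g z = deriv r z) → Λ g = 0 := by
    intro r V hV hLV hr g hg
    ext p
    rw [hΛ, ContinuousLinearMap.pi_apply, hlam p g _ hg]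
    exact integral_deriv_mul_dbar_eq_zero hV hr (hχ p p.2) (hc p p.2) ((hs p p.2).trans hLV)
  have B : ∀ (p : P) (g : C(L, ℂ)), (∀ z : L, g z = ((z : ℂ) - p)⁻¹) →
      Λ g = Pi.single p (-(Real.pi : ℂ)) := by
    intro p g hg
    ext q
    rw [hΛ, ContinuousLinearMap.pi_apply, hlam q g (fun z => (z - p)⁻¹) hg]
    have h := integral_dbar_div_sub (hχ q q.2) (hc q q.2) p
    simp_rw [div_eq_inv_mul] at h
    rw [h]
    by_cases hqp : q = p
    · subst hqp
      simp [h1 q q.2]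
    · rw [h0 q q.2 p p.2 (fun e => hqp (Subtype.ext e)), Pi.single_eq_of_ne hqp]
      simp
  refine ⟨Λ, A, B, fun q hq g hg hΛg => ?_⟩
  obtain ⟨G, c, hG⟩ := exists_primitive_add_simple_fractions P q hq
  have hne : ∀ (p : P) (z : L), (z : ℂ) - p ≠ 0 := fun p z h =>
    hPL p p.2 (by rw [← sub_eq_zero.1 h]; exact z.2)
  set e : P → C(L, ℂ) := fun p => ⟨fun z => ((z : ℂ) - p)⁻¹,
    Continuous.inv₀ (by fun_prop) (hne p)⟩ with he
  have hPo : IsOpen ((P : Set ℂ)ᶜ) := P.finite_toSet.isClosed.isOpen_compl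
  have h2 : Λ (g - ∑ p : P, c p • e p) = 0 := by
    refine A G _ hPo hPc (fun z hz => (hG z hz).differentiableAt.differentiableWithinAt) _ fun z => ?_
    rw [(hG z (hPc z.2)).deriv, ContinuousMap.sub_apply, hg, ContinuousMap.sum_apply]
    simp only [he, ContinuousMap.smul_apply, ContinuousMap.coe_mk, smul_eq_mul]
    rw [Finset.sum_coe_sort P fun p => c p * ((z : ℂ) - p)⁻¹]
  rw [map_sub, hΛg, zero_sub, neg_eq_zero, map_sum] at h2
  have hcz : ∀ p : P, c p = 0 := by
    intro p
    have h3 := congrFun h2 p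
    simp only [map_smul, Finset.sum_apply, Pi.smul_apply, Pi.zero_apply] at h3
    rw [Finset.sum_eq_single p] at h3
    · rw [B p (e p) fun z => rfl, Pi.single_eq_same, smul_eq_mul] at h3
      simpa [Real.pi_ne_zero] using h3
    · intro b _ hb
      rw [B b (e b) fun z => rfl, Pi.single_eq_of_ne hb.symm, smul_zero]
    · simp
  refine ⟨G, fun z hz => ?_⟩
  have h4 := hG z hz
  rwa [Finset.sum_eq_zero fun p hp => by rw [hcz ⟨p, hp⟩, zero_mul], sub_zero] at h4

/-! ### Increments of primitives along a path -/

/-- The difference of the values of a primitive at the end points of a segment. -/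
theorem exists_segment_functional {L : Set ℂ} [CompactSpace L] {a b : ℂ} (hab : segment ℝ a b ⊆ L) :
    ∃ l : C(L, ℂ) →L[ℂ] ℂ, ∀ (g : C(L, ℂ)) (H : ℂ → ℂ), (∀ z : L, HasDerivAt H (g z) z) →
      l g = H b - H a := by
  have hmem : ∀ t : unitInterval, a + (t : ℝ) * (b - a) ∈ L := fun t => by
    refine hab ?_
    rw [segment_eq_image']
    exact ⟨t, t.2, by simp⟩
  set γ : unitInterval → L := fun t => ⟨_, hmem t⟩ with hγ
  have hγc : Continuous γ := by
    rw [hγ]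
    fun_prop
  refine ⟨integralCLM (Measure.map γ volume) (ContinuousMap.const L (b - a)), fun g H hH => ?_⟩
  rw [integralCLM_apply, integral_map hγc.aemeasurable
    (by exact (g.continuous.mul continuous_const).aestronglyMeasurable)]
  have hd : ∀ t : unitInterval, HasDerivAt (fun s : ℝ => H (a + s * (b - a))) (g (γ t) * (b - a)) t := by
    intro t
    have h1 : HasDerivAt (fun s : ℝ => a + s * (b - a)) (b - a) (t : ℝ) := by
      simpa using ((hasDerivAt_id (t : ℝ)).ofReal_comp.mul_const (b - a)).const_add a
    have h2 := (hH (γ t)).scomp (t : ℝ) h1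
    rwa [smul_eq_mul, mul_comm] at h2
  set F : ℝ → ℂ := fun s => g (γ (Set.projIcc 0 1 zero_le_one s)) * (b - a) with hF
  have hFc : Continuous F := by
    rw [hF]
    fun_prop
  have h3 : ∫ t : unitInterval, g (γ t) * (ContinuousMap.const L (b - a)) (γ t) = ∫ s in (0:ℝ)..1, F s := by
    rw [intervalIntegral.integral_of_le zero_le_one, ← integral_Icc_eq_integral_Ioc,
      ← integral_subtype_comap measurableSet_Icc]
    refine integral_congr_ae (Eventually.of_forall fun t => ?_)
    simp [hF]
  rw [h3, intervalIntegral.integral_eq_sub_of_hasDerivAt (f := fun s : ℝ => H (a + s * (b - a)))]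
  · simp
  · intro s hs
    rw [uIcc_of_le zero_le_one] at hs
    have := hd ⟨s, hs⟩
    simp only [hF]
    rwa [Set.projIcc_of_mem _ hs]
  · exact hFc.intervalIntegrable _ _

/-- Let `m` run over the perpendicular bisector of `a` and `b`. Each point of `P` lies on either leg
for at most one position of `m`, so all but finitely many positions work. -/
theorem exists_bent_path (P : Finset ℂ) {a b : ℂ} (ha : a ∉ P) (hb : b ∉ P) (hab : a ≠ b) :
    ∃ m, ∀ z ∈ segment ℝ a m ∪ segment ℝ m b, z ∉ P := by
  classical
  set B : Finset ℝ := P.image (fun p => ((p - a) / (b - a)).im / (2 * ((p - a) / (b - a)).re)) ∪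
    P.image (fun p => -(((p - b) / (a - b)).im / (2 * ((p - b) / (a - b)).re))) with hB
  obtain ⟨s, hs⟩ := Infinite.exists_notMem_finset B
  rw [hB, Finset.mem_union, not_or] at hs
  have hba : b - a ≠ 0 := sub_ne_zero.2 hab.symm
  have hab' : a - b ≠ 0 := sub_ne_zero.2 hab
  refine ⟨(a + b) / 2 + s * I * (b - a), fun z hz hzP => ?_⟩
  rcases hz with hz | hz
  · rw [segment_eq_image'] at hz
    obtain ⟨t, -, ht⟩ := hz
    simp only [real_smul] at ht
    refine hs.1 (Finset.mem_image.2 ⟨z, hzP, ?_⟩)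
    have ht0 : t ≠ 0 := by
      rintro rfl
      simp at ht
      exact ha (ht ▸ hzP)
    have e : (z - a) / (b - a) = ((t / 2 : ℝ) : ℂ) + ((t * s : ℝ) : ℂ) * I := by
      rw [← ht, div_eq_iff hba]
      push_cast
      ring
    rw [e]
    simp
    field_simp
  · rw [segment_symm, segment_eq_image'] at hz
    obtain ⟨t, -, ht⟩ := hz
    simp only [real_smul] at ht
    refine hs.2 (Finset.mem_image.2 ⟨z, hzP, ?_⟩)
    have ht0 : t ≠ 0 := by
      rintro rfl
      simp at ht
      exact hb (ht ▸ hzP)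
    have e : (z - b) / (a - b) = ((t / 2 : ℝ) : ℂ) + ((-(t * s) : ℝ) : ℂ) * I := by
      rw [← ht, div_eq_iff hab']
      push_cast
      ring
    rw [e]
    simp
    field_simp

/-- The increment of a primitive becomes a continuous linear function of the derivative on a fixed
compact set, hence depends holomorphically on parameters. -/
theorem exists_path_functional (P : Finset ℂ) {a b : ℂ} (ha : a ∉ P) (hb : b ∉ P) (hab : a ≠ b) :
    ∃ Γ : Set ℂ, Γ ⊆ (P : Set ℂ)ᶜ ∧ ∃ _ : CompactSpace Γ, ∃ l : C(Γ, ℂ) →L[ℂ] ℂ,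
      ∀ (g : C(Γ, ℂ)) (H : ℂ → ℂ), (∀ z : Γ, HasDerivAt H (g z) z) → l g = H b - H a := by
  obtain ⟨m, hm⟩ := exists_bent_path P ha hb hab
  have hc : CompactSpace (segment ℝ a m ∪ segment ℝ m b : Set ℂ) := by
    rw [← isCompact_iff_compactSpace]
    have hseg : ∀ x y : ℂ, IsCompact (segment ℝ x y) := fun x y => by
      rw [segment_eq_image']
      exact isCompact_Icc.image (by fun_prop)
    exact (hseg _ _).union (hseg _ _)
  obtain ⟨l₁, h₁⟩ := exists_segment_functional (L := segment ℝ a m ∪ segment ℝ m b)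
    (a := a) (b := m) subset_union_left
  obtain ⟨l₂, h₂⟩ := exists_segment_functional (L := segment ℝ a m ∪ segment ℝ m b)
    (a := m) (b := b) subset_union_right
  refine ⟨_, hm, hc, l₁ + l₂, fun g H hH => ?_⟩
  rw [add_apply, h₁ g H hH, h₂ g H hH]
  ring

/-- A quantitative form of Liouville's theorem. -/
theorem exists_norm_sub_lt_of_norm_deriv {E : ℂ → ℂ} {R ε : ℝ} (hR : 0 < R) (hε : 0 < ε)
    (hE : DifferentiableOn ℂ E (ball 0 R)) (hE0 : 1 / 2 ≤ ‖deriv E 0‖) {D : ℂ}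
    (hRD : 4 * ‖E 0 - D‖ ^ 2 < ε * R) : ∃ s ∈ ball (0 : ℂ) R, ‖E s - D‖ < ε := by
  by_contra! hcon
  have hne : ∀ s ∈ ball (0 : ℂ) R, E s - D ≠ 0 := fun s hs h => by
    have := hcon s hs
    rw [h, norm_zero] at this
    linarith
  set g : ℂ → ℂ := fun s => (E s - D)⁻¹ with hg
  have hgd : DifferentiableOn ℂ g (ball 0 R) := (hE.sub_const D).inv hne
  have h0 : (0 : ℂ) ∈ ball (0 : ℂ) R := mem_ball_self hR
  have hE0d : HasDerivAt E (deriv E 0) 0 := (hE.differentiableAt (isOpen_ball.mem_nhds h0)).hasDerivAt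
  have hder : deriv g 0 = -deriv E 0 / (E 0 - D) ^ 2 := by
    exact ((hE0d.sub_const D).inv (hne 0 h0)).deriv
  have hsub : closedBall (0 : ℂ) (R / 2) ⊆ ball 0 R := closedBall_subset_ball (half_lt_self hR)
  -- Cauchy's estimate on radius `R / 2` bounds `‖deriv g 0‖` by `2 / (ε * R)`. It is also at least
  -- `1 / (2 * ‖E 0 - D‖ ^ 2)`, which contradicts `hRD`.
  have hb := Complex.norm_deriv_le_of_forall_mem_sphere_norm_le (c := 0) (R := R / 2) (C := 1 / ε)
    (f := g) (by positivity)
    ((hgd.mono hsub).diffContOnCl_ball subset_rfl) (fun z hz => by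
      have h1 := hcon z (hsub (sphere_subset_closedBall hz))
      rw [hg, norm_inv, ← one_div]
      exact one_div_le_one_div_of_le hε h1)
  rw [hder, norm_div, norm_neg, norm_pow] at hb
  have hpos : 0 < ‖E 0 - D‖ ^ 2 := by
    have := norm_pos_iff.2 (hne 0 h0)
    positivity
  rw [div_le_iff₀ hpos, div_div, div_mul_eq_mul_div, le_div_iff₀ (by positivity)] at hb
  nlinarith

/-! ### Zero-free approximation of a derivative by derivatives -/

theorem ContinuousMap.exp_apply_eq {L : Set ℂ} [CompactSpace L] (g : C(L, ℂ)) (z : L) :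
    (NormedSpace.exp g) z = exp (g z) := by
  have h := NormedSpace.map_exp (ContinuousMap.evalAlgHom ℂ ℂ z) (continuous_eval_const z) g
  simpa only [ContinuousMap.evalAlgHom_apply, exp_eq_exp_ℂ] using h

/-- The linear combinations of a finite family. -/
noncomputable def combine {ι X : Type*} [Fintype ι] [NormedAddCommGroup X] [NormedSpace ℂ X]
    (w : ι → X) : (ι → ℂ) →L[ℂ] X :=
  ∑ i, (ContinuousLinearMap.proj (R := ℂ) (φ := fun _ : ι => ℂ) i).smulRight (w i)

theorem combine_apply {ι X : Type*} [Fintype ι] [NormedAddCommGroup X] [NormedSpace ℂ X]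
    (w : ι → X) (t : ι → ℂ) : combine w t = ∑ i, t i • w i := by
  simp [combine]

theorem continuous_combine {ι X : Type*} [Fintype ι] [NormedAddCommGroup X] [NormedSpace ℂ X] :
    Continuous fun w : ι → X => combine w := by
  refine continuous_finsetSum _ fun i _ => ?_
  exact ((ContinuousLinearMap.smulRightL ℂ (ι → ℂ) X
    (ContinuousLinearMap.proj (R := ℂ) (φ := fun _ : ι => ℂ) i)).continuous).comp (continuous_apply i)

theorem isInvertible_comp_combine {ι X : Type*} [Fintype ι] [DecidableEq ι] [NormedCommRing X]
    [NormedAlgebra ℂ X] (b : X) (Λ : X →L[ℂ] (ι → ℂ)) (w : ι → X)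
    (h : ∀ i, Λ (b * w i) = Pi.single i (-(Real.pi : ℂ))) :
    (Λ ∘L (ContinuousLinearMap.mul ℂ X b) ∘L combine w).IsInvertible := by
  have hpi : (-(Real.pi : ℂ)) ≠ 0 := by simp [Real.pi_ne_zero]
  refine ⟨ContinuousLinearEquiv.smulLeft (Units.mk0 _ hpi), ?_⟩
  ext t i
  simp only [ContinuousLinearMap.comp_apply, combine_apply, map_sum, map_smul,
    ContinuousLinearMap.mul_apply', h]
  simp [Finset.sum_apply, Pi.single_apply, mul_comm]

/-- Invertibility is an open condition, so the ideal correctors `1 / (f' (z - p))` may be replaced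
by approximations that are holomorphic off `P`. -/
theorem eventually_isInvertible {ι X : Type*} [Fintype ι] [NormedCommRing X]
    [NormedAlgebra ℂ X] (b : X) (Λ : X →L[ℂ] (ι → ℂ)) (w : ι → X)
    (h : (Λ ∘L (ContinuousLinearMap.mul ℂ X b) ∘L combine w).IsInvertible) :
    ∀ᶠ v in 𝓝 w, (Λ ∘L (ContinuousLinearMap.mul ℂ X b) ∘L combine v).IsInvertible := by
  have hc : Continuous fun v : ι → X => Λ ∘L (ContinuousLinearMap.mul ℂ X b) ∘L combine v :=
    continuous_const.clm_comp (continuous_const.clm_comp continuous_combine)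
  have ho : IsOpen {T : (ι → ℂ) →L[ℂ] (ι → ℂ) | T.IsInvertible} := by
    exact ContinuousLinearEquiv.isOpen
  exact hc.continuousAt.eventually (ho.mem_nhds h)

section
variable {P : Finset ℂ} {L N U : Set ℂ} [CompactSpace L] {Λ : C(L, ℂ) →L[ℂ] (P → ℂ)}

/-- A zero-free approximant `Q` of `f'` may have small non-zero periods. On `L` it equals `f' * exp
u` with `u` small, and the factor `exp (∑ τ u p * W p)` cancels the periods. That factor is
holomorphic and zero-free off `P`, so the product has a primitive there. -/
theorem IsPeriodFunctional.exists_exact_approx (hΛ : IsPeriodFunctional P L Λ)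
    (hL : IsCompact L) (hN : IsCompact N)
    (hLN : L ⊆ N) (hNU : N ⊆ U) (hU : IsOpen U) (hPU : ∀ p ∈ P, p ∉ U)
    (hsep : Separates P L N) {f : ℂ → ℂ} (hf : DifferentiableOn ℂ f U)
    (hf0 : ∀ z ∈ U, deriv f z ≠ 0) {ε : ℝ} (hε : 0 < ε) :
    ∃ H q : ℂ → ℂ, DifferentiableOn ℂ q (P : Set ℂ)ᶜ ∧ (∀ z ∉ P, q z ≠ 0) ∧
      (∀ z ∉ P, HasDerivAt H (q z) z) ∧ ∀ z ∈ L, ‖q z - deriv f z‖ < ε := by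
  classical
  have hLU := hLN.trans hNU
  have hPL : (P : Set ℂ) ⊆ Lᶜ := fun p hp h => hPU p hp (hLU h)
  have hf' : DifferentiableOn ℂ (deriv f) U := hf.deriv hU
  set b : C(L, ℂ) := ⟨fun z => deriv f z, (hf'.continuousOn.mono hLU).domRestrict⟩ with hb
  have hb0 : Λ b = 0 := hΛ.eq_zero_of_deriv f U hU hLU hf b fun z => rfl
  have hbne : ∀ z : L, b z ≠ 0 := fun z => hf0 z (hLU z.2)
  obtain ⟨β, hβ⟩ := isUnit_of_forall_ne_zero hbne
  have hne : ∀ p ∈ P, ∀ z ∈ U, z - p ≠ 0 := fun p hp z hz h =>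
    hPU p hp (by rw [← sub_eq_zero.1 h]; exact hz)
  have hWd : ∀ p ∈ P, DifferentiableOn ℂ (fun z => (deriv f z * (z - p))⁻¹) U := fun p hp =>
    (hf'.mul (by fun_prop)).inv fun z hz => mul_ne_zero (hf0 z hz) (hne p hp z hz)
  set w₀ : P → C(L, ℂ) := fun p =>
    ⟨fun z => (deriv f z * (z - p))⁻¹, ((hWd p p.2).continuousOn.mono hLU).domRestrict⟩ with hw₀
  have hinv := isInvertible_comp_combine b Λ w₀ fun p => hΛ.apply_inv p _ fun z => by
    have h1 := hf0 z (hLU z.2)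
    have h2 := hne p p.2 z (hLU z.2)
    change deriv f z * (deriv f z * ((z : ℂ) - p))⁻¹ = ((z : ℂ) - p)⁻¹
    field_simp
  obtain ⟨δ, hδ, hδinv⟩ := Metric.eventually_nhds_iff.1 (eventually_isInvertible b Λ w₀ hinv)
  choose W hWh hW using fun p : P =>
    hsep.exists_holomorphic_approx hL hPL hN hLN hU hNU (hWd p p.2) (half_pos hδ)
  have hLP : L ⊆ (P : Set ℂ)ᶜ := fun z hz hzP => hPL hzP hz
  set w : P → C(L, ℂ) := fun p => ⟨fun z => W p z, ((hWh p).continuousOn.mono hLP).domRestrict⟩ with hw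
  have hwi : (Λ ∘L (ContinuousLinearMap.mul ℂ C(L, ℂ) b) ∘L combine w).IsInvertible := by
    refine hδinv (lt_of_le_of_lt ((dist_pi_le_iff (half_pos hδ).le).2 fun p => ?_) (half_lt_self hδ))
    refine (ContinuousMap.dist_le (half_pos hδ).le).2 fun z => ?_
    rw [dist_eq_norm]
    exact (hW p z z.2).le
  obtain ⟨τ, hτ0, hτc, hτ, -⟩ := exists_implicit_exp b Λ (combine w) hb0 hwi
  have hcont : Tendsto (fun u => b * NormedSpace.exp (u + combine w (τ u))) (𝓝 0) (𝓝 b) := by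
    have h1 : ContinuousAt (fun u => b * NormedSpace.exp (u + combine w (τ u))) 0 :=
      continuousAt_const.mul (NormedSpace.exp_continuous.continuousAt.comp
        (continuousAt_id.add ((combine w).continuous.continuousAt.comp hτc.continuousAt)))
    have h2 := h1.tendsto
    simpa [hτ0] using h2
  have hgood : {u | Λ (b * NormedSpace.exp (u + combine w (τ u))) = 0 ∧
      dist (b * NormedSpace.exp (u + combine w (τ u))) b < ε} ∈ 𝓝 (0 : C(L, ℂ)) :=
    hτ.and (hcont (ball_mem_nhds b hε))
  -- The image under `exp` of the good set of `u` is a neighbourhood of `1`, so every `Q` close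
  -- enough to `f'` on `L` equals `b * exp u` with a good `u`.
  have hexp := (hasStrictFDerivAt_exp_zero (𝕂 := ℂ) (𝔸 := C(L, ℂ))).map_nhds_eq_of_surj
    (LinearMap.range_eq_top.2 fun x => ⟨x, rfl⟩)
  rw [NormedSpace.exp_zero] at hexp
  have himg := image_mem_map (m := (NormedSpace.exp : C(L, ℂ) → C(L, ℂ))) hgood
  rw [hexp] at himg
  have hdiv : Tendsto (fun g : C(L, ℂ) => ((β⁻¹ : C(L, ℂ)ˣ) : C(L, ℂ)) * g) (𝓝 b) (𝓝 1) := by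
    have h1 : Continuous fun g : C(L, ℂ) => ((β⁻¹ : C(L, ℂ)ˣ) : C(L, ℂ)) * g :=
      continuous_const.mul continuous_id
    have h2 := h1.tendsto b
    have h3 : ((β⁻¹ : C(L, ℂ)ˣ) : C(L, ℂ)) * b = 1 := by rw [← hβ, Units.inv_mul]
    rwa [h3] at h2
  obtain ⟨η, hη, hηs⟩ := Metric.mem_nhds_iff.1 (hdiv himg)
  obtain ⟨Q, hQ, hQ0, hQf⟩ := hsep.exists_nonvanishing_approx hL hPL hN hLN hU hNU hf'
    (fun z hz => hf0 z (hNU hz)) (half_pos hη)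
  set Qr : C(L, ℂ) := ⟨fun z => Q z, (hQ.continuousOn.mono hLP).domRestrict⟩ with hQr
  have hQball : Qr ∈ ball b η := by
    refine lt_of_le_of_lt ((ContinuousMap.dist_le (half_pos hη).le).2 fun z => ?_) (half_lt_self hη)
    rw [dist_eq_norm]
    exact (hQf z z.2).le
  obtain ⟨u, ⟨hu1, hu2⟩, huQ⟩ := hηs hQball
  have hbu : b * NormedSpace.exp u = Qr := by
    rw [huQ, ← hβ, Units.mul_inv_cancel_left]
  set q : ℂ → ℂ := fun z => Q z * exp (∑ p : P, τ u p * W p z) with hq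
  have hqr : ∀ z : L, (b * NormedSpace.exp (u + combine w (τ u))) z = q z := by
    intro z
    have h1 := congrArg (fun g : C(L, ℂ) => g z) hbu
    simp only [ContinuousMap.mul_apply, ContinuousMap.exp_apply_eq] at h1
    rw [ContinuousMap.mul_apply, ContinuousMap.exp_apply_eq, ContinuousMap.add_apply, exp_add,
      ← mul_assoc, h1, combine_apply, ContinuousMap.sum_apply]
    rfl
  have hqd : DifferentiableOn ℂ q (P : Set ℂ)ᶜ := by
    refine hQ.mul (DifferentiableOn.cexp ?_)
    exact DifferentiableOn.fun_sum fun p _ => (hWh p).const_mul _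
  obtain ⟨H, hH⟩ := hΛ.exists_primitive q hqd _ hqr hu1
  refine ⟨H, q, hqd, fun z hz => mul_ne_zero (hQ0 z hz) (exp_ne_zero _), hH, fun z hz => ?_⟩
  have h1 := (ContinuousMap.dist_apply_le_dist (⟨z, hz⟩ : L)).trans_lt hu2
  rw [hqr ⟨z, hz⟩, dist_eq_norm] at h1
  exact h1

end

theorem Separates.mono {P L M L' M' : Set ℂ} (h : Separates P M M') (hL : L ⊆ M) (hM : M' ⊆ L') :
    Separates P L L' := fun ζ hζ => by
  obtain ⟨C, h1, h2, h3⟩ := h ζ fun hh => hζ (hM hh)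
  exact ⟨C, h1, h2.trans (compl_subset_compl.2 hL), h3⟩

/-! ### Adjusting the increment between the two parts -/

/-- A holomorphic function on a neighbourhood of `M` separating the two parts of `M`,
with small derivative on `L`. -/
theorem Separates.exists_norm_deriv_lt {P L M N U₁ U₂ : Set ℂ} (hsep : Separates P M N)
    (hL : IsCompact L) (hM : IsCompact M) (hN : IsCompact N) (hLM : L ⊆ interior M) (hMN : M ⊆ N)
    (hPM : P ⊆ Mᶜ) (h₁ : IsOpen U₁) (h₂ : IsOpen U₂) (hd : Disjoint U₁ U₂) (hNU : N ⊆ U₁ ∪ U₂)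
    {z₁ z₂ : ℂ} (hz₁ : z₁ ∈ U₁ ∩ M) (hz₂ : z₂ ∈ U₂ ∩ M) {ε : ℝ} (hε : 0 < ε) :
    ∃ φ : ℂ → ℂ, DifferentiableOn ℂ φ Pᶜ ∧ (∀ z ∈ L, ‖deriv φ z‖ ≤ ε) ∧
      1 / 2 ≤ ‖φ z₂ - φ z₁‖ := by
  classical
  obtain ⟨r, hr, hrM⟩ := hL.exists_cthickening_subset_open isOpen_interior hLM
  set g : ℂ → ℂ := U₂.indicator 1 with hg
  have hg2 : ∀ z ∈ U₂, g =ᶠ[𝓝 z] fun _ => 1 := fun z hz => by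
    filter_upwards [h₂.mem_nhds hz] with w hw
    simp [hg, hw]
  have hg1 : ∀ z ∈ U₁, g =ᶠ[𝓝 z] fun _ => 0 := fun z hz => by
    filter_upwards [h₁.mem_nhds hz] with w hw
    simp [hg, hd.notMem_of_mem_left hw]
  have hgd : ∀ z ∈ U₁ ∪ U₂, HasDerivAt g 0 z := by
    rintro z (hz | hz)
    · exact (hasDerivAt_const z (0 : ℂ)).congr_of_eventuallyEq (hg1 z hz)
    · exact (hasDerivAt_const z (1 : ℂ)).congr_of_eventuallyEq (hg2 z hz)
  -- The function to approximate is locally constant, `0` on `U₁` and `1` on `U₂`. An error of `ε *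
  -- r` on discs of radius `r` gives derivative at most `ε`, and `1 / 4` at each of two points costs
  -- at most half of the jump `1`.
  have hδ : 0 < min (ε * r) (1 / 4) := lt_min (by positivity) (by norm_num)
  obtain ⟨φ, hφ, hφg⟩ := hsep.exists_holomorphic_approx hM hPM hN hMN (h₁.union h₂) hNU
    (fun z hz => (hgd z hz).differentiableAt.differentiableWithinAt) hδ
  have hMP : M ⊆ Pᶜ := subset_compl_comm.1 hPM
  have hφM : ∀ z ∈ interior M, DifferentiableAt ℂ φ z := fun z hz =>
    hφ.differentiableAt (mem_of_superset (mem_interior_iff_mem_nhds.1 hz) hMP)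
  refine ⟨φ, hφ, fun z hz => ?_, ?_⟩
  · have hball : closedBall z r ⊆ interior M :=
      (closedBall_subset_cthickening hz r).trans hrM
    have hdiff : DiffContOnCl ℂ (fun w => φ w - g w) (ball z r) := by
      refine DifferentiableOn.diffContOnCl fun w hw => ?_
      have hw' := hball (closure_ball_subset_closedBall hw)
      exact ((hφM w hw').sub (hgd w (hNU (hMN (interior_subset hw')))).differentiableAt).differentiableWithinAt
    have h1 := norm_deriv_le_of_forall_mem_sphere_norm_le hr hdiff (C := ε * r) fun w hw =>
      ((hφg w (interior_subset (hball (sphere_subset_closedBall hw)))).trans_le (min_le_left _ _)).le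
    have hzM := hLM hz
    have h2 : HasDerivAt (fun w => φ w - g w) (deriv φ z - 0) z :=
      (hφM z hzM).hasDerivAt.sub (hgd z (hNU (hMN (interior_subset hzM))))
    rw [h2.deriv, sub_zero, mul_div_cancel_right₀ _ hr.ne'] at h1
    exact h1
  · have e1 := (hφg z₁ hz₁.2).trans_le (min_le_right _ _)
    have e2 := (hφg z₂ hz₂.2).trans_le (min_le_right _ _)
    rw [(hg1 z₁ hz₁.1).self_of_nhds] at e1
    rw [(hg2 z₂ hz₂.1).self_of_nhds] at e2
    have h3 : (1 : ℂ) = (φ z₂ - φ z₁) - (φ z₂ - 1) + (φ z₁ - 0) := by ring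
    have h4 : (1 : ℝ) ≤ ‖φ z₂ - φ z₁‖ + ‖φ z₂ - 1‖ + ‖φ z₁ - 0‖ := by
      calc (1 : ℝ) = ‖(1 : ℂ)‖ := by simp
        _ ≤ _ := by
          conv_lhs => rw [h3]
          exact (norm_add_le _ _).trans (add_le_add_left (norm_sub_le _ _) _)
    linarith

section
variable {P : Finset ℂ} {L : Set ℂ} [CompactSpace L] {Λ : C(L, ℂ) →L[ℂ] (P → ℂ)}

/-- An exact nowhere vanishing differential can be perturbed so as to change the difference of
the values of its primitive at two points to a prescribed value. -/
theorem IsPeriodFunctional.exists_prescribed_difference (hΛ : IsPeriodFunctional P L Λ)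
    (hPL : (P : Set ℂ) ⊆ Lᶜ) {z₁ z₂ : ℂ} (hz₁ : z₁ ∉ P) (hz₂ : z₂ ∉ P) (hz : z₁ ≠ z₂)
    (hsmall : ∀ ε : ℝ, 0 < ε → ∃ φ : ℂ → ℂ, DifferentiableOn ℂ φ (P : Set ℂ)ᶜ ∧
      (∀ z ∈ L, ‖deriv φ z‖ ≤ ε) ∧ 1 / 2 ≤ ‖φ z₂ - φ z₁‖)
    {H₀ q₀ : ℂ → ℂ} (hq : DifferentiableOn ℂ q₀ (P : Set ℂ)ᶜ) (hq0 : ∀ z ∉ P, q₀ z ≠ 0)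
    (hH : ∀ z ∉ P, HasDerivAt H₀ (q₀ z) z) (D : ℂ) {ε : ℝ} (hε : 0 < ε) :
    ∃ H q : ℂ → ℂ, DifferentiableOn ℂ q (P : Set ℂ)ᶜ ∧ (∀ z ∉ P, q z ≠ 0) ∧
      (∀ z ∉ P, HasDerivAt H (q z) z) ∧ (∀ z ∈ L, ‖q z - q₀ z‖ < ε) ∧
      ‖H z₂ - H z₁ - D‖ < ε := by
  classical
  have hLP : L ⊆ (P : Set ℂ)ᶜ := subset_compl_comm.1 hPL
  have hPo : IsOpen (P : Set ℂ)ᶜ := P.finite_toSet.isClosed.isOpen_compl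
  have hne : ∀ p ∈ P, ∀ z ∉ P, z - p ≠ 0 := fun p hp z hz h => hz (by rwa [sub_eq_zero.1 h])
  obtain ⟨Γ, hΓP, hΓc, l, hl⟩ := exists_path_functional P hz₁ hz₂ hz
  set W : P → ℂ → ℂ := fun p z => (q₀ z * (z - p))⁻¹ with hW
  have hWd : ∀ p, DifferentiableOn ℂ (W p) (P : Set ℂ)ᶜ := fun p =>
    (hq.mul (by fun_prop)).inv fun z hz => mul_ne_zero (hq0 z hz) (hne p p.2 z hz)
  -- the data on `L` and on `Γ`
  set b : C(L, ℂ) := ⟨fun z => q₀ z, (hq.continuousOn.mono hLP).domRestrict⟩ with hb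
  set w : P → C(L, ℂ) := fun p => ⟨fun z => W p z, ((hWd p).continuousOn.mono hLP).domRestrict⟩ with hw
  set bΓ : C(Γ, ℂ) := ⟨fun z => q₀ z, (hq.continuousOn.mono hΓP).domRestrict⟩ with hbΓ
  set wΓ : P → C(Γ, ℂ) := fun p => ⟨fun z => W p z, ((hWd p).continuousOn.mono hΓP).domRestrict⟩
    with hwΓ
  have hqi : DifferentiableOn ℂ (fun z => (q₀ z)⁻¹) (P : Set ℂ)ᶜ := hq.inv hq0
  set c : C(L, ℂ) := ⟨fun z => (q₀ z)⁻¹, (hqi.continuousOn.mono hLP).domRestrict⟩ with hc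
  have hb0 : Λ b = 0 := hΛ.eq_zero_of_deriv H₀ _ hPo hLP
    (fun z hz => (hH z hz).differentiableAt.differentiableWithinAt) b
    fun z => ((hH z (hLP z.2)).deriv).symm
  have hinv := isInvertible_comp_combine b Λ w fun p => hΛ.apply_inv p _ fun z => by
    have h1 := hq0 z (hLP z.2)
    have h2 := hne p p.2 z (hLP z.2)
    change q₀ z * (q₀ z * ((z : ℂ) - p))⁻¹ = ((z : ℂ) - p)⁻¹
    field_simp
  obtain ⟨τ, hτ0, hτc, hτ, hτd⟩ := exists_implicit_exp b Λ (combine w) hb0 hinv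
  have hcont : Tendsto (fun u => b * NormedSpace.exp (u + combine w (τ u))) (𝓝 0) (𝓝 b) := by
    have h1 : ContinuousAt (fun u => b * NormedSpace.exp (u + combine w (τ u))) 0 :=
      continuousAt_const.mul (NormedSpace.exp_continuous.continuousAt.comp
        (continuousAt_id.add ((combine w).continuous.continuousAt.comp hτc.continuousAt)))
    have h2 := h1.tendsto
    simpa [hτ0] using h2
  have hdiff : ∀ᶠ u in 𝓝 (0 : C(L, ℂ)), DifferentiableAt ℂ τ u := by
    filter_upwards [hτc.eventually (by simp)] with u hu
    exact hu.differentiableAt one_ne_zero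
  obtain ⟨ρ, hρ, hgood⟩ := Metric.eventually_nhds_iff_ball.1
    (hτ.and ((hcont.eventually (ball_mem_nhds b hε)).and hdiff))
  -- The radius `ρ` of admissible perturbations is fixed first, and then `R` as the Liouville
  -- estimate demands. Only then is `φ` chosen, with `deriv φ` so small on `L` that `s • v` stays in
  -- the `ρ`-ball for all `‖s‖ < R`.
  obtain ⟨R, hR⟩ := exists_gt (max 0 (4 * ‖H₀ z₂ - H₀ z₁ - D‖ ^ 2 / ε))
  have hR0 : 0 < R := (le_max_left _ _).trans_lt hR
  have hRD : 4 * ‖H₀ z₂ - H₀ z₁ - D‖ ^ 2 < ε * R := by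
    have := (le_max_right _ _).trans_lt hR
    rwa [div_lt_iff₀ hε, mul_comm R] at this
  obtain ⟨φ, hφ, hφL, hφz⟩ := hsmall (ρ / (R * (‖c‖ + 1))) (by positivity)
  have hφ' : DifferentiableOn ℂ (deriv φ) (P : Set ℂ)ᶜ := hφ.deriv hPo
  set V : ℂ → ℂ := fun z => deriv φ z * (q₀ z)⁻¹ with hV
  have hVd : DifferentiableOn ℂ V (P : Set ℂ)ᶜ := hφ'.mul hqi
  set v : C(L, ℂ) := ⟨fun z => V z, (hVd.continuousOn.mono hLP).domRestrict⟩ with hv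
  set vΓ : C(Γ, ℂ) := ⟨fun z => V z, (hVd.continuousOn.mono hΓP).domRestrict⟩ with hvΓ
  have hvn : R * ‖v‖ < ρ := by
    have h1 : ‖v‖ ≤ ρ / (R * (‖c‖ + 1)) * ‖c‖ := by
      refine (ContinuousMap.norm_le _ (by positivity)).2 fun z => ?_
      change ‖deriv φ z * (q₀ z)⁻¹‖ ≤ _
      rw [norm_mul]
      exact mul_le_mul (hφL z z.2) (c.norm_coe_le_norm z) (norm_nonneg _) (by positivity)
    calc R * ‖v‖ ≤ R * (ρ / (R * (‖c‖ + 1)) * ‖c‖) := by gcongr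
      _ = ρ * (‖c‖ / (‖c‖ + 1)) := by field_simp
      _ < ρ * 1 := by
        gcongr
        rw [div_lt_one (by positivity)]
        linarith
      _ = ρ := mul_one _
  have hsv : ∀ s ∈ ball (0 : ℂ) R, s • v ∈ ball (0 : C(L, ℂ)) ρ := fun s hs => by
    rw [mem_ball_zero_iff] at hs ⊢
    rw [norm_smul]
    exact (mul_le_mul_of_nonneg_right hs.le (norm_nonneg _)).trans_lt hvn
  -- Since `q₀ * V = φ'` is exact, the correction `τ` has zero derivative in the direction `v`.
  have hbv : Λ (b * v) = 0 := hΛ.eq_zero_of_deriv φ _ hPo hLP hφ _ fun z => by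
    have := hq0 z (hLP z.2)
    change q₀ z * (deriv φ z * (q₀ z)⁻¹) = deriv φ z
    field_simp
  -- The parameters `τ (s • v)` are determined on `L` and reused on `Γ`, where `V` need not be
  -- small. `E s` is the increment from `z₁` to `z₂` of the primitive of the perturbed derivative.
  set A : ℂ → C(Γ, ℂ) := fun s => s • vΓ + combine wΓ (τ (s • v)) with hA
  set E : ℂ → ℂ := fun s => l (bΓ * NormedSpace.exp (A s)) with hE
  have hAd : ∀ s ∈ ball (0 : ℂ) R,
      HasDerivAt A (vΓ + combine wΓ (fderiv ℂ τ (s • v) v)) s := fun s hs => by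
    have h1 : HasDerivAt (fun s : ℂ => s • v) v s := by
      simpa using (hasDerivAt_id s).smul_const v
    have h2 : HasDerivAt (fun s : ℂ => s • vΓ) vΓ s := by
      simpa using (hasDerivAt_id s).smul_const vΓ
    have h3 := (hgood _ (hsv s hs)).2.2.hasFDerivAt.comp_hasDerivAt s h1
    exact h2.add ((combine wΓ).hasFDerivAt.comp_hasDerivAt s h3)
  have hexp : Differentiable ℂ (NormedSpace.exp : C(Γ, ℂ) → C(Γ, ℂ)) := fun x =>
    (NormedSpace.exp_analytic (𝕂 := ℂ) x).differentiableAt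
  have hEd : DifferentiableOn ℂ E (ball 0 R) := fun s hs => by
    have h1 := (hAd s hs).differentiableAt
    exact (l.differentiableAt.comp s
      ((differentiableAt_const _).mul ((hexp _).comp s h1))).differentiableWithinAt
  have hA0 : A 0 = 0 := by simp [hA, hτ0]
  have hE0 : E 0 = H₀ z₂ - H₀ z₁ := by
    have h1 : E 0 = l bΓ := by simp [hE, hA0]
    rw [h1]
    exact hl bΓ H₀ fun z => hH z (hΓP z.2)
  have hE0' : deriv E 0 = φ z₂ - φ z₁ := by
    have h1 := hAd 0 (mem_ball_self hR0)
    rw [zero_smul, hτd v hbv, map_zero, add_zero] at h1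
    have h2 : HasFDerivAt (NormedSpace.exp : C(Γ, ℂ) → C(Γ, ℂ)) (1 : C(Γ, ℂ) →L[ℂ] C(Γ, ℂ)) (A 0) := by
      rw [hA0]
      exact hasFDerivAt_exp_zero (𝕂 := ℂ)
    have h3 := (l ∘L ContinuousLinearMap.mul ℂ C(Γ, ℂ) bΓ).hasFDerivAt.comp_hasDerivAt 0
      (h2.comp_hasDerivAt 0 h1)
    have h4 : deriv E 0 = l (bΓ * vΓ) := h3.deriv
    rw [h4]
    refine hl _ φ fun z => ?_
    have h5 := hq0 z (hΓP z.2)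
    have h6 : (bΓ * vΓ) z = deriv φ z := by
      change q₀ z * (deriv φ z * (q₀ z)⁻¹) = deriv φ z
      field_simp
    rw [h6]
    exact (hφ.differentiableAt (hPo.mem_nhds (hΓP z.2))).hasDerivAt
  obtain ⟨s, hs, hsD⟩ := exists_norm_sub_lt_of_norm_deriv hR0 hε hEd (by rwa [hE0'])
    (D := D) (by rwa [hE0])
  obtain ⟨hg1, hg2, -⟩ := hgood _ (hsv s hs)
  set q : ℂ → ℂ := fun z => q₀ z * exp (s * V z + ∑ p : P, τ (s • v) p * W p z) with hqdef
  have hqd : DifferentiableOn ℂ q (P : Set ℂ)ᶜ := by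
    refine hq.mul (DifferentiableOn.cexp ((hVd.const_mul s).add ?_))
    exact DifferentiableOn.fun_sum fun p _ => (hWd p).const_mul _
  have hqr : ∀ z : L, (b * NormedSpace.exp (s • v + combine w (τ (s • v)))) z = q z := by
    intro z
    rw [ContinuousMap.mul_apply, ContinuousMap.exp_apply_eq, ContinuousMap.add_apply,
      combine_apply, ContinuousMap.sum_apply]
    rfl
  have hqΓ : ∀ z : Γ, (bΓ * NormedSpace.exp (A s)) z = q z := by
    intro z
    rw [ContinuousMap.mul_apply, ContinuousMap.exp_apply_eq, hA, ContinuousMap.add_apply,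
      combine_apply, ContinuousMap.sum_apply]
    rfl
  obtain ⟨H, hH'⟩ := hΛ.exists_primitive q hqd _ hqr hg1
  refine ⟨H, q, hqd, fun z hz => mul_ne_zero (hq0 z hz) (exp_ne_zero _), hH', fun z hz => ?_, ?_⟩
  · have h1 := (ContinuousMap.dist_apply_le_dist (⟨z, hz⟩ : L)).trans_lt hg2
    rw [hqr ⟨z, hz⟩, dist_eq_norm] at h1
    exact h1
  · have h1 : E s = H z₂ - H z₁ := hl _ H fun z => by
      rw [hqΓ z]
      exact hH' z (hΓP z.2)
    rwa [h1] at hsD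

/-- The exact approximant is perturbed until its increment from `z₁` to `z₂` is nearly that of `f`.
An additive constant then gives equality at `z₁`. -/
theorem IsPeriodFunctional.exists_locally_univalent_approx (hΛ : IsPeriodFunctional P L Λ)
    {M N U₁ U₂ : Set ℂ} (hL : IsCompact L) (hM : IsCompact M) (hN : IsCompact N)
    (hLM : L ⊆ interior M) (hMN : M ⊆ N)
    (h₁ : IsOpen U₁) (h₂ : IsOpen U₂) (hd : Disjoint U₁ U₂) (hNU : N ⊆ U₁ ∪ U₂)
    (hPU : ∀ p ∈ P, p ∉ U₁ ∪ U₂) (hsep : Separates P M N)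
    {z₁ z₂ : ℂ} (hz₁ : z₁ ∈ U₁ ∩ L) (hz₂ : z₂ ∈ U₂ ∩ L) {f : ℂ → ℂ}
    (hf : DifferentiableOn ℂ f (U₁ ∪ U₂)) (hf0 : ∀ z ∈ U₁ ∪ U₂, deriv f z ≠ 0)
    {ε : ℝ} (hε : 0 < ε) :
    ∃ h q : ℂ → ℂ, (∀ z ∉ P, HasDerivAt h (q z) z ∧ q z ≠ 0) ∧
      (∀ z ∈ L, ‖q z - deriv f z‖ < ε) ∧ h z₁ = f z₁ ∧ ‖h z₂ - f z₂‖ < ε := by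
  have hLM' := hLM.trans interior_subset
  have hPN : (P : Set ℂ) ⊆ Nᶜ := fun p hp h => hPU p hp (hNU h)
  have hLP : L ⊆ (P : Set ℂ)ᶜ := subset_compl_comm.1
    (hPN.trans (compl_subset_compl.2 (hLM'.trans hMN)))
  obtain ⟨H₀, q₀, hq, hq0, hH, hqf⟩ := hΛ.exists_exact_approx hL hN (hLM'.trans hMN) hNU
    (h₁.union h₂) hPU (hsep.mono hLM' subset_rfl) hf hf0 (half_pos hε)
  have hz : z₁ ≠ z₂ := fun h => hd.notMem_of_mem_left hz₁.1 (h ▸ hz₂.1)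
  obtain ⟨H, q, -, hq0', hH', hqq, hD⟩ := hΛ.exists_prescribed_difference
    (subset_compl_comm.1 hLP) (hLP hz₁.2) (hLP hz₂.2) hz
    (fun η hη => hsep.exists_norm_deriv_lt hL hM hN hLM hMN (hPN.trans (compl_subset_compl.2 hMN))
      h₁ h₂ hd hNU ⟨hz₁.1, hLM' hz₁.2⟩ ⟨hz₂.1, hLM' hz₂.2⟩ hη) hq hq0 hH (f z₂ - f z₁) (half_pos hε)
  refine ⟨fun z => H z + (f z₁ - H z₁), q, fun z hz => ⟨(hH' z hz).add_const _, hq0' z hz⟩,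
    fun z hz => ?_, by ring, ?_⟩
  · calc ‖q z - deriv f z‖ ≤ ‖q z - q₀ z‖ + ‖q₀ z - deriv f z‖ := norm_sub_le_norm_sub_add_norm_sub ..
      _ < ε / 2 + ε / 2 := add_lt_add (hqq z hz) (hqf z hz)
      _ = ε := add_halves ε
  · have : H z₂ + (f z₁ - H z₁) - f z₂ = H z₂ - H z₁ - (f z₂ - f z₁) := by ring
    rw [this]
    exact hD.trans (half_lt_self hε)

end

/-! ### Choice of finitely many poles and of cut-offs around them -/

theorem IsCompact.exists_pos_disjoint_cthickening {K A : Set ℂ} (hK : IsCompact K)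
    (hA : IsClosed A) (h : Disjoint K A) : ∃ δ > 0, A ⊆ (cthickening δ K)ᶜ := by
  obtain ⟨δ, hδ, hs⟩ := hK.exists_cthickening_subset_open hA.isOpen_compl
    h.subset_compl_right
  exact ⟨δ, hδ, subset_compl_comm.1 hs⟩

theorem isPreconnected_ray (p : ℂ) : IsPreconnected ((fun t : ℝ => (t : ℂ) * p) '' Ici 1) :=
  isPreconnected_Ici.image _ (by fun_prop)

theorem norm_le_of_mem_ray {p z : ℂ} (hz : z ∈ (fun t : ℝ => (t : ℂ) * p) '' Ici 1) :
    ‖p‖ ≤ ‖z‖ := by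
  obtain ⟨t, ht, rfl⟩ := hz
  have ht' : (1 : ℝ) ≤ t := ht
  simp only [norm_mul, norm_real, Real.norm_eq_abs]
  exact le_mul_of_one_le_left (norm_nonneg _) (ht'.trans (le_abs_self t))

theorem mem_ray_self (p : ℂ) : p ∈ (fun t : ℝ => (t : ℂ) * p) '' Ici 1 :=
  ⟨1, self_mem_Ici, by simp⟩

theorem not_isBounded_ray {p : ℂ} (hp : p ≠ 0) :
    ¬ Bornology.IsBounded ((fun t : ℝ => (t : ℂ) * p) '' Ici 1) := fun h => by
  obtain ⟨C, hC⟩ := h.exists_norm_le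
  have hp' : 0 < ‖p‖ := norm_pos_iff.2 hp
  have h1 := hC _ ⟨max 1 ((C + 1) / ‖p‖), mem_Ici.2 (le_max_left _ _), rfl⟩
  simp only [norm_mul, norm_real, Real.norm_eq_abs] at h1
  have h2 : (C + 1) / ‖p‖ * ‖p‖ ≤ C :=
    (mul_le_mul_of_nonneg_right ((le_max_right _ _).trans (le_abs_self _)) hp'.le).trans h1
  rw [div_mul_cancel₀ _ hp'.ne'] at h2
  linarith

/-- A path to `p` together with a closed disc about `ζ` keeps a positive distance from `K`. One `δ`
thus serves a whole neighbourhood of `ζ`, as a compactness argument requires. -/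
theorem IsCompact.exists_joining {K : Set ℂ} (hK : IsCompact K) {ζ p : ℂ} (hζ : ζ ∉ K)
    (hp : p ∈ connectedComponentIn Kᶜ ζ) :
    ∃ δ > 0, ∃ r > 0, ∃ A, IsPreconnected A ∧ ball ζ r ⊆ A ∧ p ∈ A ∧ A ⊆ (cthickening δ K)ᶜ := by
  have hKo : IsOpen Kᶜ := hK.isClosed.isOpen_compl
  have hζc := mem_connectedComponentIn (mem_compl hζ)
  have hpc : IsPathConnected (connectedComponentIn Kᶜ ζ) :=
    hKo.connectedComponentIn.isConnected_iff_isPathConnected.1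
      (isConnected_connectedComponentIn_iff.2 hζ)
  obtain ⟨γ, hγ⟩ := hpc.joinedIn ζ hζc p hp
  obtain ⟨r, hr, hrK⟩ := nhds_basis_closedBall.mem_iff.1 (hKo.mem_nhds hζ)
  have hγ0 : ζ ∈ range γ := ⟨0, γ.source⟩
  have hA : IsPreconnected (closedBall ζ r ∪ range γ) :=
    (convex_closedBall ζ r).isPreconnected.union ζ (mem_closedBall_self hr.le) hγ0
      (isPreconnected_range γ.continuous)
  have hAc : IsClosed (closedBall ζ r ∪ range γ) :=
    isClosed_closedBall.union (isCompact_range γ.continuous).isClosed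
  obtain ⟨δ, hδ, hs⟩ := hK.exists_pos_disjoint_cthickening hAc (by
    refine disjoint_right.2 ?_
    rintro z (hz | ⟨t, rfl⟩)
    · exact hrK hz
    · exact connectedComponentIn_subset _ _ (hγ t))
  exact ⟨δ, hδ, r, hr, _, hA, ball_subset_closedBall.trans subset_union_left,
    Or.inr ⟨1, γ.target⟩, hs⟩

/-- The complement of `K` may have infinitely many components, but finitely many neighbourhoods
cover the compact part of a large disc outside `interior N`, and each needs at most one pole. Points
far out escape to infinity along rays. -/
theorem exists_separating_finset {K U S : Set ℂ} (hK : IsCompact K) (hU : IsOpen U) (hKU : K ⊆ U)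
    (hcomp : ∀ ζ ∉ K, Bornology.IsBounded (connectedComponentIn Kᶜ ζ) →
      (S ∩ connectedComponentIn Kᶜ ζ).Nonempty) :
    ∃ (P : Finset ℂ) (δ : ℝ) (N : Set ℂ), 0 < δ ∧ (P : Set ℂ) ⊆ S ∧
      (∀ p ∈ P, Bornology.IsBounded (connectedComponentIn Kᶜ p)) ∧
      (∀ p ∈ P, ∀ q ∈ P, q ∈ connectedComponentIn Kᶜ p → p = q) ∧
      IsCompact N ∧ cthickening δ K ⊆ N ∧ N ⊆ U ∧ Separates P (cthickening δ K) N := by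
  classical
  obtain ⟨N, hN, hKN, hNU⟩ := exists_compact_between hK hU hKU
  obtain ⟨R, hR, hNR⟩ := hN.isBounded.subset_ball_lt 0 0
  -- The pole is a function of the component, so poles picked for different pieces of the cover
  -- coincide whenever they share a component. The value `0` is never used.
  set rep : Set ℂ → ℂ := fun C => if h : (S ∩ C).Nonempty then h.some else 0 with hrep
  have hrepC : ∀ C : Set ℂ, (S ∩ C).Nonempty → rep C ∈ S ∩ C := fun C h => by
    simp only [hrep, dif_pos h]
    exact h.some_mem
  set good : Set ℂ := {p | p ∉ K ∧ p ∈ S ∧ Bornology.IsBounded (connectedComponentIn Kᶜ p) ∧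
    rep (connectedComponentIn Kᶜ p) = p} with hgood
  have key : ∃ P : Finset ℂ, ∃ δ > 0, ↑P ⊆ good ∧ ∀ ζ ∈ closedBall 0 R \ interior N,
      ∃ A, IsPreconnected A ∧ A ⊆ (cthickening δ K)ᶜ ∧ ζ ∈ A ∧
        ((∃ p ∈ P, p ∈ A) ∨ ∃ p ∈ A, R ≤ ‖p‖) := by
    have hT : IsCompact (closedBall (0 : ℂ) R \ interior N) :=
      (isCompact_closedBall 0 R).diff isOpen_interior
    refine hT.induction_on (p := fun s => ∃ P : Finset ℂ, ∃ δ > 0, ↑P ⊆ good ∧ ∀ ζ ∈ s,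
      ∃ A, IsPreconnected A ∧ A ⊆ (cthickening δ K)ᶜ ∧ ζ ∈ A ∧
        ((∃ p ∈ P, p ∈ A) ∨ ∃ p ∈ A, R ≤ ‖p‖)) ⟨∅, 1, one_pos, by simp, by simp⟩ ?_ ?_ ?_
    · rintro s t hst ⟨P, δ, h1, h2, h3⟩
      exact ⟨P, δ, h1, h2, fun ζ hζ => h3 ζ (hst hζ)⟩
    · rintro s t ⟨P, δ, h1, h2, h3⟩ ⟨P', δ', h1', h2', h3'⟩
      refine ⟨P ∪ P', min δ δ', lt_min h1 h1', by simp [h2, h2'], ?_⟩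
      rintro ζ (hζ | hζ)
      · obtain ⟨A, a1, a2, a3, a4⟩ := h3 ζ hζ
        exact ⟨A, a1, a2.trans (compl_subset_compl.2 (cthickening_mono (min_le_left _ _) _)), a3,
          a4.imp_left fun ⟨p, hp, hpA⟩ => ⟨p, Finset.mem_union_left _ hp, hpA⟩⟩
      · obtain ⟨A, a1, a2, a3, a4⟩ := h3' ζ hζ
        exact ⟨A, a1, a2.trans (compl_subset_compl.2 (cthickening_mono (min_le_right _ _) _)), a3,
          a4.imp_left fun ⟨p, hp, hpA⟩ => ⟨p, Finset.mem_union_right _ hp, hpA⟩⟩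
    · rintro ζ ⟨-, hζN⟩
      have hζK : ζ ∉ K := fun h => hζN (hKN h)
      by_cases hb : Bornology.IsBounded (connectedComponentIn Kᶜ ζ)
      · have hr := hrepC _ (hcomp ζ hζK hb)
        obtain ⟨δ, hδ, r, hr0, A, a1, a2, a3, a4⟩ := hK.exists_joining hζK hr.2
        have he := connectedComponentIn_eq hr.2
        refine ⟨ball ζ r, mem_nhdsWithin_of_mem_nhds (ball_mem_nhds ζ hr0),
          {rep (connectedComponentIn Kᶜ ζ)}, δ, hδ, ?_, fun w hw => ⟨A, a1, a4, a2 hw, Or.inl ?_⟩⟩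
        · rw [Finset.coe_singleton, singleton_subset_iff]
          exact ⟨connectedComponentIn_subset _ _ hr.2, hr.1, by rwa [← he], by rw [← he]⟩
        · exact ⟨_, Finset.mem_singleton_self _, a3⟩
      · have : ∃ p ∈ connectedComponentIn Kᶜ ζ, R ≤ ‖p‖ := by
          by_contra! hcon
          exact hb (isBounded_ball.subset fun p hp => mem_ball_zero_iff.2 (hcon p hp))
        obtain ⟨p, hp, hpR⟩ := this
        obtain ⟨δ, hδ, r, hr0, A, a1, a2, a3, a4⟩ := hK.exists_joining hζK hp
        exact ⟨ball ζ r, mem_nhdsWithin_of_mem_nhds (ball_mem_nhds ζ hr0),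
          ∅, δ, hδ, by simp, fun w hw => ⟨A, a1, a4, a2 hw, Or.inr ⟨p, a3, hpR⟩⟩⟩
  obtain ⟨P, δ₁, hδ₁, hP, hsep⟩ := key
  obtain ⟨δ₂, hδ₂, hδN⟩ := hK.exists_cthickening_subset_open isOpen_interior hKN
  have hδ1 : cthickening (min δ₁ δ₂) K ⊆ cthickening δ₁ K := cthickening_mono (min_le_left _ _) _
  have hδ2 : cthickening (min δ₁ δ₂) K ⊆ N :=
    ((cthickening_mono (min_le_right _ _) _).trans hδN).trans interior_subset
  have hray : ∀ p : ℂ, R ≤ ‖p‖ →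
      (fun t : ℝ => (t : ℂ) * p) '' Ici 1 ⊆ (cthickening (min δ₁ δ₂) K)ᶜ := fun p hp z hz hz' =>
    (hp.trans (norm_le_of_mem_ray hz)).not_gt (mem_ball_zero_iff.1 (hNR (hδ2 hz')))
  have hne : ∀ p : ℂ, R ≤ ‖p‖ → p ≠ 0 := fun p hp h => by
    rw [h, norm_zero] at hp
    exact hp.not_gt hR
  refine ⟨P, min δ₁ δ₂, N, lt_min hδ₁ hδ₂, fun p hp => (hP hp).2.1, fun p hp => (hP hp).2.2.1,
    fun p hp q hq hpq => ?_, hN, hδ2, hNU, fun ζ hζ => ?_⟩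
  · rw [← (hP hp).2.2.2, ← (hP hq).2.2.2, connectedComponentIn_eq hpq]
  · by_cases hζR : R ≤ ‖ζ‖
    · exact ⟨_, isPreconnected_ray ζ, hray ζ hζR, mem_ray_self ζ, Or.inr (not_isBounded_ray (hne ζ hζR))⟩
    · obtain ⟨A, a1, a2, a3, a4⟩ := hsep ζ ⟨mem_closedBall_zero_iff.2 (not_le.1 hζR).le,
        fun h => hζ (interior_subset h)⟩
      have a2' := a2.trans (compl_subset_compl.2 hδ1)
      rcases a4 with ⟨p, hp, hpA⟩ | ⟨p, hpA, hpR⟩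
      · exact ⟨A, a1, a2', a3, Or.inl ⟨p, hp, hpA⟩⟩
      · exact ⟨A ∪ (fun t : ℝ => (t : ℂ) * p) '' Ici 1,
          a1.union p hpA (mem_ray_self p) (isPreconnected_ray p), union_subset a2' (hray p hpR),
          Or.inl a3, Or.inr fun h => not_isBounded_ray (hne p hpR) (h.subset subset_union_right)⟩

theorem IsClosed.isClosed_connectedComponentIn_compl_union {K : Set ℂ} (hK : IsClosed K) (p : ℂ) :
    IsClosed (connectedComponentIn Kᶜ p ∪ K) := by
  rw [← isOpen_compl_iff, isOpen_iff_mem_nhds]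
  intro z hz
  rw [mem_compl_iff, mem_union, not_or] at hz
  refine mem_of_superset (hK.isOpen_compl.connectedComponentIn.mem_nhds
    (mem_connectedComponentIn (mem_compl hz.2))) fun w hw hw' => ?_
  rcases hw' with hw' | hw'
  · refine hz.1 ?_
    rw [connectedComponentIn_eq hw', ← connectedComponentIn_eq hw]
    exact mem_connectedComponentIn hz.2
  · exact connectedComponentIn_subset _ _ hw hw'

/-- The boundary of the component lies in `K`, so its indicator function can be smoothed without
changing it off a thickening of `K`. -/
theorem exists_cutoff_connectedComponentIn {K : Set ℂ} (hK : IsCompact K) {δ : ℝ} (hδ : 0 < δ) {p : ℂ}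
    (hpb : Bornology.IsBounded (connectedComponentIn Kᶜ p)) :
    ∃ χ : ℂ → ℂ, ContDiff ℝ ∞ χ ∧ HasCompactSupport χ ∧
      tsupport (fderiv ℝ χ) ⊆ cthickening δ K ∧
      (∀ z ∉ cthickening δ K, z ∈ connectedComponentIn Kᶜ p → χ z = 1) ∧
      ∀ z ∉ cthickening δ K, z ∉ connectedComponentIn Kᶜ p → χ z = 0 := by
  have hV : IsOpen (thickening δ K) := isOpen_thickening
  have hKV : K ⊆ thickening δ K := self_subset_thickening hδ K
  have hVL := thickening_subset_cthickening δ K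
  set H := connectedComponentIn Kᶜ p
  have hHo : IsOpen H := hK.isClosed.isOpen_compl.connectedComponentIn
  have h1 : IsClosed (H \ thickening δ K) := by
    have : H \ thickening δ K = (H ∪ K) \ thickening δ K := by
      rw [union_sdiff_distrib, sdiff_eq_empty.2 hKV, union_empty]
    rw [this]
    exact (hK.isClosed.isClosed_connectedComponentIn_compl_union p).sdiff hV
  have h2 : IsClosed (H ∪ thickening δ K)ᶜ := (hHo.union hV).isClosed_compl
  obtain ⟨χ, hχ, e1, e0⟩ := exists_smooth_one_nhds_zero_nhds h1 h2
    (disjoint_left.2 fun z hz hz' => hz' (Or.inl hz.1))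
  have f1 : ∀ z ∉ thickening δ K, z ∈ H → ∀ᶠ w in 𝓝 z, χ w = 1 := fun z hz hzH =>
    (eventually_nhdsSet_iff_forall.1 e1) z ⟨hzH, hz⟩
  have f0 : ∀ z ∉ thickening δ K, z ∉ H → ∀ᶠ w in 𝓝 z, χ w = 0 := fun z hz hzH =>
    (eventually_nhdsSet_iff_forall.1 e0) z fun h => h.elim hzH hz
  refine ⟨χ, hχ, ?_, fun z hz => ?_, fun z hz hzH => (f1 z (fun h => hz (hVL h)) hzH).self_of_nhds,
    fun z hz hzH => (f0 z (fun h => hz (hVL h)) hzH).self_of_nhds⟩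
  · have hb : Bornology.IsBounded (H ∪ thickening δ K) :=
      hpb.union (hK.isBounded.thickening)
    refine HasCompactSupport.of_support_subset_isCompact hb.isCompact_closure fun z hz => ?_
    refine subset_closure ?_
    by_contra h
    rw [mem_union, not_or] at h
    exact hz (f0 z h.2 h.1).self_of_nhds
  · by_contra h
    have hz' : z ∉ thickening δ K := fun hh => h (hVL hh)
    by_cases hzH : z ∈ H
    · exact notMem_tsupport_fderiv_of_eventually_const (f1 z hz' hzH) hz
    · exact notMem_tsupport_fderiv_of_eventually_const (f0 z hz' hzH) hz

/-! ### Locally univalent approximation near two continua -/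

/-- Connectedness links `a` to each point by a finite chain of discs of radius `δ`, with the mean
value inequality on each. Compactness bounds the lengths of the chains, so `C` does not depend on
`g`. -/
theorem IsPreconnected.exists_norm_sub_le_of_norm_deriv_le {K : Set ℂ} (hK : IsCompact K)
    (hKc : IsPreconnected K) {a : ℂ} (ha : a ∈ K) {δ : ℝ} (hδ : 0 < δ) :
    ∃ C : ℝ, 0 ≤ C ∧ ∀ (g : ℂ → ℂ) (η : ℝ), 0 ≤ η →
      (∀ z ∈ thickening δ K, DifferentiableAt ℂ g z ∧ ‖deriv g z‖ ≤ η) →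
      ∀ z ∈ K, ‖g z - g a‖ ≤ C * η := by
  set Q : (ℂ → ℂ) → ℝ → Prop := fun g η => 0 ≤ η ∧
    ∀ z ∈ thickening δ K, DifferentiableAt ℂ g z ∧ ‖deriv g z‖ ≤ η with hQ
  have hloc : ∀ x ∈ K, ∀ y ∈ ball x δ, ∀ g η, Q g η → ‖g y - g x‖ ≤ δ * η := by
    intro x hx y hy g η hg
    have hb : ball x δ ⊆ thickening δ K := fun w hw => mem_thickening_iff.2 ⟨x, hx, hw⟩
    have h1 := (convex_ball x δ).norm_image_sub_le_of_norm_deriv_le (f := g) (C := η)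
      (fun w hw => (hg.2 w (hb hw)).1) (fun w hw => (hg.2 w (hb hw)).2) (mem_ball_self hδ) hy
    rw [mul_comm]
    exact h1.trans (mul_le_mul_of_nonneg_left (mem_ball_iff_norm.1 hy).le hg.1)
  have hpt : ∀ y ∈ K, ∃ C : ℝ, 0 ≤ C ∧ ∀ g η, Q g η → ‖g y - g a‖ ≤ C * η := by
    intro y hy
    refine hKc.induction₂ (fun x y => ∃ C : ℝ, 0 ≤ C ∧ ∀ g η, Q g η → ‖g y - g x‖ ≤ C * η)
      (fun x hx => ?_) ?_ ?_ ha hy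
    · exact mem_nhdsWithin_of_mem_nhds (mem_of_superset (ball_mem_nhds x hδ)
        fun y hy => ⟨δ, hδ.le, hloc x hx y hy⟩)
    · rintro x y z - - - ⟨C, hC, h⟩ ⟨C', hC', h'⟩
      refine ⟨C + C', add_nonneg hC hC', fun g η hg => ?_⟩
      calc ‖g z - g x‖ ≤ ‖g z - g y‖ + ‖g y - g x‖ := norm_sub_le_norm_sub_add_norm_sub ..
        _ ≤ C' * η + C * η := add_le_add (h' g η hg) (h g η hg)
        _ = (C + C') * η := by ring
    · rintro x y - - ⟨C, hC, h⟩
      exact ⟨C, hC, fun g η hg => by rw [norm_sub_rev]; exact h g η hg⟩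
  have hun : ∃ C : ℝ, 0 ≤ C ∧ ∀ z ∈ K, ∀ g η, Q g η → ‖g z - g a‖ ≤ C * η := by
    refine hK.induction_on (p := fun s => ∃ C : ℝ, 0 ≤ C ∧ ∀ z ∈ s, ∀ g η, Q g η →
      ‖g z - g a‖ ≤ C * η) ⟨0, le_rfl, by simp⟩ ?_ ?_ ?_
    · rintro s t hst ⟨C, hC, h⟩
      exact ⟨C, hC, fun z hz => h z (hst hz)⟩
    · rintro s t ⟨C, hC, h⟩ ⟨C', hC', h'⟩
      refine ⟨max C C', le_max_of_le_left hC, ?_⟩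
      rintro z (hz | hz) g η hg
      · exact (h z hz g η hg).trans (mul_le_mul_of_nonneg_right (le_max_left _ _) hg.1)
      · exact (h' z hz g η hg).trans (mul_le_mul_of_nonneg_right (le_max_right _ _) hg.1)
    · intro x hx
      obtain ⟨C, hC, h⟩ := hpt x hx
      refine ⟨ball x δ, mem_nhdsWithin_of_mem_nhds (ball_mem_nhds x hδ), C + δ,
        add_nonneg hC hδ.le, fun z hz g η hg => ?_⟩
      calc ‖g z - g a‖ ≤ ‖g z - g x‖ + ‖g x - g a‖ := norm_sub_le_norm_sub_add_norm_sub ..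
        _ ≤ δ * η + C * η := add_le_add (hloc x hx z hz g η hg) (h g η hg)
        _ = (C + δ) * η := by ring
  obtain ⟨C, hC, h⟩ := hun
  exact ⟨C, hC, fun g η hη hg z hz => h z hz g η ⟨hη, hg⟩⟩

/-- Approximation of locally univalent functions near two disjoint continua by locally univalent
functions on the complement of `S`. -/
theorem exists_locally_univalent_approx {K₁ K₂ U₁ U₂ S : Set ℂ} (hK₁ : IsCompact K₁)
    (hK₂ : IsCompact K₂) (hc₁ : IsConnected K₁) (hc₂ : IsConnected K₂) (h₁ : IsOpen U₁)
    (h₂ : IsOpen U₂) (hd : Disjoint U₁ U₂) (hKU₁ : K₁ ⊆ U₁) (hKU₂ : K₂ ⊆ U₂)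
    (hS : Disjoint S (U₁ ∪ U₂))
    (hcomp : ∀ ζ ∉ K₁ ∪ K₂, Bornology.IsBounded (connectedComponentIn (K₁ ∪ K₂)ᶜ ζ) →
      (S ∩ connectedComponentIn (K₁ ∪ K₂)ᶜ ζ).Nonempty) {f : ℂ → ℂ}
    (hf : DifferentiableOn ℂ f (U₁ ∪ U₂)) (hf0 : ∀ z ∈ U₁ ∪ U₂, deriv f z ≠ 0)
    {ε : ℝ} (hε : 0 < ε) :
    ∃ h : ℂ → ℂ, (∀ z ∉ S, DifferentiableAt ℂ h z ∧ deriv h z ≠ 0) ∧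
      ∀ z ∈ K₁ ∪ K₂, ‖h z - f z‖ < ε := by
  obtain ⟨z₁, hz₁⟩ := hc₁.nonempty
  obtain ⟨z₂, hz₂⟩ := hc₂.nonempty
  set K := K₁ ∪ K₂ with hKdef
  have hK : IsCompact K := hK₁.union hK₂
  have hU := h₁.union h₂
  obtain ⟨P, δ, N, hδ, hPS, hPb, hPd, hN, hMN, hNU, hsep⟩ :=
    exists_separating_finset hK hU (union_subset_union hKU₁ hKU₂) hcomp
  -- Half the thickening leaves room between `L` and `cthickening δ K` for Cauchy estimates of
  -- derivatives.
  set L := cthickening (δ / 2) K with hL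
  have hLc : IsCompact L := hK.cthickening
  have : CompactSpace L := isCompact_iff_compactSpace.1 hLc
  have hLM : L ⊆ interior (cthickening δ K) := by
    refine (cthickening_subset_thickening' hδ (half_lt_self hδ) K).trans ?_
    exact interior_maximal (thickening_subset_cthickening δ K) isOpen_thickening
  have hKL : K ⊆ L := self_subset_cthickening K
  have hPU : ∀ p ∈ P, p ∉ U₁ ∪ U₂ := fun p hp => hS.notMem_of_mem_left (hPS hp)
  have hLU : L ⊆ U₁ ∪ U₂ := ((hLM.trans interior_subset).trans hMN).trans hNU
  have hPL : ∀ p ∈ P, p ∉ L := fun p hp h => hPU p hp (hLU h)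
  have hPK : ∀ p ∈ P, p ∈ connectedComponentIn Kᶜ p := fun p hp =>
    mem_connectedComponentIn fun h => hPL p hp (hKL h)
  choose! χ hχ hχc hχs hχ1 hχ0 using fun p (hp : p ∈ P) =>
    exists_cutoff_connectedComponentIn hK (half_pos hδ) (hPb p hp)
  obtain ⟨Λ, hΛ⟩ := exists_isPeriodFunctional hLc hPL hχ hχc hχs
    (fun p hp => hχ1 p hp p (hPL p hp) (hPK p hp))
    (fun p hp q hq hpq => hχ0 p hp q (hPL q hq) fun h => hpq (hPd p hp q hq h))
  obtain ⟨C₁, hC₁, hC₁'⟩ :=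
    hc₁.isPreconnected.exists_norm_sub_le_of_norm_deriv_le hK₁ hz₁ (half_pos hδ)
  obtain ⟨C₂, hC₂, hC₂'⟩ :=
    hc₂.isPreconnected.exists_norm_sub_le_of_norm_deriv_le hK₂ hz₂ (half_pos hδ)
  -- The error is at most `C₁ * η` on `K₁`, where the values agree at `z₁`, and less than `C₂ * η +
  -- η` on `K₂`, where they differ by less than `η` at `z₂`.
  set η := ε / (C₁ + C₂ + 2) with hη
  have hη0 : 0 < η := by positivity
  have hηε : (C₁ + C₂ + 2) * η = ε := by rw [hη]; field_simp
  obtain ⟨h, q, hh, hq, e₁, e₂⟩ := hΛ.exists_locally_univalent_approx hLc hK.cthickening hN hLM hMN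
    h₁ h₂ hd hNU hPU hsep ⟨hKU₁ hz₁, hKL (Or.inl hz₁)⟩ ⟨hKU₂ hz₂, hKL (Or.inr hz₂)⟩ hf hf0 hη0
  have hdiff : ∀ z ∈ L, HasDerivAt (fun w => h w - f w) (q z - deriv f z) z := fun z hz =>
    (hh z fun hzP => hPL z hzP hz).1.sub (hf.differentiableAt (hU.mem_nhds (hLU hz))).hasDerivAt
  have hcond : ∀ z ∈ L, DifferentiableAt ℂ (fun w => h w - f w) z ∧
      ‖deriv (fun w => h w - f w) z‖ ≤ η := fun z hz =>
    ⟨(hdiff z hz).differentiableAt, by rw [(hdiff z hz).deriv]; exact (hq z hz).le⟩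
  have hsub : ∀ {K' : Set ℂ}, K' ⊆ K → thickening (δ / 2) K' ⊆ L := fun hs =>
    (thickening_subset_of_subset _ hs).trans (thickening_subset_cthickening _ _)
  refine ⟨h, fun z hz => ?_, ?_⟩
  · obtain ⟨a1, a2⟩ := hh z fun hzP => hz (hPS hzP)
    exact ⟨a1.differentiableAt, by rwa [a1.deriv]⟩
  · rintro z (hz | hz)
    · have h3 := hC₁' _ η hη0.le (fun w hw => hcond w (hsub subset_union_left hw)) z hz
      simp only [e₁, sub_self, sub_zero] at h3
      nlinarith
    · have h3 := hC₂' _ η hη0.le (fun w hw => hcond w (hsub subset_union_right hw)) z hz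
      have h4 := norm_le_norm_add_norm_sub' (h z - f z) (h z₂ - f z₂)
      nlinarith

/-! ### Connected 𝒪-convex hulls -/

section
variable {X : Type*} [TopologicalSpace X]

theorem exists_isCompact_isConnected_nhds [LocallyConnectedSpace X] [LocallyCompactSpace X] [T2Space X]
    (x : X) : ∃ C ∈ 𝓝 x, IsCompact C ∧ IsConnected C := by
  obtain ⟨N, hN, hxN⟩ := exists_compact_mem_nhds x
  have hx : x ∈ interior N := mem_interior_iff_mem_nhds.2 hxN
  refine ⟨closure (connectedComponentIn (interior N) x), ?_, ?_, ?_⟩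
  · exact mem_of_superset (isOpen_interior.connectedComponentIn.mem_nhds
      (mem_connectedComponentIn hx)) subset_closure
  · exact hN.of_isClosed_subset isClosed_closure
      (closure_minimal ((connectedComponentIn_subset _ _).trans interior_subset) hN.isClosed)
  · exact (isConnected_connectedComponentIn_iff.2 hx).closure

theorem IsCompact.exists_isCompact_isConnected_superset [LocallyConnectedSpace X]
    [LocallyCompactSpace X] [T2Space X] [ConnectedSpace X] {K : Set X} (hK : IsCompact K) :
    ∃ C, IsCompact C ∧ IsConnected C ∧ K ⊆ C := by
  obtain ⟨a⟩ := (inferInstance : Nonempty X)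
  have hpt : ∀ y, ∃ C, IsCompact C ∧ IsPreconnected C ∧ a ∈ C ∧ y ∈ C := fun y => by
    refine isPreconnected_univ.induction₂
      (fun x y => ∃ C, IsCompact C ∧ IsPreconnected C ∧ x ∈ C ∧ y ∈ C)
      (fun x _ => ?_) ?_ ?_ (mem_univ a) (mem_univ y)
    · obtain ⟨C, hC, h1, h2⟩ := exists_isCompact_isConnected_nhds x
      exact mem_nhdsWithin_of_mem_nhds
        (mem_of_superset hC fun y hy => ⟨C, h1, h2.isPreconnected, mem_of_mem_nhds hC, hy⟩)
    · rintro x y z - - - ⟨C, h1, h2, h3, h4⟩ ⟨C', h1', h2', h3', h4'⟩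
      exact ⟨C ∪ C', h1.union h1', h2.union y h4 h3' h2', Or.inl h3, Or.inr h4'⟩
    · rintro x y - - ⟨C, h1, h2, h3, h4⟩
      exact ⟨C, h1, h2, h4, h3⟩
  have : ∃ C, IsCompact C ∧ IsPreconnected C ∧ a ∈ C ∧ K ⊆ C := by
    refine hK.induction_on (p := fun s => ∃ C, IsCompact C ∧ IsPreconnected C ∧ a ∈ C ∧ s ⊆ C)
      ⟨{a}, isCompact_singleton, isPreconnected_singleton, rfl, empty_subset _⟩ ?_ ?_ ?_
    · rintro s t hst ⟨C, h1, h2, h3, h4⟩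
      exact ⟨C, h1, h2, h3, hst.trans h4⟩
    · rintro s t ⟨C, h1, h2, h3, h4⟩ ⟨C', h1', h2', h3', h4'⟩
      exact ⟨C ∪ C', h1.union h1', h2.union a h3 h3' h2', Or.inl h3, union_subset_union h4 h4'⟩
    · intro x _
      obtain ⟨C, h1, h2, h3, h4⟩ := hpt x
      obtain ⟨C', hC', h1', h2'⟩ := exists_isCompact_isConnected_nhds x
      exact ⟨C', mem_nhdsWithin_of_mem_nhds hC', C ∪ C', h1.union h1',
        h2.union x h4 (mem_of_mem_nhds hC') h2'.isPreconnected, Or.inl h3, subset_union_right⟩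
  obtain ⟨C, h1, h2, h3, h4⟩ := this
  exact ⟨C, h1, ⟨⟨a, h3⟩, h2⟩, h4⟩

theorem IsClosed.closure_connectedComponentIn_compl_subset [LocallyConnectedSpace X] {C : Set X}
    (hC : IsClosed C) (z : X) :
    closure (connectedComponentIn Cᶜ z) ⊆ connectedComponentIn Cᶜ z ∪ C := by
  intro w hw
  by_contra h
  rw [mem_union, not_or] at h
  obtain ⟨v, hv, hv'⟩ := mem_closure_iff.1 hw _ hC.isOpen_compl.connectedComponentIn
    (mem_connectedComponentIn (mem_compl h.2))
  refine h.1 ?_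
  rw [connectedComponentIn_eq hv', ← connectedComponentIn_eq hv]
  exact mem_connectedComponentIn h.2

/-- Otherwise the component would be clopen, hence the whole space. -/
theorem closure_connectedComponentIn_compl_inter_nonempty [LocallyConnectedSpace X]
    [PreconnectedSpace X] {C : Set X} (hC : IsClosed C) (hCn : C.Nonempty) {z : X} (hz : z ∉ C) :
    (closure (connectedComponentIn Cᶜ z) ∩ C).Nonempty := by
  by_contra h
  have h1 : closure (connectedComponentIn Cᶜ z) ⊆ connectedComponentIn Cᶜ z := fun w hw =>
    (hC.closure_connectedComponentIn_compl_subset z hw).resolve_right fun hw' => h ⟨w, hw, hw'⟩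
  have h2 : IsClopen (connectedComponentIn Cᶜ z) :=
    ⟨closure_subset_iff_isClosed.1 h1, hC.isOpen_compl.connectedComponentIn⟩
  have h3 := h2.eq_univ ⟨z, mem_connectedComponentIn (mem_compl hz)⟩
  obtain ⟨c, hc⟩ := hCn
  exact connectedComponentIn_subset Cᶜ z (h3 ▸ mem_univ c) hc

/-- The union of a set with the relatively compact components of its complement. -/
def fillHoles (C : Set X) : Set X :=
  {z | z ∈ C ∨ IsCompact (closure (connectedComponentIn Cᶜ z))}

theorem subset_fillHoles (C : Set X) : C ⊆ fillHoles C := fun _ => Or.inl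

variable {C : Set X}

theorem disjoint_fillHoles {z : X} (hz : z ∉ fillHoles C) :
    Disjoint (connectedComponentIn Cᶜ z) (fillHoles C) := by
  refine disjoint_left.2 fun w hw hw' => ?_
  rcases hw' with hw' | hw'
  · exact connectedComponentIn_subset _ _ hw hw'
  · exact hz (Or.inr (by rwa [connectedComponentIn_eq hw]))

theorem connectedComponentIn_subset_fillHoles {z : X}
    (hz : IsCompact (closure (connectedComponentIn Cᶜ z))) :
    connectedComponentIn Cᶜ z ⊆ fillHoles C := fun w hw =>
  Or.inr (by rwa [← connectedComponentIn_eq hw])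

theorem isClosed_fillHoles [LocallyConnectedSpace X] (hC : IsClosed C) : IsClosed (fillHoles C) := by
  rw [← isOpen_compl_iff, isOpen_iff_mem_nhds]
  intro z hz
  have hzC : z ∉ C := fun h => hz (Or.inl h)
  exact mem_of_superset (hC.isOpen_compl.connectedComponentIn.mem_nhds
    (mem_connectedComponentIn (mem_compl hzC))) (disjoint_fillHoles hz).subset_compl_right

/-- The closure of each filled component is connected and touches `C`. -/
theorem isConnected_fillHoles [LocallyConnectedSpace X] [PreconnectedSpace X] (hC : IsClosed C)
    (hCc : IsConnected C) : IsConnected (fillHoles C) := by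
  obtain ⟨a, ha⟩ := hCc.nonempty
  refine ⟨⟨a, Or.inl ha⟩, isPreconnected_of_forall a fun y hy => ?_⟩
  by_cases hyC : y ∈ C
  · exact ⟨C, subset_fillHoles C, ha, hyC, hCc.isPreconnected⟩
  · obtain ⟨c, hc, hc'⟩ := closure_connectedComponentIn_compl_inter_nonempty hC hCc.nonempty hyC
    refine ⟨C ∪ closure (connectedComponentIn Cᶜ y), union_subset (subset_fillHoles C) ?_,
      Or.inl ha, Or.inr (subset_closure (mem_connectedComponentIn hyC)),
      hCc.isPreconnected.union c hc' hc isPreconnected_connectedComponentIn.closure⟩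
    exact (hC.closure_connectedComponentIn_compl_subset y).trans (union_subset
      (connectedComponentIn_subset_fillHoles (hy.resolve_left hyC)) (subset_fillHoles C))

/-- Let `N` be a compact neighbourhood of `C`. A component of the complement that leaves `N` also
comes close to `C`, so it crosses the compact set `N \ interior N`. Finitely many components cover
that set, so only finitely many filled ones leave `N`. -/
theorem isCompact_fillHoles [LocallyConnectedSpace X] [PreconnectedSpace X] [LocallyCompactSpace X]
    [T2Space X] (hC : IsCompact C) (hCn : C.Nonempty) : IsCompact (fillHoles C) := by
  obtain ⟨N, hN, hCN⟩ := exists_compact_superset hC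
  have hcov : ∃ T, IsCompact T ∧ ∀ z ∈ N \ interior N, z ∈ fillHoles C →
      connectedComponentIn Cᶜ z ⊆ T := by
    refine (hN.diff isOpen_interior).induction_on (p := fun s => ∃ T, IsCompact T ∧
      ∀ z ∈ s, z ∈ fillHoles C → connectedComponentIn Cᶜ z ⊆ T) ⟨∅, isCompact_empty, by simp⟩
      ?_ ?_ ?_
    · rintro s t hst ⟨T, h1, h2⟩
      exact ⟨T, h1, fun z hz => h2 z (hst hz)⟩
    · rintro s t ⟨T, h1, h2⟩ ⟨T', h1', h2'⟩
      refine ⟨T ∪ T', h1.union h1', ?_⟩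
      rintro z (hz | hz) hzF
      · exact (h2 z hz hzF).trans subset_union_left
      · exact (h2' z hz hzF).trans subset_union_right
    · rintro x ⟨-, hx⟩
      have hxC : x ∉ C := fun h => hx (hCN h)
      refine ⟨connectedComponentIn Cᶜ x, mem_nhdsWithin_of_mem_nhds
        (hC.isClosed.isOpen_compl.connectedComponentIn.mem_nhds (mem_connectedComponentIn hxC)), ?_⟩
      by_cases hxF : x ∈ fillHoles C
      · refine ⟨_, hxF.resolve_left hxC, fun z hz _ => ?_⟩
        rw [← connectedComponentIn_eq hz]
        exact subset_closure
      · exact ⟨∅, isCompact_empty, fun z hz hzF =>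
          (disjoint_fillHoles hxF).notMem_of_mem_left hz hzF |>.elim⟩
  obtain ⟨T, hT, hTs⟩ := hcov
  refine (hN.union hT).of_isClosed_subset (isClosed_fillHoles hC.isClosed) fun y hy => ?_
  by_cases hyN : y ∈ N
  · exact Or.inl hyN
  have hyC : y ∉ C := fun h => hyN (interior_subset (hCN h))
  set H := connectedComponentIn Cᶜ y with hH
  by_cases hmeet : ∃ z ∈ H, z ∈ N \ interior N
  · obtain ⟨z, hz, hzN⟩ := hmeet
    have h1 := hTs z hzN (connectedComponentIn_subset_fillHoles (hy.resolve_left hyC) hz)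
    rw [← connectedComponentIn_eq hz] at h1
    exact Or.inr (h1 (mem_connectedComponentIn hyC))
  · exfalso
    have h1 : H ⊆ interior N ∪ Nᶜ := fun z hz => by
      by_contra h
      rw [mem_union, not_or, mem_compl_iff, not_not] at h
      exact hmeet ⟨z, hz, h.2, h.1⟩
    have h2 : H ⊆ Nᶜ := by
      refine isPreconnected_connectedComponentIn.subset_right_of_subset_union isOpen_interior
        hN.isClosed.isOpen_compl (disjoint_compl_right.mono_left interior_subset) h1
        ⟨y, mem_connectedComponentIn hyC, hyN⟩
    obtain ⟨c, hc, hc'⟩ := closure_connectedComponentIn_compl_inter_nonempty hC.isClosed hCn hyC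
    obtain ⟨w, hw, hw'⟩ := mem_closure_iff.1 hc _ isOpen_interior (hCN hc')
    exact h2 hw' (interior_subset hw)

theorem not_isCompact_closure_connectedComponentIn_fillHoles {z : X} (hz : z ∈ (fillHoles C)ᶜ) :
    ¬ IsCompact (closure (connectedComponentIn (fillHoles C)ᶜ z)) := fun h => by
  have hzC : z ∈ Cᶜ := fun h => hz (Or.inl h)
  refine hz (Or.inr (h.of_isClosed_subset isClosed_closure (closure_mono ?_)))
  exact isPreconnected_connectedComponentIn.subset_connectedComponentIn
    (mem_connectedComponentIn hzC) (disjoint_fillHoles hz).subset_compl_right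

end

theorem exists_isOConvexCompact_isConnected_superset {Ω : Set ℂ} (hΩ : IsPlaneDomain Ω) {K : Set Ω}
    (hK : IsCompact K) : ∃ C, IsOConvexCompact C ∧ IsConnected C ∧ K ⊆ C := by
  have : LocallyConnectedSpace Ω := hΩ.1.isOpenEmbedding_subtypeVal.locallyConnectedSpace
  have : LocallyCompactSpace Ω := hΩ.1.locallyCompactSpace
  have : ConnectedSpace Ω := isConnected_iff_connectedSpace.1 hΩ.2
  obtain ⟨C, h1, h2, h3⟩ := hK.exists_isCompact_isConnected_superset
  exact ⟨fillHoles C, ⟨isCompact_fillHoles h1 h2.nonempty,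
    fun z hz => not_isCompact_closure_connectedComponentIn_fillHoles hz⟩,
    isConnected_fillHoles h1.isClosed h2, h3.trans (subset_fillHoles C)⟩

/-- A bounded component of the planar complement contained in `Ω` would have its closure in `Ω`, and
so give a relatively compact component of `Ω \ K`. Hence every bounded component offers room for a
pole off `Ω`. -/
theorem IsOConvexCompact.compl_inter_connectedComponentIn_nonempty {Ω : Set ℂ} {K : Set Ω}
    (hK : IsOConvexCompact K) {ζ : ℂ} (hζ : ζ ∉ Subtype.val '' K)
    (hb : Bornology.IsBounded (connectedComponentIn (Subtype.val '' K)ᶜ ζ)) :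
    (Ωᶜ ∩ connectedComponentIn (Subtype.val '' K)ᶜ ζ).Nonempty := by
  by_contra hcon
  set H := connectedComponentIn (Subtype.val '' K : Set ℂ)ᶜ ζ with hH
  have hHΩ : H ⊆ Ω := fun z hz => by
    by_contra h
    exact hcon ⟨z, h, hz⟩
  have hKc : IsClosed (Subtype.val '' K : Set ℂ) := (hK.1.image continuous_subtype_val).isClosed
  have hcl : closure H ⊆ Ω := (hKc.closure_connectedComponentIn_compl_subset ζ).trans
    (union_subset hHΩ (by rintro _ ⟨z, -, rfl⟩; exact z.2))
  have hζH : ζ ∈ H := mem_connectedComponentIn hζ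
  have hz : (⟨ζ, hHΩ hζH⟩ : Ω) ∈ Kᶜ := fun h => hζ ⟨_, h, rfl⟩
  refine hK.2 _ hz ?_
  have hcpt : IsCompact (Subtype.val ⁻¹' closure H : Set Ω) :=
    (IsInducing.subtypeVal.isCompact_preimage_iff (by rwa [Subtype.range_coe])).2
      hb.isCompact_closure
  refine hcpt.of_isClosed_subset isClosed_closure
    (closure_minimal (fun w hw => subset_closure ?_) hcpt.isClosed)
  have h1 : IsPreconnected (Subtype.val '' connectedComponentIn Kᶜ (⟨ζ, hHΩ hζH⟩ : Ω)) :=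
    isPreconnected_connectedComponentIn.image _ continuous_subtype_val.continuousOn
  refine h1.subset_connectedComponentIn ⟨_, mem_connectedComponentIn hz, rfl⟩ ?_ ⟨w, hw, rfl⟩
  rintro _ ⟨v, hv, rfl⟩ ⟨v', hv', he⟩
  rw [Subtype.ext he] at hv'
  exact connectedComponentIn_subset _ _ hv hv'

/-! ### Simultaneous approximation of two functions -/

/-- The inverse of an injective holomorphic function with nonvanishing derivative. -/
theorem exists_holomorphic_inverse {F : ℂ → ℂ} {V : Set ℂ} (hV : IsOpen V)
    (hF : DifferentiableOn ℂ F V) (hF0 : ∀ z ∈ V, deriv F z ≠ 0) (hinj : InjOn F V) :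
    IsOpen (F '' V) ∧ ∃ ψ : ℂ → ℂ, (∀ z ∈ V, ψ (F z) = z) ∧
      ∀ z ∈ V, HasDerivAt ψ (deriv F z)⁻¹ (F z) := by
  have hst : ∀ z ∈ V, HasStrictDerivAt F (deriv F z) z := fun z hz =>
    (hF.analyticAt (hV.mem_nhds hz)).hasStrictDerivAt
  have hmap : ∀ z ∈ V, ∀ W ∈ 𝓝 z, F '' W ∈ 𝓝 (F z) := fun z hz W hW => by
    rw [← (hst z hz).map_nhds_eq (hF0 z hz)]
    exact image_mem_map hW
  have hψ : ∀ z ∈ V, Function.invFunOn F V (F z) = z := fun z hz => hinj.leftInvOn_invFunOn hz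
  refine ⟨isOpen_iff_mem_nhds.2 ?_, Function.invFunOn F V, hψ, fun z hz => ?_⟩
  · rintro _ ⟨z, hz, rfl⟩
    exact hmap z hz V (hV.mem_nhds hz)
  · refine HasDerivAt.of_local_left_inverse (f := F) ?_ ?_ (hF0 z hz) ?_
    · rw [ContinuousAt, hψ z hz]
      intro W hW
      rw [mem_map]
      refine mem_of_superset (hmap z hz (W ∩ V) (inter_mem hW (hV.mem_nhds hz))) ?_
      rintro _ ⟨w, ⟨hw, hwV⟩, rfl⟩
      rwa [mem_preimage, hψ w hwV]
    · rw [hψ z hz]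
      exact (hst z hz).hasDerivAt
    · refine mem_of_superset (hmap z hz V (hV.mem_nhds hz)) ?_
      rintro _ ⟨w, hw, rfl⟩
      simp only [mem_ofPred_eq, hψ w hw]

theorem exists_universal_approx {Ω : Set ℂ} (hΩ : IsPlaneDomain Ω) {φ : ℕ → C(Ω, Ω)}
    (hφ : ∀ n, φ n ∈ locallyUnivalentSelfMaps Ω) (hinj : EventuallyInjective φ)
    (hconv : ∀ K : Set Ω, IsOConvexCompact K → ∀ N : ℕ, ∃ n ≥ N,
      (φ n '' K) ∩ K = ∅ ∧ IsOConvexCompact ((φ n '' K) ∪ K))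
    {f g : C(Ω, ℂ)} (hf : f ∈ locallyUnivalentFunctions Ω) (hg : g ∈ locallyUnivalentFunctions Ω)
    {K : Set Ω} (hK : IsCompact K) {ε : ℝ} (hε : 0 < ε) :
    ∃ h ∈ locallyUnivalentFunctions Ω, ∃ n, (∀ z ∈ K, ‖h z - f z‖ < ε) ∧
      ∀ z ∈ K, ‖h (φ n z) - g z‖ < ε := by
  classical
  have : LocallyCompactSpace Ω := hΩ.1.locallyCompactSpace
  obtain ⟨C, hC, hCc, hKC⟩ := exists_isOConvexCompact_isConnected_superset hΩ hK
  -- Injectivity is needed on a neighbourhood of `C`, so that the inverse of `φ n` is holomorphic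
  -- near `φ n '' C`.
  obtain ⟨N, hN, hCN⟩ := exists_compact_superset hC.1
  obtain ⟨n₀, hn₀⟩ := hinj N hN
  obtain ⟨n, hn, hdisj, hunion⟩ := hconv C hC n₀
  obtain ⟨F, hF, hF0, hFf⟩ := hf
  obtain ⟨G, hG, hG0, hGg⟩ := hg
  obtain ⟨T, hT, hT0, hTφ'⟩ := hφ n
  have hTφ : ∀ z : Ω, T z = φ n z := hTφ'
  set K₁ : Set ℂ := Subtype.val '' C with hK₁
  set K₂ : Set ℂ := Subtype.val '' (φ n '' C) with hK₂
  have hc₁ : IsCompact K₁ := hC.1.image continuous_subtype_val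
  have hφC : IsCompact (φ n '' C) := hC.1.image (φ n).continuous
  have hc₂ : IsCompact K₂ := hφC.image continuous_subtype_val
  have hd : Disjoint K₁ K₂ := by
    rw [disjoint_image_iff Subtype.val_injective, disjoint_iff_inter_eq_empty, inter_comm]
    exact hdisj
  obtain ⟨A₁, A₂, hA₁, hA₂, hKA₁, hKA₂, hA⟩ := SeparatedNhds.of_isCompact_isCompact hc₁ hc₂ hd
  set V : Set ℂ := Subtype.val '' interior N ∩ T ⁻¹' A₂ with hV
  have hN' : IsOpen (Subtype.val '' interior N : Set ℂ) :=
    hΩ.1.isOpenMap_subtype_val _ isOpen_interior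
  have hNΩ : (Subtype.val '' interior N : Set ℂ) ⊆ Ω := by rintro _ ⟨z, -, rfl⟩; exact z.2
  have hVo : IsOpen V := (hT.continuousOn.mono hNΩ).isOpen_inter_preimage hN' hA₂
  have hVΩ : V ⊆ Ω := inter_subset_left.trans hNΩ
  have hVT : InjOn T V := by
    rintro _ ⟨⟨z, hz, rfl⟩, -⟩ _ ⟨⟨w, hw, rfl⟩, -⟩ hzw
    rw [hTφ, hTφ] at hzw
    rw [hn₀ n hn (interior_subset hz) (interior_subset hw) (Subtype.ext hzw)]
  obtain ⟨hTV, ψ, hψ, hψ'⟩ := exists_holomorphic_inverse hVo (hT.mono hVΩ)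
    (fun z hz => hT0 z (hVΩ hz)) hVT
  have hCV : ∀ z ∈ C, (z : ℂ) ∈ V := fun z hz => ⟨⟨z, hCN hz, rfl⟩, by
    rw [mem_preimage, hTφ]
    exact hKA₂ ⟨_, ⟨z, hz, rfl⟩, rfl⟩⟩
  set U₁ := A₁ ∩ Ω with hU₁
  have hU₁o : IsOpen U₁ := hA₁.inter hΩ.1
  have hU : Disjoint U₁ (T '' V) := hA.mono inter_subset_left (by
    rintro _ ⟨z, hz, rfl⟩
    exact hz.2)
  have hTVΩ : T '' V ⊆ Ω := by
    rintro _ ⟨z, hz, rfl⟩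
    rw [hTφ ⟨z, hVΩ hz⟩]
    exact Subtype.prop _
  -- The function to approximate is `f` near `C` and `g ∘ (φ n)⁻¹` near `φ n '' C`. Composing with
  -- `φ n` turns the second into `g`.
  set E : ℂ → ℂ := fun z => if z ∈ U₁ then F z else G (ψ z) with hE
  have hE₁ : ∀ z ∈ U₁, HasDerivAt E (deriv F z) z := fun z hz => by
    refine (hF.differentiableAt (hΩ.1.mem_nhds hz.2)).hasDerivAt.congr_of_eventuallyEq ?_
    filter_upwards [hU₁o.mem_nhds hz] with w hw
    simp only [hE, if_pos hw]
  have hE₂ : ∀ z ∈ V, HasDerivAt E (deriv G z * (deriv T z)⁻¹) (T z) := fun z hz => by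
    have h1 : HasDerivAt G (deriv G z) (ψ (T z)) := by
      rw [hψ z hz]
      exact (hG.differentiableAt (hΩ.1.mem_nhds (hVΩ hz))).hasDerivAt
    refine (h1.comp (T z) (hψ' z hz)).congr_of_eventuallyEq ?_
    filter_upwards [hTV.mem_nhds ⟨z, hz, rfl⟩] with w hw
    simp only [hE, if_neg (hU.notMem_of_mem_right hw), Function.comp]
  obtain ⟨h, hh, hhE⟩ := exists_locally_univalent_approx hc₁ hc₂
    (hCc.image _ continuous_subtype_val.continuousOn)
    ((hCc.image _ (φ n).continuous.continuousOn).image _ continuous_subtype_val.continuousOn)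
    hU₁o hTV hU (fun z hz => ⟨hKA₁ hz, by obtain ⟨w, -, rfl⟩ := hz; exact w.2⟩)
    (by rintro _ ⟨_, ⟨z, hz, rfl⟩, rfl⟩; exact ⟨z, hCV z hz, hTφ z⟩)
    (S := Ωᶜ) (disjoint_compl_left_iff_subset.2 (union_subset inter_subset_right hTVΩ))
    (by
      rw [hK₁, hK₂, union_comm, ← image_union]
      exact fun ζ hζ hb => hunion.compl_inter_connectedComponentIn_nonempty hζ hb)
    (f := E) (by
      rintro z (hz | ⟨w, hw, rfl⟩)
      · exact (hE₁ z hz).differentiableAt.differentiableWithinAt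
      · exact (hE₂ w hw).differentiableAt.differentiableWithinAt)
    (by
      rintro z (hz | ⟨w, hw, rfl⟩)
      · rw [(hE₁ z hz).deriv]
        exact hF0 z hz.2
      · rw [(hE₂ w hw).deriv]
        exact mul_ne_zero (hG0 w (hVΩ hw)) (inv_ne_zero (hT0 w (hVΩ hw)))) hε
  have hhd : DifferentiableOn ℂ h Ω := fun z hz =>
    (hh z (not_not.2 hz)).1.differentiableWithinAt
  refine ⟨⟨fun z => h z, hhd.continuousOn.domRestrict⟩,
    ⟨h, hhd, fun z hz => (hh z (not_not.2 hz)).2, fun z => rfl⟩, n, fun z hz => ?_, fun z hz => ?_⟩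
  · have hz1 : (z : ℂ) ∈ K₁ := ⟨z, hKC hz, rfl⟩
    have h1 := hhE z (Or.inl hz1)
    simp only [hE, if_pos (show (z : ℂ) ∈ U₁ from ⟨hKA₁ hz1, z.2⟩), hFf] at h1
    exact h1
  · have hz1 := hCV z (hKC hz)
    have h1 := hhE _ (Or.inr ⟨_, ⟨z, hKC hz, rfl⟩, rfl⟩)
    have h2 : E (φ n z) = g z := by
      rw [← hTφ z]
      simp only [hE, if_neg (hU.notMem_of_mem_right ⟨(z : ℂ), hz1, rfl⟩), hψ _ hz1, hGg]
    rw [h2] at h1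
    exact h1

/-! ### Hurwitz' theorem and the Baire property -/

/-- Hurwitz' theorem. -/
theorem TendstoLocallyUniformlyOn.eventually_eq_zero_of_forall_ne_zero {Ω : Set ℂ} (hΩ : IsOpen Ω)
    {F : ℕ → ℂ → ℂ} {g : ℂ → ℂ} (h : TendstoLocallyUniformlyOn F g atTop Ω)
    (hF : ∀ n, DifferentiableOn ℂ (F n) Ω) (hF0 : ∀ n, ∀ z ∈ Ω, F n z ≠ 0) {z₀ : ℂ} (hz₀ : z₀ ∈ Ω)
    (hg : g z₀ = 0) : ∀ᶠ z in 𝓝 z₀, g z = 0 := by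
  have hgd : DifferentiableOn ℂ g Ω := h.differentiableOn (Eventually.of_forall hF) hΩ
  refine (hgd.analyticAt (hΩ.mem_nhds hz₀)).eventually_eq_zero_or_eventually_ne_zero.resolve_right
    fun hne => ?_
  rw [eventually_nhdsWithin_iff] at hne
  obtain ⟨r, hr, hrs⟩ := nhds_basis_closedBall.mem_iff.1 (hne.and (hΩ.mem_nhds hz₀))
  have hrΩ : closedBall z₀ r ⊆ Ω := fun z hz => (hrs hz).2
  have hgs : ∀ z ∈ sphere z₀ r, g z ≠ 0 := fun z hz =>
    (hrs (sphere_subset_closedBall hz)).1 (ne_of_mem_sphere hz hr.ne')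
  obtain ⟨w, hw, hwm⟩ := (isCompact_sphere z₀ r).exists_isMinOn
    (NormedSpace.sphere_nonempty.2 hr.le)
    (hgd.continuousOn.mono (sphere_subset_closedBall.trans hrΩ)).norm
  have hm : 0 < ‖g w‖ := norm_pos_iff.2 (hgs w hw)
  have hu := (tendstoLocallyUniformlyOn_iff_forall_isCompact hΩ).1 h _ hrΩ
    (isCompact_closedBall z₀ r)
  obtain ⟨n, hn⟩ := (Metric.tendstoUniformlyOn_iff.1 hu _ (half_pos hm)).exists
  -- If the zero were isolated, the maximum principle for `1 / F n` would carry the bound `‖F n‖ ≥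
  -- ‖g w‖ / 2` from the circle to its centre, where `F n` is within less than `‖g w‖ / 2` of `g z₀
  -- = 0`.
  have hd : DiffContOnCl ℂ (fun z => (F n z)⁻¹) (ball z₀ r) :=
    DifferentiableOn.diffContOnCl (((hF n).inv (hF0 n)).mono
      (closure_ball_subset_closedBall.trans hrΩ))
  have hle := norm_le_of_forall_mem_frontier_norm_le isBounded_ball hd (C := (‖g w‖ / 2)⁻¹)
    (fun z hz => by
      rw [frontier_ball z₀ hr.ne'] at hz
      rw [norm_inv]
      refine inv_anti₀ (half_pos hm) ?_
      have h1 := hn z (sphere_subset_closedBall hz)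
      have h2 : ‖g w‖ ≤ ‖g z‖ := hwm hz
      rw [dist_eq_norm] at h1
      have h3 := norm_le_norm_add_norm_sub' (g z) (F n z)
      linarith) (subset_closure (mem_ball_self hr))
  rw [norm_inv, inv_le_inv₀ (norm_pos_iff.2 (hF0 n z₀ hz₀)) (half_pos hm)] at hle
  have h1 := hn z₀ (mem_closedBall_self hr.le)
  rw [hg, dist_zero_left] at h1
  exact hle.not_gt h1

section
variable {Ω : Set ℂ}

theorem exists_ne_of_mem_locallyUnivalentFunctions (hΩ : IsPlaneDomain Ω) {f : C(Ω, ℂ)}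
    (hf : f ∈ locallyUnivalentFunctions Ω) : ∃ x y, f x ≠ f y := by
  by_contra! h
  obtain ⟨F, hF, hF0, hFf⟩ := hf
  obtain ⟨a, ha⟩ := hΩ.2.nonempty
  refine hF0 a ha ?_
  have h1 : F =ᶠ[𝓝 a] fun _ => F a := by
    filter_upwards [hΩ.1.mem_nhds ha] with z hz
    exact ((hFf ⟨z, hz⟩).trans (h _ _)).trans (hFf ⟨a, ha⟩).symm
  rw [h1.deriv_eq, deriv_const]

/-- By Hurwitz for the derivatives, a zero of the limit's derivative forces it to vanish identically
on the connected set `Ω`, which makes the limit constant. -/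
theorem mem_locallyUnivalentFunctions_of_mem_closure (hΩ : IsPlaneDomain Ω) {f : C(Ω, ℂ)}
    (hf : f ∈ closure (locallyUnivalentFunctions Ω)) {x y : Ω} (hxy : f x ≠ f y) :
    f ∈ locallyUnivalentFunctions Ω := by
  have : LocallyCompactSpace Ω := hΩ.1.locallyCompactSpace
  obtain ⟨s, hs, hsf⟩ := mem_closure_iff_seq_limit.1 hf
  choose F hF hF0 hFs using hs
  set G : ℂ → ℂ := Function.extend Subtype.val f 0
  have hG : ∀ z : Ω, G z = f z := fun z => Subtype.val_injective.extend_apply _ _ _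
  have hlim : TendstoLocallyUniformlyOn F G atTop Ω := by
    rw [tendstoLocallyUniformlyOn_iff_tendstoLocallyUniformly_comp_coe]
    have h1 := ContinuousMap.tendsto_iff_tendstoLocallyUniformly.1 hsf
    have e1 : G ∘ (Subtype.val : Ω → ℂ) = f := funext hG
    have e2 : (fun n (z : Ω) => F n z) = fun n z => s n z := funext fun n => funext (hFs n)
    rw [e1, e2]
    exact h1
  have hGd : DifferentiableOn ℂ G Ω := hlim.differentiableOn (Eventually.of_forall hF) hΩ.1
  have hlim' := hlim.deriv (Eventually.of_forall hF) hΩ.1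
  have hGd' := hGd.deriv hΩ.1
  refine ⟨G, hGd, fun z hz hz0 => hxy ?_, hG⟩
  have h1 := hlim'.eventually_eq_zero_of_forall_ne_zero hΩ.1 (fun n => (hF n).deriv hΩ.1) hF0 hz hz0
  have h2 : EqOn (deriv G) 0 Ω :=
    (hGd'.analyticOnNhd hΩ.1).eqOn_zero_of_preconnected_of_eventuallyEq_zero hΩ.2.isPreconnected hz h1
  rw [← hG, ← hG]
  exact hΩ.1.is_const_of_deriv_eq_zero hΩ.2.isPreconnected hGd h2 x.2 y.2

/-- Limits may be constant, but non-constancy is an open condition. The space is thus open in its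
closure, which is complete and therefore Baire. -/
theorem baireSpace_locallyUnivalentFunctions (hΩ : IsPlaneDomain Ω) :
    BaireSpace (locallyUnivalentFunctions Ω) := by
  have : LocallyCompactSpace Ω := hΩ.1.locallyCompactSpace
  have : CompleteSpace (closure (locallyUnivalentFunctions Ω)) :=
    isClosed_closure.completeSpace_coe
  have : BaireSpace (closure (locallyUnivalentFunctions Ω)) := inferInstance
  have hr : range (inclusion (subset_closure (s := locallyUnivalentFunctions Ω))) =
      Subtype.val ⁻¹' ⋃ x, ⋃ y, {f : C(Ω, ℂ) | f x ≠ f y} := by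
    rw [range_inclusion]
    ext f
    simp only [mem_preimage, mem_iUnion, mem_ofPred_eq]
    exact ⟨exists_ne_of_mem_locallyUnivalentFunctions hΩ, fun ⟨x, y, h⟩ =>
      mem_locallyUnivalentFunctions_of_mem_closure hΩ f.2 h⟩
  suffices ho : IsOpen (range (inclusion (subset_closure (s := locallyUnivalentFunctions Ω)))) from
    Topology.IsOpenEmbedding.baireSpace ⟨IsEmbedding.inclusion subset_closure, ho⟩
  rw [hr]
  refine IsOpen.preimage continuous_subtype_val (isOpen_iUnion fun x => isOpen_iUnion fun y => ?_)
  exact isOpen_ne_fun (continuous_eval_const x) (continuous_eval_const y)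

theorem comp_mem_locallyUnivalentFunctions (hΩ : IsPlaneDomain Ω) {f : C(Ω, ℂ)}
    (hf : f ∈ locallyUnivalentFunctions Ω) {φ : C(Ω, Ω)} (hφ : φ ∈ locallyUnivalentSelfMaps Ω) :
    f.comp φ ∈ locallyUnivalentFunctions Ω := by
  obtain ⟨F, hF, hF0, hFf⟩ := hf
  obtain ⟨T, hT, hT0, hTφ⟩ := hφ
  have hTΩ : MapsTo T Ω Ω := fun z hz => by
    rw [hTφ ⟨z, hz⟩]
    exact Subtype.prop _
  refine ⟨F ∘ T, hF.comp hT hTΩ, fun z hz => ?_, fun z => ?_⟩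
  · rw [deriv_comp z (hF.differentiableAt (hΩ.1.mem_nhds (hTΩ hz)))
      (hT.differentiableAt (hΩ.1.mem_nhds hz))]
    exact mul_ne_zero (hF0 _ (hTΩ hz)) (hT0 z hz)
  · rw [Function.comp_apply, hTφ, ContinuousMap.comp_apply, hFf]

theorem id_mem_locallyUnivalentFunctions :
    (⟨Subtype.val, continuous_subtype_val⟩ : C(Ω, ℂ)) ∈ locallyUnivalentFunctions Ω :=
  ⟨id, differentiableOn_id, fun z _ => by simp, fun _ => rfl⟩

/-! ### Universal functions as a countable intersection of dense open sets -/

theorem ContinuousMap.exists_forall_norm_sub_lt_imp_mem {X : Type*} [TopologicalSpace X] {f : C(X, ℂ)}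
    {O : Set C(X, ℂ)} (hO : O ∈ 𝓝 f) :
    ∃ K, IsCompact K ∧ ∃ ε > 0, ∀ h : C(X, ℂ), (∀ z ∈ K, ‖h z - f z‖ < ε) → h ∈ O := by
  have hb := uniformity_basis_dist (α := ℂ) |>.compactConvergenceUniformity (α := X)
  obtain ⟨⟨K, ε⟩, ⟨hK, hε⟩, hs⟩ := (nhds_basis_uniformity' hb).mem_iff.1 hO
  refine ⟨K, hK, ε, hε, fun h hh => hs fun z hz => ?_⟩
  have := hh z hz
  rwa [← dist_eq_norm, dist_comm] at this

/-- Density need only be tested on basic open sets meeting the locally univalent functions; for a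
countable basis this is a countable intersection. -/
theorem universal_eq_iInter (hΩ : IsPlaneDomain Ω) {Φ : Set C(Ω, Ω)}
    (hΦ : Φ ⊆ locallyUnivalentSelfMaps Ω) {B : Set (Set C(Ω, ℂ))}
    (hB : TopologicalSpace.IsTopologicalBasis B) :
    {G : locallyUnivalentFunctions Ω |
      IsUniversalIn Φ (locallyUnivalentFunctions Ω) (G : C(Ω, ℂ))} =
    ⋂ b ∈ {b ∈ B | (b ∩ locallyUnivalentFunctions Ω).Nonempty},
      {G : locallyUnivalentFunctions Ω | ∃ φ ∈ Φ, (G : C(Ω, ℂ)).comp φ ∈ b} := by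
  ext G
  simp only [mem_iInter, mem_ofPred_eq]
  constructor
  · rintro ⟨-, -, h⟩ b ⟨hb, f, hfb, hf⟩
    obtain ⟨_, h1, φ, hφ, rfl⟩ := hB.mem_closure_iff.1 (h hf) b hb hfb
    exact ⟨φ, hφ, h1⟩
  · intro h
    refine ⟨G.2, ?_, fun f hf => hB.mem_closure_iff.2 fun b hb hfb => ?_⟩
    · rintro _ ⟨φ, hφ, rfl⟩
      exact comp_mem_locallyUnivalentFunctions hΩ G.2 (hΦ hφ)
    · obtain ⟨φ, hφ, h1⟩ := h b ⟨hb, f, hfb, hf⟩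
      exact ⟨_, h1, φ, hφ, rfl⟩

theorem isOpen_setOf_comp_mem {Φ : Set C(Ω, Ω)} {b : Set C(Ω, ℂ)} (hb : IsOpen b) :
    IsOpen {G : locallyUnivalentFunctions Ω | ∃ φ ∈ Φ, (G : C(Ω, ℂ)).comp φ ∈ b} := by
  have : {G : locallyUnivalentFunctions Ω | ∃ φ ∈ Φ, (G : C(Ω, ℂ)).comp φ ∈ b} =
      ⋃ φ ∈ Φ, (fun G : locallyUnivalentFunctions Ω => (G : C(Ω, ℂ)).comp φ) ⁻¹' b := by
    ext G
    simp
  rw [this]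
  exact isOpen_biUnion fun φ _ =>
    hb.preimage ((ContinuousMap.continuous_precomp φ).comp continuous_subtype_val)

end

theorem mainTheorem7 (Ω : Set ℂ) (hΩ : IsPlaneDomain Ω) (hconn : HasInfiniteConnectivity Ω)
    (Φ : Set C(Ω, Ω)) (hΦ : Φ ⊆ locallyUnivalentSelfMaps Ω)
    (hseq : ∃ φ : ℕ → C(Ω, Ω), (∀ n, φ n ∈ Φ) ∧ EventuallyInjective φ ∧
      ∀ K : Set Ω, IsOConvexCompact K → ∀ N : ℕ, ∃ n ≥ N,
        (φ n '' K) ∩ K = ∅ ∧ IsOConvexCompact ((φ n '' K) ∪ K)) :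
    (∃ G : C(Ω, ℂ), IsUniversalIn Φ (locallyUnivalentFunctions Ω) G) ∧
    Dense {G : locallyUnivalentFunctions Ω |
      IsUniversalIn Φ (locallyUnivalentFunctions Ω) (G : C(Ω, ℂ))} ∧
    IsGδ {G : locallyUnivalentFunctions Ω |
      IsUniversalIn Φ (locallyUnivalentFunctions Ω) (G : C(Ω, ℂ))} := by
  have : LocallyCompactSpace Ω := hΩ.1.locallyCompactSpace
  have : BaireSpace (locallyUnivalentFunctions Ω) := baireSpace_locallyUnivalentFunctions hΩ
  obtain ⟨φ, hφ, hinj, hconv⟩ := hseq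
  have hB := TopologicalSpace.isBasis_countableBasis C(Ω, ℂ)
  have hcount : {b ∈ TopologicalSpace.countableBasis C(Ω, ℂ) |
      (b ∩ locallyUnivalentFunctions Ω).Nonempty}.Countable :=
    (TopologicalSpace.countable_countableBasis _).mono (sep_subset _ _)
  have hdense : Dense {G : locallyUnivalentFunctions Ω |
      IsUniversalIn Φ (locallyUnivalentFunctions Ω) (G : C(Ω, ℂ))} := by
    rw [universal_eq_iInter hΩ hΦ hB]
    refine dense_biInter_of_isOpen (fun b hb => isOpen_setOf_comp_mem (hB.isOpen hb.1)) hcount ?_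
    rintro b ⟨hb, g, hgb, hg⟩
    refine dense_iff_inter_open.2 fun O hO ⟨f, hf⟩ => ?_
    obtain ⟨O', hO', rfl⟩ := isOpen_induced_iff.1 hO
    obtain ⟨K₁, hK₁, ε₁, hε₁, h₁⟩ :=
      ContinuousMap.exists_forall_norm_sub_lt_imp_mem (hO'.mem_nhds hf)
    obtain ⟨K₂, hK₂, ε₂, hε₂, h₂⟩ :=
      ContinuousMap.exists_forall_norm_sub_lt_imp_mem ((hB.isOpen hb).mem_nhds hgb)
    -- Closeness to `f` puts `h` in the given open set, and closeness of `h ∘ φ n` to `g` puts that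
    -- composition in `b`.
    obtain ⟨h, hh, n, e₁, e₂⟩ := exists_universal_approx hΩ (fun n => hΦ (hφ n)) hinj hconv f.2 hg
      (hK₁.union hK₂) (lt_min hε₁ hε₂)
    exact ⟨⟨h, hh⟩, h₁ h fun z hz => (e₁ z (Or.inl hz)).trans_le (min_le_left _ _), φ n, hφ n,
      h₂ _ fun z hz => (e₂ z (Or.inr hz)).trans_le (min_le_right _ _)⟩
  have : Nonempty (locallyUnivalentFunctions Ω) := ⟨⟨_, id_mem_locallyUnivalentFunctions⟩⟩
  obtain ⟨G, hG⟩ := hdense.nonempty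
  refine ⟨⟨G, hG⟩, hdense, ?_⟩
  rw [universal_eq_iInter hΩ hΦ hB]
  exact IsGδ.biInter_of_isOpen hcount fun b hb => isOpen_setOf_comp_mem (hB.isOpen hb.1)
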